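/- Let $Z>0$, $0<\sigma<1$, $0<h<1$, $0<T_{ign}<1$, $\delta>0$, and let $F:\mathbb R\to\mathbb R$ be a smoothed Arrhenius rate with ignition cut-off: $F(T)=0$ for $T\le T_{ign}$, $F(T)=\exp\!\big(Z\,\frac{T-h}{\sigma+(1-\sigma)T}\big)$ for $T\ge T_{ign}+2\delta$, and $F$ is nondecreasing on $[T_{ign},T_{ign}+2\delta]$ and smooth on $(-\infty,T_{ign}+2\delta]$ (one-sidedly at the right end point, where $F$ may have a corner). Suppose that the system $$u_t=u_{xx}+yF(w),\qquad y_t=-yF(w),\qquad w=hu+(1-h)(1-y),$$ has a front with speed $c$, i.e. there are $\hat u\in C^2(\mathbb R)$, $\hat y\in C^1(\mathbb R)$, functions of $\xi=x-ct$, such that, with $\hat w=h\hat u+(1-h)(1-\hat y)$, $$\hat u''+c\hat u'+\hat yF(\hat w)=0,\qquad c\hat y'-\hat yF(\hat w)=0,$$ $(\hat u,\hat y)\to(1,0)$ as $\xi\to-\infty$ and $(\hat u,\hat y)\to(0,1)$ as $\xi\to+\infty$. Let $$\mathcal L\begin{pmatrix}p\\q\end{pmatrix}=\begin{pmatrix}p''+cp'+F'(\hat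 w)\,\hat y\,(hp-(1-h)q)+F(\hat w)q\\ cq'-F'(\hat w)\,\hat y\,(hp-(1-h)q)-F(\hat w)q\end{pmatrix}$$ be the linearization about the front in the moving frame. Let $E_0$ be $H^1(\mathbb R;\mathbb C)$ or the space $BUC(\mathbb R;\mathbb C)$ of bounded uniformly continuous functions, let $E_\alpha=\{u: e^{\alpha\xi}u\in E_0\}$ with norm $\|u\|_\alpha=\|e^{\alpha\xi}u\|_{E_0}$, and regard $\mathcal L$ as an unbounded operator on $E_\alpha^2$ with its maximal domain: all $(p,q)\in E_\alpha^2$ with $p\in C^1$, $p'$ and $q$ locally absolutely continuous, and $\mathcal L(p,q)\in E_\alpha^2$ (equality almost everywhere). The essential spectrum is the spectrum without the isolated eigenvalues of finite algebraic multiplicity (finite rank of the Riesz projection). If $0<\alpha<c/2$, then there exists $\nu>0$ such that, for both choices of $E_0$, the essential spectrum of $\mathcal L$ on $E_\alpha^2$ is contained in the half-plane $\{\operatorname{Re}\lambda\le-\nu\}$. -/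

import Mathlib

open MeasureTheory Filter Topology

noncomputable section

namespace CombustionFront

/-! ### The reaction rate and the travelling front -/

/-- The Arrhenius law `exp (Z (T - h) / (σ + (1 - σ) T))`. -/
def arrhenius (Z σ h T : ℝ) : ℝ :=
  Real.exp (Z * ((T - h) / (σ + (1 - σ) * T)))

/-- `F` is a smoothed Arrhenius reaction rate with ignition cut-off: it vanishes up to the ignition
temperature `Tign`, is given by the Arrhenius law from `Tign + 2 δ` on, and is monotone in between.
It is smooth up to `Tign + 2 δ` inclusive, hence continuous and piecewise smooth on the line; both a
globally smooth `F` and the concrete choice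
`F T = arrhenius (Tign + 2 δ) * H_δ (T - Tign - δ)` on `[Tign, Tign + 2 δ]`, with `H_δ` a smooth
monotone approximation of the Heaviside function (which has a corner at `Tign + 2 δ`), are
instances. -/
structure IsSmoothedArrhenius (Z σ h Tign δ : ℝ) (F : ℝ → ℝ) : Prop where
  eq_zero : ∀ T, T ≤ Tign → F T = 0
  eq_arrhenius : ∀ T, Tign + 2 * δ ≤ T → F T = arrhenius Z σ h T
  monotone : MonotoneOn F (Set.Icc Tign (Tign + 2 * δ))
  smooth : ContDiffOn ℝ (⊤ : ℕ∞) F (Set.Iic (Tign + 2 * δ))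

/-- The temperature `w = h u + (1 - h) (1 - y)`. -/
def temperature (h : ℝ) (u y : ℝ → ℝ) (ξ : ℝ) : ℝ :=
  h * u ξ + (1 - h) * (1 - y ξ)

/-- `(u, y)` is a front of speed `c` of the system
`u_t = u_xx + y F(w)`, `y_t = - y F(w)`, `w = h u + (1 - h) (1 - y)`, as a function of
`ξ = x - c t`, connecting `(1, 0)` at `-∞` to `(0, 1)` at `+∞`. -/
structure IsFront (F : ℝ → ℝ) (h c : ℝ) (u y : ℝ → ℝ) : Prop where
  contDiff_u : ContDiff ℝ 2 u
  contDiff_y : ContDiff ℝ 1 y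
  eq_u : ∀ ξ, deriv (deriv u) ξ + c * deriv u ξ + y ξ * F (temperature h u y ξ) = 0
  eq_y : ∀ ξ, c * deriv y ξ - y ξ * F (temperature h u y ξ) = 0
  u_atBot : Tendsto u atBot (𝓝 1)
  y_atBot : Tendsto y atBot (𝓝 0)
  u_atTop : Tendsto u atTop (𝓝 0)
  y_atTop : Tendsto y atTop (𝓝 1)

/-! ### The function spaces -/

/-- Local absolute continuity on the line: the function is the integral of its (almost everywhere
defined) derivative. -/
def LocAC (u : ℝ → ℂ) : Prop :=
  LocallyIntegrable (deriv u) volume ∧ ∀ a b : ℝ, ∫ x in a..b, deriv u x = u b - u a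

theorem LocAC.ae_hasDerivAt {u : ℝ → ℂ} (hu : LocAC u) :
    ∀ᵐ x, HasDerivAt u (deriv u x) x := by
  filter_upwards [_root_.LocallyIntegrable.ae_hasDerivAt_integral hu.1] with x hx
  have h := (hx 0).add_const (u 0)
  refine h.congr_of_eventuallyEq (Eventually.of_forall fun y => ?_)
  simp [hu.2 0 y]

theorem LocAC.intervalIntegrable {u : ℝ → ℂ} (hu : LocAC u) (a b : ℝ) :
    IntervalIntegrable (deriv u) volume a b :=
  intervalIntegrable_iff.mpr <|
    (hu.1.integrableOn_isCompact isCompact_uIcc).mono_set Set.uIoc_subset_uIcc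

theorem LocAC.continuous {u : ℝ → ℂ} (hu : LocAC u) : Continuous u := by
  have h := intervalIntegral.continuous_primitive (μ := volume)
    (fun a b => hu.intervalIntegrable a b) 0
  have h2 : u = fun b => (∫ x in (0 : ℝ)..b, deriv u x) + u 0 := by
    funext b; simp [hu.2 0 b]
  rw [h2]
  exact h.add continuous_const

theorem LocAC.ae_deriv_add {u v : ℝ → ℂ} (hu : LocAC u) (hv : LocAC v) :
    deriv (u + v) =ᵐ[volume] deriv u + deriv v := by
  filter_upwards [hu.ae_hasDerivAt, hv.ae_hasDerivAt] with x h1 h2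
  exact (h1.add h2).deriv

theorem LocAC.ae_deriv_smul {u : ℝ → ℂ} (a : ℂ) (hu : LocAC u) :
    deriv (a • u) =ᵐ[volume] a • deriv u := by
  filter_upwards [hu.ae_hasDerivAt] with x h1
  exact (h1.const_smul a).deriv

theorem LocAC.add {u v : ℝ → ℂ} (hu : LocAC u) (hv : LocAC v) : LocAC (u + v) := by
  have he := hu.ae_deriv_add hv
  refine ⟨(hu.1.add hv.1).congr he.symm, fun a b => ?_⟩
  rw [intervalIntegral.integral_congr_ae (he.mono fun x hx _ => hx)]
  simp only [Pi.add_apply]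
  rw [intervalIntegral.integral_add (hu.intervalIntegrable a b) (hv.intervalIntegrable a b),
    hu.2, hv.2]
  ring

theorem LocAC.smul {u : ℝ → ℂ} (a : ℂ) (hu : LocAC u) : LocAC (a • u) := by
  have he := hu.ae_deriv_smul a
  refine ⟨(hu.1.smul a).congr he.symm, fun s t => ?_⟩
  rw [intervalIntegral.integral_congr_ae (he.mono fun x hx _ => hx)]
  simp only [Pi.smul_apply, smul_eq_mul]
  rw [intervalIntegral.integral_const_mul, hu.2]
  ring

theorem LocAC.zero : LocAC (0 : ℝ → ℂ) := by
  have : deriv (0 : ℝ → ℂ) = 0 := by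
    funext x; exact deriv_const x (0 : ℂ)
  refine ⟨?_, fun a b => ?_⟩ <;> rw [this]
  · exact locallyIntegrable_zero
  · simp

/-- The Sobolev space `H¹(ℝ; ℂ)`, each class being represented by its continuous member:
locally absolutely continuous functions that are square integrable with their derivative. -/
def h1Submodule : Submodule ℂ (ℝ → ℂ) where
  carrier := {u | LocAC u ∧ MemLp u 2 volume ∧ MemLp (deriv u) 2 volume}
  add_mem' := by
    rintro u v ⟨hu, hu2, hu3⟩ ⟨hv, hv2, hv3⟩
    exact ⟨hu.add hv, hu2.add hv2, (hu3.add hv3).ae_eq (hu.ae_deriv_add hv).symm⟩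
  zero_mem' := by
    refine ⟨LocAC.zero, MemLp.zero, ?_⟩
    have : deriv (0 : ℝ → ℂ) = 0 := by
      funext x; exact deriv_const x (0 : ℂ)
    rw [this]
    exact MemLp.zero
  smul_mem' := by
    rintro a u ⟨hu, hu2, hu3⟩
    exact ⟨hu.smul a, hu2.const_smul a, (hu3.const_smul a).ae_eq (hu.ae_deriv_smul a).symm⟩

/-- The space `BUC(ℝ; ℂ)` of bounded uniformly continuous functions. -/
def bucSubmodule : Submodule ℂ (ℝ → ℂ) where
  carrier := {u | UniformContinuous u ∧ ∃ C : ℝ, ∀ x, ‖u x‖ ≤ C}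
  add_mem' := by
    rintro u v ⟨hu, C, hC⟩ ⟨hv, D, hD⟩
    exact ⟨hu.add hv, C + D, fun x => (norm_add_le _ _).trans (add_le_add (hC x) (hD x))⟩
  zero_mem' := ⟨uniformContinuous_const, 0, fun x => by simp⟩
  smul_mem' := by
    rintro a u ⟨hu, C, hC⟩
    refine ⟨hu.const_smul a, ‖a‖ * C, fun x => ?_⟩
    rw [Pi.smul_apply, norm_smul]
    exact mul_le_mul_of_nonneg_left (hC x) (norm_nonneg a)

/-- Multiplication by the weight `e^{α ξ}`. -/
def weight (α : ℝ) : (ℝ → ℂ) →ₗ[ℂ] (ℝ → ℂ) where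
  toFun u := fun ξ => (Real.exp (α * ξ) : ℂ) * u ξ
  map_add' u v := by funext ξ; simp [mul_add]
  map_smul' a u := by funext ξ; simp [mul_left_comm]

theorem weight_injective (α : ℝ) : Function.Injective (weight α) := by
  intro u v huv
  funext ξ
  have h := congrFun huv ξ
  have hne : (Real.exp (α * ξ) : ℂ) ≠ 0 := by exact_mod_cast (Real.exp_pos _).ne'
  exact mul_left_cancel₀ hne h

theorem continuous_of_weight {α : ℝ} {u : ℝ → ℂ} (hu : Continuous (weight α u)) :
    Continuous u := by
  have h : u = weight (-α) (weight α u) := by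
    funext ξ
    simp [weight, ← mul_assoc, ← Complex.exp_add]
  rw [h]
  have : Continuous fun ξ : ℝ => (Real.exp (-α * ξ) : ℂ) := by fun_prop
  exact this.mul hu

/-- The weighted space over `H¹`: all `u` with `e^{α ξ} u ∈ H¹`. -/
def H1 (α : ℝ) : Type := h1Submodule.comap (weight α)

instance (α : ℝ) : AddCommGroup (H1 α) :=
  inferInstanceAs (AddCommGroup (h1Submodule.comap (weight α)))

instance (α : ℝ) : Module ℂ (H1 α) :=
  inferInstanceAs (Module ℂ (h1Submodule.comap (weight α)))

/-- The elements of the weighted space `H1 α` as functions. -/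
def H1.toFun (α : ℝ) : H1 α →ₗ[ℂ] (ℝ → ℂ) :=
  (h1Submodule.comap (weight α)).subtype

theorem H1.toFun_injective (α : ℝ) : Function.Injective (H1.toFun α) :=
  Subtype.coe_injective

theorem H1.weight_mem {α : ℝ} (u : H1 α) : weight α (H1.toFun α u) ∈ h1Submodule := u.2

theorem H1.continuous {α : ℝ} (u : H1 α) : Continuous (H1.toFun α u) :=
  continuous_of_weight (H1.weight_mem u).1.continuous

/-- `u ↦ (e^{α ξ} u, (e^{α ξ} u)')`, with values in `L² ⊕ L²`. -/
def H1.jet (α : ℝ) :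
    H1 α →ₗ[ℂ] WithLp 2 (Lp ℂ 2 (volume : Measure ℝ) × Lp ℂ 2 (volume : Measure ℝ)) where
  toFun u := WithLp.toLp 2 ((H1.weight_mem u).2.1.toLp _, (H1.weight_mem u).2.2.toLp _)
  map_add' u v := by
    rw [← WithLp.toLp_add]
    congr 1
    refine Prod.ext ?_ ?_
    · rw [Prod.fst_add, ← MemLp.toLp_add]
      refine MemLp.toLp_congr (H1.weight_mem (u + v)).2.1 _ ?_
      rw [map_add, map_add]
    · rw [Prod.snd_add, ← MemLp.toLp_add]
      refine MemLp.toLp_congr (H1.weight_mem (u + v)).2.2 _ ?_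
      rw [map_add, map_add]
      exact (H1.weight_mem u).1.ae_deriv_add (H1.weight_mem v).1
  map_smul' a u := by
    rw [RingHom.id_apply, ← WithLp.toLp_smul]
    congr 1
    refine Prod.ext ?_ ?_
    · rw [Prod.smul_fst, ← MemLp.toLp_const_smul]
      refine MemLp.toLp_congr (H1.weight_mem (a • u)).2.1 _ ?_
      rw [map_smul, map_smul]
    · rw [Prod.smul_snd, ← MemLp.toLp_const_smul]
      refine MemLp.toLp_congr (H1.weight_mem (a • u)).2.2 _ ?_
      rw [map_smul, map_smul]
      exact (H1.weight_mem u).1.ae_deriv_smul a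

theorem H1.jet_injective (α : ℝ) : Function.Injective (H1.jet α) := by
  intro u v huv
  have h1 : (H1.weight_mem u).2.1.toLp _ = (H1.weight_mem v).2.1.toLp _ :=
    congrArg (fun z => (WithLp.ofLp z).1) huv
  rw [MemLp.toLp_eq_toLp_iff] at h1
  exact H1.toFun_injective α <| weight_injective α <|
    ((H1.weight_mem u).1.continuous.ae_eq_iff_eq volume (H1.weight_mem v).1.continuous).1 h1

/-- `‖u‖² = ‖e^{α ξ} u‖²_{L²} + ‖(e^{α ξ} u)'‖²_{L²}`. -/
instance (α : ℝ) : NormedAddCommGroup (H1 α) :=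
  NormedAddCommGroup.induced (H1 α) _ (H1.jet α) (H1.jet_injective α)

instance (α : ℝ) : NormedSpace ℂ (H1 α) :=
  NormedSpace.induced ℂ (H1 α) _ (H1.jet α)

/-- The weighted space over `BUC`: all `u` with `e^{α ξ} u ∈ BUC`. -/
def BUC (α : ℝ) : Type := bucSubmodule.comap (weight α)

instance (α : ℝ) : AddCommGroup (BUC α) :=
  inferInstanceAs (AddCommGroup (bucSubmodule.comap (weight α)))

instance (α : ℝ) : Module ℂ (BUC α) :=
  inferInstanceAs (Module ℂ (bucSubmodule.comap (weight α)))

/-- The elements of the weighted space `BUC α` as functions. -/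
def BUC.toFun (α : ℝ) : BUC α →ₗ[ℂ] (ℝ → ℂ) :=
  (bucSubmodule.comap (weight α)).subtype

theorem BUC.toFun_injective (α : ℝ) : Function.Injective (BUC.toFun α) :=
  Subtype.coe_injective

theorem BUC.weight_mem {α : ℝ} (u : BUC α) : weight α (BUC.toFun α u) ∈ bucSubmodule := u.2

theorem BUC.continuous {α : ℝ} (u : BUC α) : Continuous (BUC.toFun α u) :=
  continuous_of_weight (BUC.weight_mem u).1.continuous

/-- `u ↦ e^{α ξ} u`, with values in the bounded continuous functions. -/
def BUC.weighted (α : ℝ) : BUC α →ₗ[ℂ] BoundedContinuousFunction ℝ ℂ where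
  toFun u := BoundedContinuousFunction.ofNormedAddCommGroup (weight α (BUC.toFun α u))
    (BUC.weight_mem u).1.continuous (BUC.weight_mem u).2.choose (BUC.weight_mem u).2.choose_spec
  map_add' u v := by ext ξ; simp
  map_smul' a u := by ext ξ; simp

theorem BUC.weighted_injective (α : ℝ) : Function.Injective (BUC.weighted α) := by
  intro u v huv
  refine BUC.toFun_injective α (weight_injective α (funext fun ξ => ?_))
  exact DFunLike.congr_fun huv ξ

/-- `‖u‖ = sup |e^{α ξ} u|`. -/
instance (α : ℝ) : NormedAddCommGroup (BUC α) :=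
  NormedAddCommGroup.induced (BUC α) _ (BUC.weighted α) (BUC.weighted_injective α)

instance (α : ℝ) : NormedSpace ℂ (BUC α) :=
  NormedSpace.induced ℂ (BUC α) _ (BUC.weighted α)

/-! ### The linearization about the front -/

/-- The graph of the linearization about the front `(u, y)`, with its maximal domain, in the square
of a space `X` of functions (`ι` reads an element of `X` as a function): the pairs
`((p, q), (f, g))` such that, almost everywhere,
`f = p'' + c p' + F'(w) y (h p - (1 - h) q) + F(w) q` and
`g = c q' - F'(w) y (h p - (1 - h) q) - F(w) q`. -/
def linearizationGraph {X : Type} [AddCommGroup X] [Module ℂ X] (ι : X →ₗ[ℂ] (ℝ → ℂ))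
    (F : ℝ → ℝ) (h c : ℝ) (u y : ℝ → ℝ) : Submodule ℂ ((X × X) × (X × X)) where
  carrier := {z |
    Differentiable ℝ (ι z.1.1) ∧ LocAC (deriv (ι z.1.1)) ∧ LocAC (ι z.1.2) ∧
    (∀ᵐ ξ : ℝ, ι z.2.1 ξ = deriv (deriv (ι z.1.1)) ξ + (c : ℂ) * deriv (ι z.1.1) ξ
      + ((deriv F (temperature h u y ξ) * y ξ : ℝ) : ℂ)
          * ((h : ℂ) * ι z.1.1 ξ - (1 - (h : ℂ)) * ι z.1.2 ξ)
      + (F (temperature h u y ξ) : ℂ) * ι z.1.2 ξ) ∧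
    (∀ᵐ ξ : ℝ, ι z.2.2 ξ = (c : ℂ) * deriv (ι z.1.2) ξ
      - ((deriv F (temperature h u y ξ) * y ξ : ℝ) : ℂ)
          * ((h : ℂ) * ι z.1.1 ξ - (1 - (h : ℂ)) * ι z.1.2 ξ)
      - (F (temperature h u y ξ) : ℂ) * ι z.1.2 ξ)}
  add_mem' := by
    rintro ⟨⟨p, q⟩, ⟨f, g⟩⟩ ⟨⟨p', q'⟩, ⟨f', g'⟩⟩ ⟨h1, h2, h3, h4, h5⟩ ⟨k1, k2, k3, k4, k5⟩
    simp only [Prod.mk_add_mk, Set.mem_ofPred_eq, map_add] at *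
    have e1 : deriv (ι p + ι p') = deriv (ι p) + deriv (ι p') := by
      funext ξ; exact deriv_add (h1 ξ) (k1 ξ)
    refine ⟨h1.add k1, e1 ▸ h2.add k2, h3.add k3, ?_, ?_⟩
    · rw [e1]
      filter_upwards [h2.ae_deriv_add k2, h4, k4] with ξ a1 a2 a3
      simp only [Pi.add_apply] at *
      rw [a1, a2, a3]; ring
    · filter_upwards [h3.ae_deriv_add k3, h5, k5] with ξ a1 a2 a3
      simp only [Pi.add_apply] at *
      rw [a1, a2, a3]; ring
  zero_mem' := by
    have e : deriv (0 : ℝ → ℂ) = 0 := by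
      funext x; exact deriv_const x (0 : ℂ)
    simp only [Set.mem_ofPred_eq, Prod.fst_zero, Prod.snd_zero, map_zero, e]
    exact ⟨differentiable_const 0, LocAC.zero, LocAC.zero, by simp, by simp⟩
  smul_mem' := by
    rintro a ⟨⟨p, q⟩, ⟨f, g⟩⟩ ⟨h1, h2, h3, h4, h5⟩
    simp only [Prod.smul_mk, Set.mem_ofPred_eq, map_smul] at *
    have e1 : deriv (a • ι p) = a • deriv (ι p) := by
      funext ξ; exact deriv_const_smul a (h1 ξ)
    refine ⟨h1.const_smul a, e1 ▸ h2.smul a, h3.smul a, ?_, ?_⟩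
    · rw [e1]
      filter_upwards [h2.ae_deriv_smul a, h4] with ξ a1 a2
      simp only [Pi.smul_apply, smul_eq_mul] at *
      rw [a1, a2]; ring
    · filter_upwards [h3.ae_deriv_smul a, h5] with ξ a1 a2
      simp only [Pi.smul_apply, smul_eq_mul] at *
      rw [a1, a2]; ring

/-- The linearized operator `𝓛` as an unbounded operator in `X × X`. -/
def linearization {X : Type} [AddCommGroup X] [Module ℂ X] (ι : X →ₗ[ℂ] (ℝ → ℂ))
    (F : ℝ → ℝ) (h c : ℝ) (u y : ℝ → ℝ) : (X × X) →ₗ.[ℂ] (X × X) :=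
  (linearizationGraph ι F h c u y).toLinearPMap

/-- In a space of continuous functions the value of `𝓛` is determined by its argument, so the graph
of `linearization` is `linearizationGraph`. -/
theorem linearization_graph {X : Type} [AddCommGroup X] [Module ℂ X] (ι : X →ₗ[ℂ] (ℝ → ℂ))
    (hι : Function.Injective ι) (hc : ∀ x, Continuous (ι x))
    (F : ℝ → ℝ) (h c : ℝ) (u y : ℝ → ℝ) :
    (linearization ι F h c u y).graph = linearizationGraph ι F h c u y := by
  refine Submodule.toLinearPMap_graph_eq _ ?_
  rintro ⟨⟨p, q⟩, ⟨f, g⟩⟩ ⟨-, -, -, h4, h5⟩ h0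
  obtain ⟨rfl, rfl⟩ : p = 0 ∧ q = 0 := by simpa using h0
  have e : deriv (0 : ℝ → ℂ) = 0 := by
    funext x; exact deriv_const x (0 : ℂ)
  simp only [map_zero, e] at h4 h5
  have hf : ι f = 0 := ((hc f).ae_eq_iff_eq (μ := volume) continuous_zero).1
    (h4.mono fun ξ hξ => by simpa using hξ)
  have hg : ι g = 0 := ((hc g).ae_eq_iff_eq (μ := volume) continuous_zero).1
    (h5.mono fun ξ hξ => by simpa using hξ)
  exact Prod.ext (hι (by simpa using hf)) (hι (by simpa using hg))

/-- The linearized operator on the square of the weighted space over `H¹`. -/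
def linearizationH1 (α : ℝ) (F : ℝ → ℝ) (h c : ℝ) (u y : ℝ → ℝ) :
    (H1 α × H1 α) →ₗ.[ℂ] (H1 α × H1 α) :=
  linearization (H1.toFun α) F h c u y

/-- The linearized operator on the square of the weighted space over `BUC`. -/
def linearizationBUC (α : ℝ) (F : ℝ → ℝ) (h c : ℝ) (u y : ℝ → ℝ) :
    (BUC α × BUC α) →ₗ.[ℂ] (BUC α × BUC α) :=
  linearization (BUC.toFun α) F h c u y

theorem linearizationH1_graph (α : ℝ) (F : ℝ → ℝ) (h c : ℝ) (u y : ℝ → ℝ) :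
    (linearizationH1 α F h c u y).graph = linearizationGraph (H1.toFun α) F h c u y :=
  linearization_graph _ (H1.toFun_injective α) H1.continuous F h c u y

theorem linearizationBUC_graph (α : ℝ) (F : ℝ → ℝ) (h c : ℝ) (u y : ℝ → ℝ) :
    (linearizationBUC α F h c u y).graph = linearizationGraph (BUC.toFun α) F h c u y :=
  linearization_graph _ (BUC.toFun_injective α) BUC.continuous F h c u y

/-! ### Spectrum and essential spectrum of an unbounded operator -/

section Spectrum

variable {E : Type*} [NormedAddCommGroup E] [NormedSpace ℂ E]

/-- `R` is a bounded two-sided inverse of `z - A : D(A) → E`. -/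
def IsResolventAt (A : E →ₗ.[ℂ] E) (z : ℂ) (R : E →L[ℂ] E) : Prop :=
  (∀ x : E, ∃ hx : R x ∈ A.domain, z • R x - A ⟨R x, hx⟩ = x) ∧
  ∀ x : A.domain, R (z • (x : E) - A x) = x

/-- The resolvent set of an unbounded operator. -/
def resolventSet (A : E →ₗ.[ℂ] E) : Set ℂ :=
  {z | ∃ R : E →L[ℂ] E, IsResolventAt A z R}

/-- The spectrum of an unbounded operator. -/
def spectrum (A : E →ₗ.[ℂ] E) : Set ℂ :=
  (resolventSet A)ᶜ

open Classical in
/-- The resolvent `(z - A)⁻¹`, set to zero outside the resolvent set. -/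
def resolvent (A : E →ₗ.[ℂ] E) (z : ℂ) : E →L[ℂ] E :=
  if hz : ∃ R : E →L[ℂ] E, IsResolventAt A z R then hz.choose else 0

/-- `(2πi)⁻¹ ∮ (z - A)⁻¹ dz` over the circle of centre `z₀` and radius `r`. -/
def rieszProjection (A : E →ₗ.[ℂ] E) (z₀ : ℂ) (r : ℝ) : E →L[ℂ] E :=
  (2 * Real.pi * Complex.I : ℂ)⁻¹ • ∮ z in C(z₀, r), resolvent A z

/-- `z₀` is an eigenvalue of `A`, isolated in the spectrum, of finite algebraic multiplicity (the
rank of its Riesz projection). -/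
def IsDiscreteEigenvalue (A : E →ₗ.[ℂ] E) (z₀ : ℂ) : Prop :=
  (∃ x : A.domain, (x : E) ≠ 0 ∧ A x = z₀ • (x : E)) ∧
  ∃ r : ℝ, 0 < r ∧ (∀ z : ℂ, z ≠ z₀ → dist z z₀ ≤ r → z ∈ resolventSet A) ∧
    FiniteDimensional ℂ (LinearMap.range (rieszProjection A z₀ r).toLinearMap)

/-- The essential spectrum: what remains of the spectrum without the isolated eigenvalues of finite
multiplicity. -/
def essentialSpectrum (A : E →ₗ.[ℂ] E) : Set ℂ :=
  {z | z ∈ spectrum A ∧ ¬ IsDiscreteEigenvalue A z}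

end Spectrum

end CombustionFront

end

/-! Multiplication by e^{αξ} conjugates ∂ to ∂ - α. For the weighted unknowns (P, Q) the operator 𝓛
becomes the constant coefficient part (P'' + d P' - m P, c Q' - c α Q), with d = c - 2α > 0 and m =
α (c - α) > 0, plus the reaction terms (A N + B Q, -A N - B Q), where N = h P - (1 - h) Q, A = F'(w)
y and B = F(w).

The two reaction coefficients play different roles. B need not vanish at -∞, but once A is dropped
the system is triangular: the Q equation is of first order and B ≥ 0 only adds damping to it, and
for given Q the P equation factors into two first order equations. Hence the system without A is
boundedly solvable for Re z > -m (`exists_system_resolvent`). A tends to 0 at both ends: at -∞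
because y → 0, at +∞ because w falls below the ignition temperature, where F' = 0. So A is
approximated by finite rank operators relative to the graph norm of ∂ (`isApproximable_mulOp`), and
adding it back leaves a right inverse modulo finite rank (`exists_system_parametrix`).

The rest is analytic Fredholm theory. Near each point of the half-plane Re z > -m a resolvent exists
exactly where a holomorphic determinant is nonzero. The half-plane is connected and contains a large
real z without eigenvector (`exists_system_injective`), so no determinant vanishes identically, and
only resolvent points and isolated eigenvalues with finite rank Riesz projection occur
(`graph_discrete`). Thus ν = α (c - α) works.

Since F may have a corner, A may jump, and multiplication by A need not preserve H¹ or BUC. The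
analysis therefore takes place in L² and L^∞ with the weak derivative, both through the interface
`IsDerivation`. On the weighted H¹ or BUC space, 𝓛 is the part of the Lᵖ operator, and the domain of
the latter embeds continuously in that space (`isPartOf_linearization`). This carries over
resolvents, eigenvectors and the finite rank of contour integrals (`IsPartOf.isDiscreteEigenvalue`).
-/

noncomputable section

namespace CombustionFront

/-! ### Finite rank of contour integrals -/

section FiniteRank

variable {Y : Type*} [NormedAddCommGroup Y] [NormedSpace ℂ Y]

theorem finiteDimensional_range_add {S T : Y →L[ℂ] Y}
    (hS : FiniteDimensional ℂ (LinearMap.range S.toLinearMap))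
    (hT : FiniteDimensional ℂ (LinearMap.range T.toLinearMap)) :
    FiniteDimensional ℂ (LinearMap.range (S + T).toLinearMap) := by
  refine Submodule.finiteDimensional_of_le
    (S₂ := LinearMap.range S.toLinearMap ⊔ LinearMap.range T.toLinearMap) ?_
  rintro _ ⟨x, rfl⟩
  exact Submodule.add_mem_sup ⟨x, rfl⟩ ⟨x, rfl⟩

theorem finiteDimensional_range_zero :
    FiniteDimensional ℂ (LinearMap.range (0 : Y →L[ℂ] Y).toLinearMap) := by
  have : LinearMap.range (0 : Y →L[ℂ] Y).toLinearMap = ⊥ := LinearMap.range_zero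
  rw [this]; infer_instance

theorem finiteDimensional_range_sum {ι : Type*} (s : Finset ι) {T : ι → Y →L[ℂ] Y}
    (hT : ∀ i ∈ s, FiniteDimensional ℂ (LinearMap.range (T i).toLinearMap)) :
    FiniteDimensional ℂ (LinearMap.range (∑ i ∈ s, T i).toLinearMap) := by
  classical
  induction s using Finset.induction_on with
  | empty => rw [Finset.sum_empty]; exact finiteDimensional_range_zero
  | insert i s hi ih =>
    rw [Finset.sum_insert hi]
    exact finiteDimensional_range_add (hT i (by simp)) (ih fun j hj => hT j (by simp [hj]))

theorem finiteDimensional_range_smulRight (ψ : Y →L[ℂ] ℂ) (v : Y) :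
    FiniteDimensional ℂ (LinearMap.range (ψ.smulRight v).toLinearMap) := by
  refine Submodule.finiteDimensional_of_le (S₂ := Submodule.span ℂ {v}) ?_
  rintro _ ⟨x, rfl⟩
  exact Submodule.smul_mem _ _ (Submodule.mem_span_singleton_self v)

theorem circleIntegral_comp_comm {E G : Type*} [NormedAddCommGroup E] [NormedSpace ℂ E]
    [NormedAddCommGroup G] [NormedSpace ℂ G] [CompleteSpace E] [CompleteSpace G] (L : E →L[ℂ] G)
    {f : ℂ → E} {z₀ : ℂ} {r : ℝ} (hf : CircleIntegrable f z₀ r) :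
    ∮ z in C(z₀, r), L (f z) = L (∮ z in C(z₀, r), f z) := by
  simp only [circleIntegral]
  rw [← L.intervalIntegral_comp_comm hf.out]
  simp

variable [CompleteSpace Y]

/-- Induction on the order k of the pole. Splitting φ(z) = φ(z₀) + (z - z₀) · `dslope φ z₀ z` gives
an integral of functionals times the fixed vector φ(z₀), which has rank at most one, and an integral
of the same kind with a pole of order one less. For k = 0 the integrand is holomorphic and Cauchy's
theorem gives 0. -/
theorem finiteDimensional_range_circleIntegral {z₀ : ℂ} {r ρ : ℝ} (hr : 0 < r) (hrρ : r < ρ)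
    {ψ : ℂ → Y →L[ℂ] ℂ} (hψ : DifferentiableOn ℂ ψ (Metric.ball z₀ ρ)) (k : ℕ) :
    ∀ {φ : ℂ → Y}, DifferentiableOn ℂ φ (Metric.ball z₀ ρ) →
    FiniteDimensional ℂ (LinearMap.range
      (∮ z in C(z₀, r), ((z - z₀) ^ k)⁻¹ • (ψ z).smulRight (φ z)).toLinearMap) := by
  have hsub : Metric.closedBall z₀ r ⊆ Metric.ball z₀ ρ := Metric.closedBall_subset_ball hrρ
  have hsph : Metric.sphere z₀ r ⊆ Metric.ball z₀ ρ := Metric.sphere_subset_closedBall.trans hsub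
  have hpow : ∀ k : ℕ, ContinuousOn (fun z : ℂ => ((z - z₀) ^ k)⁻¹) (Metric.sphere z₀ r) := by
    intro k
    refine ContinuousOn.inv₀ (by fun_prop) fun z hz => pow_ne_zero _ (sub_ne_zero.2 ?_)
    rintro rfl
    simp at hz
    exact hr.ne hz
  have hsm : ∀ {φ : ℂ → Y}, DifferentiableOn ℂ φ (Metric.ball z₀ ρ) →
      DifferentiableOn ℂ (fun z => (ψ z).smulRight (φ z)) (Metric.ball z₀ ρ) := by
    intro φ hφ
    have h1 : DifferentiableOn ℂ (fun z => ContinuousLinearMap.smulRightL ℂ Y Y (ψ z))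
      (Metric.ball z₀ ρ) := (ContinuousLinearMap.smulRightL ℂ Y Y).differentiable.comp_differentiableOn hψ
    exact h1.clm_apply hφ
  induction k with
  | zero =>
    intro φ hφ
    have : (∮ z in C(z₀, r), ((z - z₀) ^ 0)⁻¹ • (ψ z).smulRight (φ z)) = 0 := by
      simp only [pow_zero, inv_one, one_smul]
      refine DiffContOnCl.circleIntegral_eq_zero hr.le ?_
      exact ((hsm hφ).mono (by rwa [closure_ball _ hr.ne'])).diffContOnCl
    rw [this]; exact finiteDimensional_range_zero
  | succ k ih =>
    intro φ hφ
    have hφ1 : DifferentiableOn ℂ (dslope φ z₀) (Metric.ball z₀ ρ) :=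
      (Complex.differentiableOn_dslope (Metric.ball_mem_nhds _ (hr.trans hrρ))).2 hφ
    have hc : ContinuousOn (fun z => ((z - z₀) ^ (k + 1))⁻¹ • ψ z) (Metric.sphere z₀ r) :=
      (hpow (k + 1)).smul (hψ.continuousOn.mono hsph)
    have e : (∮ z in C(z₀, r), ((z - z₀) ^ (k + 1))⁻¹ • (ψ z).smulRight (φ z)) =
        (∮ z in C(z₀, r), ((z - z₀) ^ (k + 1))⁻¹ • ψ z).smulRight (φ z₀) +
        ∮ z in C(z₀, r), ((z - z₀) ^ k)⁻¹ • (ψ z).smulRight (dslope φ z₀ z) := by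
      have h1 : (∮ z in C(z₀, r), (((z - z₀) ^ (k + 1))⁻¹ • ψ z).smulRight (φ z₀)) =
          (∮ z in C(z₀, r), ((z - z₀) ^ (k + 1))⁻¹ • ψ z).smulRight (φ z₀) :=
        circleIntegral_comp_comm
          ((ContinuousLinearMap.smulRightL ℂ Y Y).flip (φ z₀)) (hc.circleIntegrable hr.le)
      rw [← h1, ← circleIntegral.integral_add]
      · refine circleIntegral.integral_congr hr.le fun z hz => ?_
        have hz0 : z - z₀ ≠ 0 := by
          refine sub_ne_zero.2 ?_
          rintro rfl
          simp at hz
          exact hr.ne hz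
        have h2 : φ z = φ z₀ + (z - z₀) • dslope φ z₀ z := by
          rw [sub_smul_dslope]; abel
        ext y
        simp only [smul_apply, ContinuousLinearMap.smulRight_apply,
          add_apply]
        conv_lhs => rw [h2]
        rw [smul_add, smul_add, smul_smul, smul_smul, smul_smul, smul_smul, smul_eq_mul]
        congr 2
        rw [pow_succ]; field_simp
      · exact ContinuousOn.circleIntegrable hr.le
          (((ContinuousLinearMap.smulRightL ℂ Y Y).flip (φ z₀)).continuous.comp_continuousOn hc)
      · exact ContinuousOn.circleIntegrable hr.le
          ((hpow k).smul ((hsm hφ1).continuousOn.mono hsph))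
    rw [e]
    exact finiteDimensional_range_add (finiteDimensional_range_smulRight _ _) (ih hφ1)

end FiniteRank

/-! ### Analytic Fredholm theory for a graph with local parametrices -/

section Graph

variable {Y : Type*} [NormedAddCommGroup Y] [NormedSpace ℂ Y]

/-- `R` is a bounded two-sided inverse of `z - A`, where `A` is the operator with graph `Γ`. -/
def IsGraphResolvent (Γ : Submodule ℂ (Y × Y)) (z : ℂ) (R : Y →L[ℂ] Y) : Prop :=
  (∀ y, (R y, z • R y - y) ∈ Γ) ∧ ∀ x f, (x, f) ∈ Γ → R (z • x - f) = x

/-- The set of points at which the operator with graph `Γ` has a resolvent. -/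
def graphResolventSet (Γ : Submodule ℂ (Y × Y)) : Set ℂ :=
  {z | ∃ R, IsGraphResolvent Γ z R}

/-- A right inverse of `z₀ - A` modulo the finite rank operator `∑ i, π i ⊗ e i`, which is a
bijection onto the domain of `A`. -/
structure IsParametrix (Γ : Submodule ℂ (Y × Y)) (z₀ : ℂ) (W : Y →L[ℂ] Y) {n : ℕ}
    (π : Fin n → Y →L[ℂ] ℂ) (e : Fin n → Y) : Prop where
  mem : ∀ y, (W y, z₀ • W y - y + ∑ i, π i y • e i) ∈ Γ
  surj : ∀ x f, (x, f) ∈ Γ → ∃ y, W y = x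
  inj : Function.Injective W

/-- With B(z) = (1 + (z - z₀) W)⁻¹, a Neumann series, the parametrix identity becomes (z - A) W B(z)
y = y - ∑ π i (B(z) y) • e i. Inverting z - A is thus reduced to inverting the matrix M(z) = 1 - (π
i (B(z) (e j))), and D is its determinant. A null vector of M(z) produces an eigenvector. If D(z) ≠
0, Cramer's rule writes the resolvent as a holomorphic part plus D(z)⁻¹ times a finite sum of
holomorphic rank one operators. -/
theorem IsParametrix.exists_local [CompleteSpace Y] {Γ : Submodule ℂ (Y × Y)}
    (hΓ : ∀ f, ((0 : Y), f) ∈ Γ → f = 0) {z₀ : ℂ} {W : Y →L[ℂ] Y} {n : ℕ}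
    {π : Fin n → Y →L[ℂ] ℂ} {e : Fin n → Y} (h : IsParametrix Γ z₀ W π e) :
    ∃ ρ > 0, ∃ (D : ℂ → ℂ) (A : ℂ → Y →L[ℂ] Y) (ψ : Fin n → ℂ → Y →L[ℂ] ℂ) (φ : Fin n → ℂ → Y),
      DifferentiableOn ℂ D (Metric.ball z₀ ρ) ∧ DifferentiableOn ℂ A (Metric.ball z₀ ρ) ∧
      (∀ i, DifferentiableOn ℂ (ψ i) (Metric.ball z₀ ρ)) ∧
      (∀ i, DifferentiableOn ℂ (φ i) (Metric.ball z₀ ρ)) ∧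
      ∀ z ∈ Metric.ball z₀ ρ, (D z = 0 → ∃ x, x ≠ 0 ∧ (x, z • x) ∈ Γ) ∧
        (D z ≠ 0 → IsGraphResolvent Γ z
          (A z + (D z)⁻¹ • ∑ i, (ψ i z).smulRight (φ i z))) := by
  set ρ : ℝ := (‖W‖ + 1)⁻¹ with hρ
  have hρ0 : 0 < ρ := by positivity
  set B : ℂ → Y →L[ℂ] Y := fun z => Ring.inverse (1 + (z - z₀) • W) with hB
  have hunit : ∀ z ∈ Metric.ball z₀ ρ, IsUnit (1 + (z - z₀) • W) := by
    intro z hz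
    have : ‖-((z - z₀) • W)‖ < 1 := by
      rw [norm_neg, norm_smul]
      rw [Metric.mem_ball, dist_eq_norm] at hz
      calc ‖z - z₀‖ * ‖W‖ ≤ ρ * ‖W‖ := by gcongr
        _ < 1 := by
          rw [hρ, inv_mul_lt_one₀ (by positivity)]; linarith
    simpa using isUnit_one_sub_of_norm_lt_one this
  have hBd : DifferentiableOn ℂ B (Metric.ball z₀ ρ) := by
    intro z hz
    have h1 : DifferentiableAt ℂ (fun z : ℂ => 1 + (z - z₀) • W) z := by fun_prop
    have h2 := (differentiableAt_inverse (𝕜 := ℂ) (hunit z hz)).comp z h1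
    exact h2.differentiableWithinAt
  have hBl : ∀ z ∈ Metric.ball z₀ ρ, ∀ y, B z y + (z - z₀) • W (B z y) = y := by
    intro z hz y
    have := congrArg (fun T : Y →L[ℂ] Y => T y) (Ring.mul_inverse_cancel _ (hunit z hz))
    simpa using this
  have hBr : ∀ z ∈ Metric.ball z₀ ρ, ∀ y, B z (y + (z - z₀) • W y) = y := by
    intro z hz y
    have := congrArg (fun T : Y →L[ℂ] Y => T y) (Ring.inverse_mul_cancel _ (hunit z hz))
    simpa using this
  have hmem : ∀ z ∈ Metric.ball z₀ ρ, ∀ y,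
      (W (B z y), z • W (B z y) - y + ∑ i, π i (B z y) • e i) ∈ Γ := by
    intro z hz y
    have h1 := h.mem (B z y)
    have h2 := hBl z hz y
    have aux : ∀ v w y' : Y, v + (z - z₀) • w = y' → z • w - y' = z₀ • w - v := by
      rintro v w _ rfl
      rw [sub_smul]; abel
    rwa [aux _ _ _ h2]
  set M : ℂ → Matrix (Fin n) (Fin n) ℂ := fun z => 1 - Matrix.of fun i j => π i (B z (e j))
    with hM
  have hMv : ∀ z (v : Fin n → ℂ) i,
      (M z).mulVec v i = v i - π i (B z (∑ j, v j • e j)) := by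
    intro z v i
    simp only [hM, Matrix.sub_mulVec, Matrix.one_mulVec, Pi.sub_apply]
    simp only [Matrix.mulVec, dotProduct, Matrix.of_apply, map_sum, map_smul, smul_eq_mul]
    congr 1
    exact Finset.sum_congr rfl fun j _ => mul_comm _ _
  have hBe : ∀ y, DifferentiableOn ℂ (fun z => B z y) (Metric.ball z₀ ρ) := fun y =>
    hBd.clm_apply (differentiableOn_const y)
  have hMd : ∀ i j, DifferentiableOn ℂ (fun z => M z i j) (Metric.ball z₀ ρ) := by
    intro i j
    simp only [hM, Matrix.sub_apply, Matrix.of_apply]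
    exact (differentiableOn_const _).sub ((π i).differentiable.comp_differentiableOn (hBe (e j)))
  have hdet : ∀ (N : ℂ → Matrix (Fin n) (Fin n) ℂ),
      (∀ i j, DifferentiableOn ℂ (fun z => N z i j) (Metric.ball z₀ ρ)) →
      DifferentiableOn ℂ (fun z => (N z).det) (Metric.ball z₀ ρ) := by
    intro N hN
    simp only [Matrix.det_apply]
    refine DifferentiableOn.fun_sum fun σ _ => ?_
    refine DifferentiableOn.const_smul ?_ _
    exact DifferentiableOn.fun_finsetProd fun i _ => hN _ _
  have hadj : ∀ i j, DifferentiableOn ℂ (fun z => (M z).adjugate i j) (Metric.ball z₀ ρ) := by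
    intro i j
    simp only [Matrix.adjugate_apply]
    refine hdet _ fun k l => ?_
    by_cases hk : k = j
    · subst hk; simp
    · simpa [Matrix.updateRow_ne hk] using hMd k l
  refine ⟨ρ, hρ0, fun z => (M z).det, fun z => W ∘L B z,
    fun i z => ∑ j, (M z).adjugate i j • (π j ∘L B z), fun i z => W (B z (e i)),
    hdet M hMd, ?_, ?_, ?_, fun z hz => ⟨fun hD => ?_, fun hD => ?_⟩⟩
  · exact ((ContinuousLinearMap.compL ℂ Y Y Y) W).differentiable.comp_differentiableOn hBd
  · intro i
    refine DifferentiableOn.fun_sum fun j _ => (hadj i j).smul ?_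
    exact ((ContinuousLinearMap.compL ℂ Y Y ℂ) (π j)).differentiable.comp_differentiableOn hBd
  · exact fun i => W.differentiable.comp_differentiableOn (hBe (e i))
  · obtain ⟨v, hv, hMv0⟩ := Matrix.exists_mulVec_eq_zero_iff.2 hD
    have hv1 : ∀ i, π i (B z (∑ j, v j • e j)) = v i := fun i => by
      have := hMv z v i
      rw [hMv0] at this
      exact (sub_eq_zero.1 this.symm).symm
    refine ⟨W (B z (∑ j, v j • e j)), fun h0 => hv ?_, ?_⟩
    · have h1 : B z (∑ j, v j • e j) = 0 := h.inj (by simpa using h0)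
      funext i
      rw [← hv1 i, h1]; simp
    · have := hmem z hz (∑ j, v j • e j)
      simp only [hv1] at this
      simpa using this
  · set R : Y →L[ℂ] Y := W ∘L B z + (M z).det⁻¹ • ∑ i,
      (∑ j, (M z).adjugate i j • (π j ∘L B z)).smulRight (W (B z (e i))) with hR
    have hR1 : ∀ y, (R y, z • R y - y) ∈ Γ := by
      intro y
      -- The ansatz x = W B(z) (y + ∑ v i • e i) solves (z - A) x = y as soon as v i = π i (B(z) (y
      -- + ∑ v j • e j)), that is, M(z) v = (π i (B(z) y)).
      set v : Fin n → ℂ := (M z).det⁻¹ • (M z).adjugate.mulVec (fun j => π j (B z y)) with hv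
      have hMvv : (M z).mulVec v = fun j => π j (B z y) := by
        rw [hv, Matrix.mulVec_smul, Matrix.mulVec_mulVec, Matrix.mul_adjugate, Matrix.smul_mulVec,
          Matrix.one_mulVec, smul_smul, inv_mul_cancel₀ hD, one_smul]
      have hRy : R y = W (B z (y + ∑ i, v i • e i)) := by
        simp only [hR, hv, add_apply, ContinuousLinearMap.comp_apply,
          smul_apply, sum_apply,
          ContinuousLinearMap.smulRight_apply, map_add, map_sum, map_smul, Matrix.mulVec,
          dotProduct, Pi.smul_apply, smul_eq_mul, Finset.smul_sum, smul_smul]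
      have h1 : ∀ i, π i (B z (y + ∑ i, v i • e i)) = v i := by
        intro i
        have h2 := hMv z v i
        rw [hMvv] at h2
        rw [map_add, map_add]
        linear_combination h2
      have h3 := hmem z hz (y + ∑ i, v i • e i)
      simp only [h1] at h3
      rw [hRy]
      convert h3 using 2
      abel
    refine ⟨hR1, fun x f hxf => ?_⟩
    have h1 := Γ.sub_mem hxf (hR1 (z • x - f))
    set x' := x - R (z • x - f) with hx'
    have h2 : (x', z • x') ∈ Γ := by
      convert h1 using 1
      refine Prod.ext rfl ?_
      simp only [hx', Prod.snd_sub, smul_sub]; abel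
    -- The difference x' satisfies A x' = z x'. Writing x' = W y turns this into a vector in the
    -- kernel of M(z), so y = 0.
    obtain ⟨y, hy⟩ := h.surj _ _ h2
    have h3 := Γ.sub_mem h2 (h.mem y)
    have h4 := hΓ _ (by simpa [hy] using h3)
    have h5 : y + (z - z₀) • W y = ∑ i, π i y • e i := by
      rw [sub_smul, hy, ← sub_eq_zero, ← h4]; abel
    have h6 : B z (∑ i, π i y • e i) = y := by rw [← h5, hBr z hz]
    have h7 : (M z).mulVec (fun i => π i y) = 0 := by
      funext i
      rw [hMv, h6]; simp
    have h8 : (fun i => π i y) = 0 := by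
      by_contra hne
      exact hD (Matrix.exists_mulVec_eq_zero_iff.1 ⟨_, hne, h7⟩)
    have h9 : y = 0 := by
      rw [← h6]
      have : ∀ i, π i y = 0 := fun i => congrFun h8 i
      simp [this]
    have : x' = 0 := by rw [← hy, h9]; simp
    exact (sub_eq_zero.1 this).symm

theorem IsGraphResolvent.eq_zero_of_mem {Γ : Submodule ℂ (Y × Y)} {z : ℂ} {R : Y →L[ℂ] Y}
    (h : IsGraphResolvent Γ z R) {x : Y} (hx : (x, z • x) ∈ Γ) : x = 0 := by
  simpa using (h.2 _ _ hx).symm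

/-- The zeros of the holomorphic determinant near z₀ are either everything or isolated from z₀. -/
theorem eventually_mem_or_eventually_notMem_graphResolventSet [CompleteSpace Y]
    {Γ : Submodule ℂ (Y × Y)} (hΓ : ∀ f, ((0 : Y), f) ∈ Γ → f = 0) {z₀ : ℂ} {W : Y →L[ℂ] Y} {n : ℕ}
    {π : Fin n → Y →L[ℂ] ℂ} {e : Fin n → Y} (h : IsParametrix Γ z₀ W π e) :
    (∀ᶠ z in 𝓝 z₀, z ∉ graphResolventSet Γ) ∨ ∀ᶠ z in 𝓝[≠] z₀, z ∈ graphResolventSet Γ := by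
  obtain ⟨ρ, hρ, D, A, ψ, φ, hD, -, -, -, hz⟩ := h.exists_local hΓ
  have hb := Metric.ball_mem_nhds z₀ hρ
  rcases (hD.analyticAt hb).eventually_eq_zero_or_eventually_ne_zero with h0 | h0
  · left
    filter_upwards [h0, hb] with z h1 h2
    rintro ⟨R, hR⟩
    obtain ⟨x, hx, hx'⟩ := (hz z h2).1 h1
    exact hx (hR.eq_zero_of_mem hx')
  · right
    filter_upwards [h0, nhdsWithin_le_nhds hb] with z h1 h2
    exact ⟨_, (hz z h2).2 h1⟩

/-- A graph with local parametrices on a connected set that meets the resolvent set has only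
isolated eigenvalues of finite multiplicity there. -/
theorem graph_discrete [CompleteSpace Y]
    {Γ : Submodule ℂ (Y × Y)} (hΓ : ∀ f, ((0 : Y), f) ∈ Γ → f = 0) {Ω : Set ℂ}
    (hΩ : IsPreconnected Ω)
    (hpar : ∀ z₀ ∈ Ω, ∃ (n : ℕ) (W : Y →L[ℂ] Y) (π : Fin n → Y →L[ℂ] ℂ) (e : Fin n → Y),
      IsParametrix Γ z₀ W π e)
    (hne : (Ω ∩ graphResolventSet Γ).Nonempty) {z₀ : ℂ} (hz₀ : z₀ ∈ Ω) :
    z₀ ∈ graphResolventSet Γ ∨ (∃ x, x ≠ 0 ∧ (x, z₀ • x) ∈ Γ) ∧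
      ∃ r : ℝ, 0 < r ∧ (∀ z, z ≠ z₀ → dist z z₀ ≤ r → z ∈ graphResolventSet Γ) ∧
        ∃ R : ℂ → Y →L[ℂ] Y, ContinuousOn R (Metric.sphere z₀ r) ∧
          (∀ z ∈ Metric.sphere z₀ r, IsGraphResolvent Γ z (R z)) ∧
          FiniteDimensional ℂ (LinearMap.range (∮ z in C(z₀, r), R z).toLinearMap) := by
  -- Connectedness: the points with a punctured neighbourhood in the resolvent set and the points
  -- with a neighbourhood off it are two disjoint open sets covering Ω. The resolvent point in Ω can
  -- only lie in the first, so the second misses Ω.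
  have key : ∀ z₀ ∈ Ω, ∀ᶠ z in 𝓝[≠] z₀, z ∈ graphResolventSet Γ := by
    set U₁ : Set ℂ := {z | ∀ᶠ w in 𝓝[≠] z, w ∈ graphResolventSet Γ} with hU₁
    set U₂ : Set ℂ := {z | ∀ᶠ w in 𝓝 z, w ∉ graphResolventSet Γ} with hU₂
    have ho₂ : IsOpen U₂ := isOpen_setOfPred_eventually_nhds
    have ho₁ : IsOpen U₁ := by
      rw [isOpen_iff_mem_nhds]
      intro z hz
      have h2 := eventually_nhdsWithin_iff.1 (eventually_eventually_nhdsWithin.2 hz)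
      filter_upwards [h2] with w hw
      by_cases hwz : w = z
      · rw [hwz]; exact hz
      · have := hw hwz
        rw [isOpen_compl_singleton.nhdsWithin_eq hwz] at this
        exact this.filter_mono nhdsWithin_le_nhds
    have hcov : Ω ⊆ U₁ ∪ U₂ := by
      intro z hz
      obtain ⟨n, W, π, e, h⟩ := hpar z hz
      exact (eventually_mem_or_eventually_notMem_graphResolventSet hΓ h).symm
    have hdisj : ¬ (Ω ∩ (U₁ ∩ U₂)).Nonempty := by
      rintro ⟨z, -, h1, h2⟩
      simp only [hU₁, hU₂, Set.mem_ofPred_eq] at h1 h2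
      obtain ⟨w, hw1, hw2⟩ := (h1.and (h2.filter_mono nhdsWithin_le_nhds)).exists
      exact hw2 hw1
    obtain ⟨z₁, hz₁, hr⟩ := hne
    intro z hz
    rcases hcov hz with h | h
    · exact h
    · refine absurd (hΩ U₁ U₂ ho₁ ho₂ hcov ⟨z₁, hz₁, ?_⟩ ⟨z, hz, h⟩) hdisj
      rcases hcov hz₁ with h' | h'
      · exact h'
      · exact absurd hr h'.self_of_nhds
  obtain ⟨n, W, π, e, hP⟩ := hpar z₀ hz₀
  obtain ⟨ρ, hρ, D, A, ψ, φ, hD, hA, hψ, hφ, hz⟩ := hP.exists_local hΓ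
  have hb := Metric.ball_mem_nhds z₀ hρ
  by_cases hD0 : D z₀ = 0
  swap
  · exact Or.inl ⟨_, (hz z₀ (Metric.mem_ball_self hρ)).2 hD0⟩
  refine Or.inr ⟨(hz z₀ (Metric.mem_ball_self hρ)).1 hD0, ?_⟩
  have hDa := hD.analyticAt hb
  have hnz : ¬ ∀ᶠ z in 𝓝 z₀, D z = 0 := by
    intro h0
    obtain ⟨w, ⟨hw1, hw2⟩, ⟨R, hR⟩⟩ :=
      (((h0.and hb).filter_mono nhdsWithin_le_nhds).and (key z₀ hz₀)).exists
    obtain ⟨x, hx, hx'⟩ := (hz w hw2).1 hw1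
    exact hx (hR.eq_zero_of_mem hx')
  -- D = (z - z₀)^k g with g(z₀) ≠ 0. The factor g⁻¹ is later absorbed into the functionals ψ i,
  -- which leaves a pole of order k.
  obtain ⟨k, g, hg, hg0, hDg⟩ := hDa.exists_eventuallyEq_pow_smul_nonzero_iff.2 hnz
  obtain ⟨ρ', hρ', hball⟩ := Metric.eventually_nhds_iff_ball.1
    ((hDg.and (hg.eventually_analyticAt.and (hg.continuousAt.eventually_ne hg0))).and hb)
  have hsub : Metric.ball z₀ ρ' ⊆ Metric.ball z₀ ρ := fun z hz => (hball z hz).2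
  have hDne : ∀ z ∈ Metric.ball z₀ ρ', z ≠ z₀ → D z ≠ 0 := by
    intro z hz hne
    obtain ⟨⟨h1, -, h2⟩, -⟩ := hball z hz
    rw [h1]
    exact smul_ne_zero (pow_ne_zero _ (sub_ne_zero.2 hne)) h2
  have hr0 : 0 < ρ' / 2 := by positivity
  have hrρ : ρ' / 2 < ρ' := by linarith
  have hsphere : Metric.sphere z₀ (ρ' / 2) ⊆ Metric.ball z₀ ρ' :=
    Metric.sphere_subset_closedBall.trans (Metric.closedBall_subset_ball hrρ)
  have hsne : ∀ z ∈ Metric.sphere z₀ (ρ' / 2), z ≠ z₀ := by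
    rintro z hz rfl
    simp at hz
    linarith
  refine ⟨ρ' / 2, hr0, fun z hne hd => ?_,
    fun z => A z + (D z)⁻¹ • ∑ i, (ψ i z).smulRight (φ i z), ?_, fun z hzs => ?_, ?_⟩
  · have hzb : z ∈ Metric.ball z₀ ρ' := lt_of_le_of_lt hd hrρ
    exact ⟨_, (hz z (hsub hzb)).2 (hDne z hzb hne)⟩
  · refine ContinuousOn.add (hA.continuousOn.mono (hsphere.trans hsub)) (ContinuousOn.fun_smul ?_ ?_)
    · exact (hD.continuousOn.mono (hsphere.trans hsub)).inv₀
        fun z hz => hDne z (hsphere hz) (hsne z hz)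
    · refine continuousOn_finsetSum _ fun i _ => ?_
      have h1 : ContinuousOn (fun z => ContinuousLinearMap.smulRightL ℂ Y Y (ψ i z))
          (Metric.sphere z₀ (ρ' / 2)) :=
        (ContinuousLinearMap.smulRightL ℂ Y Y).continuous.comp_continuousOn
          ((hψ i).continuousOn.mono (hsphere.trans hsub))
      exact h1.clm_apply ((hφ i).continuousOn.mono (hsphere.trans hsub))
  · exact (hz z (hsub (hsphere hzs))).2 (hDne z (hsphere hzs) (hsne z hzs))
  · have hψ' : ∀ i, DifferentiableOn ℂ (fun z => (g z)⁻¹ • ψ i z) (Metric.ball z₀ ρ') := by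
      intro i
      refine DifferentiableOn.smul (DifferentiableOn.inv ?_ fun z hz => (hball z hz).1.2.2)
        ((hψ i).mono hsub)
      exact fun z hz => (hball z hz).1.2.1.differentiableAt.differentiableWithinAt
    have hcont : ∀ i, CircleIntegrable (fun z => ((z - z₀) ^ k)⁻¹ •
        ((g z)⁻¹ • ψ i z).smulRight (φ i z)) z₀ (ρ' / 2) := by
      intro i
      refine ContinuousOn.circleIntegrable hr0.le (ContinuousOn.fun_smul ?_ ?_)
      · exact ContinuousOn.inv₀ (by fun_prop)
          fun z hz => pow_ne_zero _ (sub_ne_zero.2 (hsne z hz))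
      · have h1 : ContinuousOn (fun z => ContinuousLinearMap.smulRightL ℂ Y Y ((g z)⁻¹ • ψ i z))
            (Metric.sphere z₀ (ρ' / 2)) :=
          (ContinuousLinearMap.smulRightL ℂ Y Y).continuous.comp_continuousOn
            ((hψ' i).continuousOn.mono hsphere)
        exact h1.clm_apply ((hφ i).continuousOn.mono (hsphere.trans hsub))
    have e : (∮ z in C(z₀, ρ' / 2), A z + (D z)⁻¹ • ∑ i, (ψ i z).smulRight (φ i z)) =
        ∑ i, ∮ z in C(z₀, ρ' / 2), ((z - z₀) ^ k)⁻¹ • ((g z)⁻¹ • ψ i z).smulRight (φ i z) := by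
      -- The holomorphic part of the resolvent contributes nothing, so only the finitely many polar
      -- rank one terms remain.
      have h0 : (∮ z in C(z₀, ρ' / 2), A z) = 0 := by
        refine DiffContOnCl.circleIntegral_eq_zero hr0.le ?_
        refine (hA.mono ?_).diffContOnCl
        rw [closure_ball _ hr0.ne']
        exact (Metric.closedBall_subset_ball hrρ).trans hsub
      rw [← circleIntegral.integral_fun_sum fun i _ => hcont i]
      conv_rhs => rw [← zero_add (circleIntegral _ _ _), ← h0]
      rw [← circleIntegral.integral_add]
      · refine circleIntegral.integral_congr hr0.le fun z hzs => ?_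
        change A z + _ = A z + _
        congr 1
        rw [(hball z (hsphere hzs)).1.1, Finset.smul_sum]
        refine Finset.sum_congr rfl fun i _ => ?_
        ext y
        simp [mul_comm, mul_left_comm, mul_assoc, smul_smul]
      · exact ContinuousOn.circleIntegrable hr0.le (hA.continuousOn.mono (hsphere.trans hsub))
      · convert CircleIntegrable.sum Finset.univ fun i _ => hcont i using 1
        ext z : 1
        simp
    rw [e]
    exact finiteDimensional_range_sum _ fun i _ =>
      finiteDimensional_range_circleIntegral hr0 hrρ (hψ' i) k ((hφ i).mono hsub)

/-- A graph with a parametrix and no eigenvector has a resolvent. -/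
theorem IsParametrix.mem_graphResolventSet [CompleteSpace Y] {Γ : Submodule ℂ (Y × Y)}
    (hΓ : ∀ f, ((0 : Y), f) ∈ Γ → f = 0) {z₀ : ℂ} {W : Y →L[ℂ] Y} {n : ℕ}
    {π : Fin n → Y →L[ℂ] ℂ} {e : Fin n → Y} (h : IsParametrix Γ z₀ W π e)
    (hinj : ∀ x, (x, z₀ • x) ∈ Γ → x = 0) : z₀ ∈ graphResolventSet Γ := by
  obtain ⟨ρ, hρ, D, A, ψ, φ, -, -, -, -, hz⟩ := h.exists_local hΓ
  obtain ⟨h1, h2⟩ := hz z₀ (Metric.mem_ball_self hρ)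
  refine ⟨_, h2 fun h0 => ?_⟩
  obtain ⟨x, hx, hx'⟩ := h1 h0
  exact hx (hinj x hx')

end Graph

/-! ### Resolvents of unbounded operators and transfer between spaces -/

section Transfer

variable {E : Type*} [NormedAddCommGroup E] [NormedSpace ℂ E]

theorem IsResolventAt.unique {A : E →ₗ.[ℂ] E} {z : ℂ} {R R' : E →L[ℂ] E}
    (h : IsResolventAt A z R) (h' : IsResolventAt A z R') : R = R' := by
  ext x
  obtain ⟨hx, e⟩ := h.1 x
  have := h'.2 ⟨R x, hx⟩
  rw [e] at this
  exact this.symm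

theorem IsResolventAt.resolvent_eq {A : E →ₗ.[ℂ] E} {z : ℂ} {R : E →L[ℂ] E}
    (h : IsResolventAt A z R) : resolvent A z = R := by
  have hz : ∃ R : E →L[ℂ] E, IsResolventAt A z R := ⟨R, h⟩
  rw [resolvent, dif_pos hz]
  exact hz.choose_spec.unique h

theorem IsResolventAt.sub_eq {A : E →ₗ.[ℂ] E} {z w : ℂ} {R S : E →L[ℂ] E}
    (hR : IsResolventAt A z R) (hS : IsResolventAt A w S) :
    R - S = (w - z) • (R ∘L S) := by
  ext x
  obtain ⟨hx, e⟩ := hS.1 x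
  have h1 := hR.2 ⟨S x, hx⟩
  have h2 : z • S x - A ⟨S x, hx⟩ = x + (z - w) • S x := by
    rw [sub_smul, ← sub_eq_zero, ← sub_eq_zero.2 e]; abel
  rw [h2, map_add, map_smul] at h1
  simp only [sub_apply, smul_apply, ContinuousLinearMap.comp_apply]
  change R x + (z - w) • R (S x) = S x at h1
  rw [← neg_sub z w, neg_smul, sub_eq_iff_eq_add, ← sub_eq_iff_eq_add', sub_neg_eq_add, h1]

/-- Needed for the Riesz integral over a circle to commute with bounded maps. Continuity follows
from the resolvent identity once the resolvent is known to be locally bounded. -/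
theorem continuousOn_resolvent (A : E →ₗ.[ℂ] E) :
    ContinuousOn (resolvent A) (resolventSet A) := by
  intro w hw
  obtain ⟨S, hS⟩ := hw
  have key : ∀ z ∈ resolventSet A, ‖z - w‖ * (2 * (‖S‖ + 1)) ≤ 1 →
      ‖resolvent A z - resolvent A w‖ ≤ ‖z - w‖ * (2 * ‖S‖ * ‖S‖) := by
    rintro z ⟨R, hR⟩ hz
    rw [hR.resolvent_eq, hS.resolvent_eq]
    have h1 : ‖R - S‖ ≤ ‖z - w‖ * (‖R‖ * ‖S‖) := by
      rw [hR.sub_eq hS, norm_smul, norm_sub_rev]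
      gcongr
      exact ContinuousLinearMap.opNorm_comp_le _ _
    have h2 : ‖R‖ ≤ ‖S‖ + ‖R - S‖ := by
      simpa using norm_add_le S (R - S)
    -- For ‖z - w‖ ‖S‖ ≤ 1/2 the resolvent identity gives ‖R - S‖ ≤ ‖R‖ / 2, which is absorbed on
    -- the left.
    have h3 : ‖R‖ ≤ 2 * ‖S‖ := by
      have h4 : ‖z - w‖ * (‖R‖ * ‖S‖) ≤ ‖R‖ / 2 := by
        have := norm_nonneg R
        have := norm_nonneg S
        have := norm_nonneg (z - w)
        have h5 : ‖z - w‖ * ‖S‖ ≤ 1 / 2 := by nlinarith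
        nlinarith
      linarith
    refine h1.trans ?_
    gcongr
  rw [ContinuousWithinAt, tendsto_iff_norm_sub_tendsto_zero]
  have ht : Tendsto (fun z : ℂ => ‖z - w‖) (𝓝[resolventSet A] w) (𝓝 0) := by
    have : Tendsto (fun z : ℂ => ‖z - w‖) (𝓝 w) (𝓝 ‖w - w‖) := by
      apply Continuous.tendsto; fun_prop
    simp only [sub_self, norm_zero] at this
    exact this.mono_left nhdsWithin_le_nhds
  have ht2 : Tendsto (fun z : ℂ => ‖z - w‖ * (2 * (‖S‖ + 1))) (𝓝[resolventSet A] w) (𝓝 0) := by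
    simpa using ht.mul_const (2 * (‖S‖ + 1))
  refine squeeze_zero' (Eventually.of_forall fun _ => norm_nonneg _) ?_
    (by simpa using ht.mul_const (2 * ‖S‖ * ‖S‖))
  filter_upwards [self_mem_nhdsWithin, ht2.eventually_le_const zero_lt_one] with z hz h1
  exact key z hz h1

/-! ### Parts of operators: transfer from the large space to the small one -/

variable {Y : Type*} [NormedAddCommGroup Y] [NormedSpace ℂ Y]

/-- `A` is the part in `E` of the operator in `Y` with graph `Γ`, and the domain of the latter is
continuously embedded in `E`. -/
structure IsPartOf (A : E →ₗ.[ℂ] E) (Γ : Submodule ℂ (Y × Y)) (J : E →L[ℂ] Y) : Prop where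
  inj : Function.Injective J
  mem_graph : ∀ x f, (x, f) ∈ A.graph ↔ (J x, J f) ∈ Γ
  domain_le : ∃ C, ∀ x f, (x, f) ∈ Γ → ∃ e, J e = x ∧ ‖e‖ ≤ C * (‖x‖ + ‖f‖)

/-- R maps into the domain of the large operator, which lies in E with control by the graph norm.
Hence R ∘ J factors through J, and the factor S is bounded in the norm of E. -/
theorem IsPartOf.exists_isResolventAt {A : E →ₗ.[ℂ] E} {Γ : Submodule ℂ (Y × Y)} {J : E →L[ℂ] Y}
    (h : IsPartOf A Γ J) {z : ℂ} {R : Y →L[ℂ] Y} (hR : IsGraphResolvent Γ z R) :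
    ∃ S : E →L[ℂ] E, IsResolventAt A z S ∧ J ∘L S = R ∘L J := by
  obtain ⟨C, hC⟩ := h.domain_le
  choose S hS hSn using fun e : E => hC _ _ (hR.1 (J e))
  have hC0 : ∀ e, ‖S e‖ ≤ |C| * (‖R‖ * ‖J‖ + (‖z‖ * (‖R‖ * ‖J‖) + ‖J‖)) * ‖e‖ := by
    intro e
    have h1 : ‖J e‖ ≤ ‖J‖ * ‖e‖ := J.le_opNorm e
    have h2 : ‖R (J e)‖ ≤ ‖R‖ * (‖J‖ * ‖e‖) := (R.le_opNorm _).trans (by gcongr)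
    have h3 : ‖z • R (J e) - J e‖ ≤ ‖z‖ * (‖R‖ * (‖J‖ * ‖e‖)) + ‖J‖ * ‖e‖ := by
      refine (norm_sub_le _ _).trans (add_le_add ?_ h1)
      rw [norm_smul]; gcongr
    calc ‖S e‖ ≤ |C| * (‖R (J e)‖ + ‖z • R (J e) - J e‖) :=
          (hSn e).trans (by gcongr; exact le_abs_self C)
      _ ≤ |C| * (‖R‖ * (‖J‖ * ‖e‖) + (‖z‖ * (‖R‖ * (‖J‖ * ‖e‖)) + ‖J‖ * ‖e‖)) := by gcongr
      _ = _ := by ring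
  let S' : E →ₗ[ℂ] E :=
    { toFun := S
      map_add' := fun a b => h.inj (by simp [hS])
      map_smul' := fun a b => h.inj (by simp [hS]) }
  refine ⟨S'.mkContinuous _ hC0, ⟨fun e => ?_, fun x => ?_⟩, ?_⟩
  · have h1 : (S e, z • S e - e) ∈ A.graph := by
      rw [h.mem_graph, map_sub, map_smul, hS]
      exact hR.1 (J e)
    rw [LinearPMap.mem_graph_iff] at h1
    obtain ⟨y, hy1, hy2⟩ := h1
    simp only at hy1 hy2
    change ∃ hx : S e ∈ A.domain, z • S e - A ⟨S e, hx⟩ = e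
    refine ⟨hy1 ▸ y.2, ?_⟩
    have : (⟨S e, hy1 ▸ y.2⟩ : A.domain) = y := Subtype.ext hy1.symm
    rw [this, hy2]; abel
  · refine h.inj ?_
    change J (S _) = _
    rw [hS, map_sub, map_smul]
    exact hR.2 _ _ ((h.mem_graph _ _).1 (A.mem_graph x))
  · ext e
    exact hS e

/-- Eigenvectors lie in the domain, hence in E. J intertwines the two families of resolvents, so
also their contour integrals, and since J is injective the rank in E is at most the rank in Y. -/
theorem IsPartOf.isDiscreteEigenvalue [CompleteSpace E] [CompleteSpace Y] {A : E →ₗ.[ℂ] E}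
    {Γ : Submodule ℂ (Y × Y)} {J : E →L[ℂ] Y} (h : IsPartOf A Γ J) {z₀ : ℂ}
    (hev : ∃ x, x ≠ 0 ∧ (x, z₀ • x) ∈ Γ) {r : ℝ} (hr : 0 < r)
    (hres : ∀ z, z ≠ z₀ → dist z z₀ ≤ r → z ∈ graphResolventSet Γ)
    {R : ℂ → Y →L[ℂ] Y} (hRc : ContinuousOn R (Metric.sphere z₀ r))
    (hR : ∀ z ∈ Metric.sphere z₀ r, IsGraphResolvent Γ z (R z))
    (hfin : FiniteDimensional ℂ (LinearMap.range (∮ z in C(z₀, r), R z).toLinearMap)) :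
    IsDiscreteEigenvalue A z₀ := by
  have hres' : ∀ z ∈ graphResolventSet Γ, z ∈ resolventSet A := by
    rintro z ⟨R, hR⟩
    obtain ⟨S, hS, -⟩ := h.exists_isResolventAt hR
    exact ⟨S, hS⟩
  refine ⟨?_, r, hr, fun z h1 h2 => hres' z (hres z h1 h2), ?_⟩
  · obtain ⟨x, hx, hxΓ⟩ := hev
    obtain ⟨C, hC⟩ := h.domain_le
    obtain ⟨e, rfl, -⟩ := hC _ _ hxΓ
    rw [← map_smul, ← h.mem_graph, LinearPMap.mem_graph_iff] at hxΓ
    obtain ⟨y, hy1, hy2⟩ := hxΓ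
    simp only at hy1 hy2
    refine ⟨y, ?_, by rw [hy2, hy1]⟩
    rw [hy1]
    rintro rfl
    simp at hx
  · have hS : ∀ z ∈ Metric.sphere z₀ r, z ∈ resolventSet A ∧ J ∘L resolvent A z = R z ∘L J := by
      intro z hz
      obtain ⟨S, hS, hSJ⟩ := h.exists_isResolventAt (hR z hz)
      refine ⟨⟨S, hS⟩, ?_⟩
      rw [hS.resolvent_eq, hSJ]
    have hc1 : CircleIntegrable (resolvent A) z₀ r :=
      ((continuousOn_resolvent A).mono fun z hz => (hS z hz).1).circleIntegrable hr.le
    have hc2 : CircleIntegrable R z₀ r := hRc.circleIntegrable hr.le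
    have e : J ∘L (∮ z in C(z₀, r), resolvent A z) = (∮ z in C(z₀, r), R z) ∘L J := by
      have e1 := circleIntegral_comp_comm ((ContinuousLinearMap.compL ℂ E E Y) J) hc1
      have e2 := circleIntegral_comp_comm ((ContinuousLinearMap.compL ℂ E Y Y).flip J) hc2
      simp only [ContinuousLinearMap.flip_apply, ContinuousLinearMap.compL_apply] at e1 e2
      rw [← e1, ← e2]
      exact circleIntegral.integral_congr hr.le fun z hz => (hS z hz).2
    have hfin2 : FiniteDimensional ℂ (LinearMap.range
        ((∮ z in C(z₀, r), resolvent A z)).toLinearMap) := by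
      have hle : (LinearMap.range ((∮ z in C(z₀, r), resolvent A z)).toLinearMap).map
          J.toLinearMap ≤ LinearMap.range (∮ z in C(z₀, r), R z).toLinearMap := by
        rintro _ ⟨_, ⟨x, rfl⟩, rfl⟩
        exact ⟨J x, (DFunLike.congr_fun e x).symm⟩
      have h1 := Submodule.finiteDimensional_of_le hle
      exact (Submodule.equivMapOfInjective J.toLinearMap h.inj _).symm.finiteDimensional
    refine Submodule.finiteDimensional_of_le
      (S₂ := LinearMap.range ((∮ z in C(z₀, r), resolvent A z)).toLinearMap) ?_
    rintro _ ⟨x, rfl⟩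
    exact Submodule.smul_mem _ _ ⟨x, rfl⟩

theorem IsPartOf.notMem_essentialSpectrum [CompleteSpace E] [CompleteSpace Y] {A : E →ₗ.[ℂ] E}
    {Γ : Submodule ℂ (Y × Y)} {J : E →L[ℂ] Y} (h : IsPartOf A Γ J)
    (hΓ : ∀ f, ((0 : Y), f) ∈ Γ → f = 0) {Ω : Set ℂ} (hΩ : IsPreconnected Ω)
    (hpar : ∀ z₀ ∈ Ω, ∃ (n : ℕ) (W : Y →L[ℂ] Y) (π : Fin n → Y →L[ℂ] ℂ) (e : Fin n → Y),
      IsParametrix Γ z₀ W π e)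
    (hne : ∃ z ∈ Ω, ∀ x, (x, z • x) ∈ Γ → x = 0) {z₀ : ℂ} (hz₀ : z₀ ∈ Ω) :
    z₀ ∉ essentialSpectrum A := by
  have hne' : (Ω ∩ graphResolventSet Γ).Nonempty := by
    obtain ⟨z, hz, hinj⟩ := hne
    obtain ⟨n, W, π, e, hP⟩ := hpar z hz
    exact ⟨z, hz, hP.mem_graphResolventSet hΓ hinj⟩
  rintro ⟨hs, hd⟩
  rcases graph_discrete hΓ hΩ hpar hne' hz₀ with ⟨R, hR⟩ | ⟨hev, r, hr, hres, R, hRc, hR, hfin⟩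
  · obtain ⟨S, hS, -⟩ := h.exists_isResolventAt hR
    exact hs ⟨S, hS⟩
  · exact hd (h.isDiscreteEigenvalue hev hr hres hRc hR hfin)

end Transfer

/-! ### Primitives of locally integrable functions -/

section Primitive

/-- `u` is a primitive of the locally integrable function `f`. -/
def IsPrimitive (u f : ℝ → ℂ) : Prop :=
  LocallyIntegrable f volume ∧ ∀ a b : ℝ, ∫ x in a..b, f x = u b - u a

variable {u v f g : ℝ → ℂ}

theorem LocAC.isPrimitive (hu : LocAC u) : IsPrimitive u (deriv u) := hu

theorem IsPrimitive.ae_hasDerivAt (hu : IsPrimitive u f) : ∀ᵐ x, HasDerivAt u (f x) x := by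
  filter_upwards [_root_.LocallyIntegrable.ae_hasDerivAt_integral hu.1] with x hx
  have h := (hx 0).add_const (u 0)
  refine h.congr_of_eventuallyEq (Eventually.of_forall fun y => ?_)
  simp [hu.2 0 y]

theorem IsPrimitive.congr (hu : IsPrimitive u f) (hfg : f =ᵐ[volume] g) : IsPrimitive u g :=
  ⟨hu.1.congr hfg, fun a b => by
    rw [← hu.2 a b]
    exact intervalIntegral.integral_congr_ae (hfg.mono fun x hx _ => hx.symm)⟩

theorem IsPrimitive.deriv_ae_eq (hu : IsPrimitive u f) : deriv u =ᵐ[volume] f :=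
  hu.ae_hasDerivAt.mono fun _ hx => hx.deriv

theorem IsPrimitive.locAC (hu : IsPrimitive u f) : LocAC u :=
  hu.congr hu.deriv_ae_eq.symm

theorem IsPrimitive.continuous (hu : IsPrimitive u f) : Continuous u := hu.locAC.continuous

theorem IsPrimitive.ae_eq (hu : IsPrimitive u f) (hv : IsPrimitive u g) : f =ᵐ[volume] g :=
  hu.deriv_ae_eq.symm.trans hv.deriv_ae_eq

theorem IsPrimitive.intervalIntegrable (hu : IsPrimitive u f) (a b : ℝ) :
    IntervalIntegrable f volume a b :=
  intervalIntegrable_iff.mpr <|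
    (hu.1.integrableOn_isCompact isCompact_uIcc).mono_set Set.uIoc_subset_uIcc

theorem IsPrimitive.add (hu : IsPrimitive u f) (hv : IsPrimitive v g) :
    IsPrimitive (fun x => u x + v x) (fun x => f x + g x) :=
  ⟨hu.1.add hv.1, fun a b => by
    rw [intervalIntegral.integral_add (hu.intervalIntegrable a b) (hv.intervalIntegrable a b),
      hu.2, hv.2]
    ring⟩

theorem IsPrimitive.const_mul (k : ℂ) (hu : IsPrimitive u f) :
    IsPrimitive (fun x => k * u x) (fun x => k * f x) :=
  ⟨hu.1.smul k, fun a b => by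
    rw [intervalIntegral.integral_const_mul, hu.2]
    ring⟩

theorem IsPrimitive.sub (hu : IsPrimitive u f) (hv : IsPrimitive v g) :
    IsPrimitive (fun x => u x - v x) (fun x => f x - g x) := by
  have := hu.add (hv.const_mul (-1))
  simpa only [neg_mul, one_mul, ← sub_eq_add_neg] using this

theorem isPrimitive_zero : IsPrimitive (fun _ => 0) (fun _ => 0) :=
  ⟨locallyIntegrable_zero, fun a b => by simp⟩

theorem isPrimitive_of_hasDerivAt (h : ∀ x, HasDerivAt u (f x) x) (hf : Continuous f) :
    IsPrimitive u f :=
  ⟨hf.locallyIntegrable, fun a b =>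
    intervalIntegral.integral_eq_sub_of_hasDerivAt (fun x _ => h x) (hf.intervalIntegrable a b)⟩

theorem IsPrimitive.hasDerivAt (hu : IsPrimitive u f) (hf : Continuous f) (x : ℝ) :
    HasDerivAt u (f x) x := by
  have h := (intervalIntegral.integral_hasDerivAt_right (hf.intervalIntegrable 0 x)
    (hf.stronglyMeasurableAtFilter _ _) hf.continuousAt).add_const (u 0)
  refine h.congr_of_eventuallyEq (Eventually.of_forall fun y => ?_)
  simp [hu.2 0 y]

theorem IsPrimitive.comp_neg (hu : IsPrimitive u f) :
    IsPrimitive (fun x => u (-x)) (fun x => -f (-x)) := by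
  refine ⟨?_, fun a b => ?_⟩
  · have h1 : LocallyIntegrable (fun x => f (-x)) volume := by
      have h2 := (locallyIntegrable_map_homeomorph (Homeomorph.neg ℝ) (f := f) (μ := volume)).1
      have h3 : Measure.map (Homeomorph.neg ℝ) (volume : Measure ℝ) = volume :=
        Measure.map_neg_eq_self volume
      exact h2 (by rw [h3]; exact hu.1)
    exact h1.neg
  · rw [intervalIntegral.integral_neg, intervalIntegral.integral_comp_neg, hu.2]
    ring

/-- Absolute continuity in the ε-δ sense is what allows a function with almost everywhere vanishing
derivative to be declared constant in the product rule below. -/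
theorem IsPrimitive.absolutelyContinuousOnInterval (hu : IsPrimitive u f) (a b : ℝ) :
    AbsolutelyContinuousOnInterval u a b := by
  have hi := hu.intervalIntegrable a b
  have hre : IntervalIntegrable (fun x => (f x).re) volume a b :=
    ⟨hi.1.re, hi.2.re⟩
  have him : IntervalIntegrable (fun x => (f x).im) volume a b :=
    ⟨hi.1.im, hi.2.im⟩
  have hcst : ∀ k : ℂ, AbsolutelyContinuousOnInterval (fun _ : ℝ => k) a b := fun k =>
    (contDiff_const.contDiffOn).absolutelyContinuousOnInterval
  have h1 := (hre.absolutelyContinuousOnInterval_intervalIntegral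
    (c := a) (by simp)).fun_smul (hcst 1)
  have h2 := (him.absolutelyContinuousOnInterval_intervalIntegral
    (c := a) (by simp)).fun_smul (hcst Complex.I)
  have h3 := ((hcst (u a)).fun_add h1).fun_add h2
  suffices h : u = fun i => u a + (∫ v in a..i, (f v).re) • (1 : ℂ) +
      (∫ v in a..i, (f v).im) • Complex.I by
    rw [h]; exact h3
  funext x
  have h4 := hu.2 a x
  have h5 := hu.intervalIntegrable a x
  have e1 : (∫ v in a..x, (f v).re) = (∫ v in a..x, f v).re :=
    intervalIntegral.intervalIntegral_re h5
  have e2 : (∫ v in a..x, (f v).im) = (∫ v in a..x, f v).im :=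
    intervalIntegral.intervalIntegral_im h5
  rw [e1, e2, h4]
  apply Complex.ext <;> simp

/-- The product u v minus the integral of f v + u g is absolutely continuous with derivative zero
almost everywhere, hence constant on every interval. -/
theorem IsPrimitive.mul (hu : IsPrimitive u f) (hv : IsPrimitive v g) :
    IsPrimitive (fun x => u x * v x) (fun x => f x * v x + u x * g x) := by
  have hloc : LocallyIntegrable (fun x => f x * v x + u x * g x) volume := by
    refine LocallyIntegrable.add ?_ ?_
    · have := hu.1.smul_continuous hv.continuous
      simpa [mul_comm] using this
    · have := hv.1.continuous_smul hu.continuous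
      simpa using this
  refine ⟨hloc, fun a b => ?_⟩
  set w : ℝ → ℂ := fun x => ∫ t in (0 : ℝ)..x, (f t * v t + u t * g t) with hw
  have hwp : IsPrimitive w (fun x => f x * v x + u x * g x) := by
    refine ⟨hloc, fun s t => ?_⟩
    have hii : ∀ s t : ℝ, IntervalIntegrable (fun x => f x * v x + u x * g x) volume s t :=
      fun s t => intervalIntegrable_iff.mpr <|
        (hloc.integrableOn_isCompact isCompact_uIcc).mono_set Set.uIoc_subset_uIcc
    rw [hw]
    exact (intervalIntegral.integral_interval_sub_left (hii 0 t) (hii 0 s)).symm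
  have hac : AbsolutelyContinuousOnInterval (fun x => u x • v x - w x) a b :=
    ((hu.absolutelyContinuousOnInterval a b).fun_smul
      (hv.absolutelyContinuousOnInterval a b)).fun_sub (hwp.absolutelyContinuousOnInterval a b)
  obtain ⟨C, hC⟩ := hac.const_of_ae_hasDerivAt_zero (by
    filter_upwards [hu.ae_hasDerivAt, hv.ae_hasDerivAt, hwp.ae_hasDerivAt] with x h1 h2 h3 _
    have := (h1.fun_mul h2).fun_sub h3
    simpa using this)
  have h1 := hC a (by simp)
  have h2 := hC b (by simp)
  simp only [smul_eq_mul] at h1 h2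
  rw [hwp.2]
  linear_combination h1 - h2

theorem IsPrimitive.const_of_ae_eq_zero (hu : IsPrimitive u f) (hf : f =ᵐ[volume] 0) (x y : ℝ) :
    u x = u y := by
  have := (hu.congr hf).2 y x
  simp only [Pi.zero_apply, intervalIntegral.integral_zero] at this
  exact (sub_eq_zero.1 this.symm)

end Primitive

/-! ### First order equations in `Lᵖ` -/

section Majorant

open ENNReal

/-- `∫₀^∞ e^{-κ t} |g (x + t)| dt`. -/
def expMajorant (κ : ℝ) (g : ℝ → ℂ) (x : ℝ) : ℝ≥0∞ :=
  ∫⁻ t in Set.Ioi (0 : ℝ), ENNReal.ofReal (Real.exp (-κ * t)) * ‖g (x + t)‖ₑ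

theorem lintegral_exp_neg {κ : ℝ} (hκ : 0 < κ) :
    ∫⁻ t in Set.Ioi (0 : ℝ), ENNReal.ofReal (Real.exp (-κ * t)) = ENNReal.ofReal κ⁻¹ := by
  rw [← ofReal_integral_eq_lintegral_ofReal (integrableOn_exp_mul_Ioi (by linarith) 0)
    (Eventually.of_forall fun t => (Real.exp_pos _).le), integral_exp_mul_Ioi (by linarith)]
  congr 1
  simp [neg_div_neg_eq]

theorem expMajorant_congr {κ : ℝ} {g g' : ℝ → ℂ} (h : g =ᵐ[volume] g') (x : ℝ) :
    expMajorant κ g x = expMajorant κ g' x := by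
  refine lintegral_congr_ae (ae_restrict_of_ae ?_)
  filter_upwards [(measurePreserving_add_left volume x).quasiMeasurePreserving.ae h] with t ht
  rw [ht]

theorem expMajorant_le_top {κ : ℝ} (hκ : 0 < κ) (g : ℝ → ℂ) (x : ℝ) :
    expMajorant κ g x ≤ ENNReal.ofReal κ⁻¹ * eLpNorm g ∞ volume := by
  rw [← lintegral_exp_neg hκ, ← lintegral_mul_const _ (by fun_prop)]
  refine lintegral_mono_ae (ae_restrict_of_ae ?_)
  have h : ∀ᵐ y, ‖g y‖ₑ ≤ eLpNorm g ∞ volume := by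
    rw [eLpNorm_exponent_top]; exact ae_le_eLpNormEssSup
  filter_upwards [(measurePreserving_add_left volume x).quasiMeasurePreserving.ae h] with t ht
  gcongr

/-- Cauchy–Schwarz after splitting e^{-κt} into two factors e^{-κt/2}, one of which stays with g. -/
theorem expMajorant_sq_le {κ : ℝ} (hκ : 0 < κ) {g : ℝ → ℂ} (hg : Measurable g) (x : ℝ) :
    expMajorant κ g x ^ (2 : ℝ) ≤ ENNReal.ofReal κ⁻¹ *
      ∫⁻ t in Set.Ioi (0 : ℝ), ENNReal.ofReal (Real.exp (-κ * t)) * ‖g (x + t)‖ₑ ^ (2 : ℝ) := by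
  have hsq : ∀ t : ℝ, ENNReal.ofReal (Real.exp (-κ * t / 2)) ^ (2 : ℝ) =
      ENNReal.ofReal (Real.exp (-κ * t)) := by
    intro t
    rw [ENNReal.ofReal_rpow_of_pos (Real.exp_pos _), ← Real.exp_mul]
    congr 2; ring
  have h := ENNReal.lintegral_mul_le_Lp_mul_Lq (volume.restrict (Set.Ioi (0 : ℝ)))
    Real.HolderConjugate.two_two
    (f := fun t => ENNReal.ofReal (Real.exp (-κ * t / 2)))
    (g := fun t => ENNReal.ofReal (Real.exp (-κ * t / 2)) * ‖g (x + t)‖ₑ)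
    (by fun_prop) (by fun_prop)
  have e : ∀ t : ℝ, ENNReal.ofReal (Real.exp (-κ * t / 2)) *
      (ENNReal.ofReal (Real.exp (-κ * t / 2)) * ‖g (x + t)‖ₑ) =
      ENNReal.ofReal (Real.exp (-κ * t)) * ‖g (x + t)‖ₑ := by
    intro t
    rw [← mul_assoc, ← hsq, ENNReal.rpow_two, sq]
  simp only [Pi.mul_apply, e, hsq, ENNReal.mul_rpow_of_nonneg _ _ zero_le_two] at h
  rw [lintegral_exp_neg hκ] at h
  refine (ENNReal.rpow_le_rpow h zero_le_two).trans_eq ?_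
  rw [ENNReal.mul_rpow_of_nonneg _ _ zero_le_two, ← ENNReal.rpow_mul, ← ENNReal.rpow_mul]
  norm_num

/-- Young's inequality for the kernel e^{-κt}, of L¹ norm κ⁻¹: the pointwise Cauchy–Schwarz bound is
integrated by Tonelli and translation invariance. -/
theorem lintegral_sq_expMajorant_le {κ : ℝ} (hκ : 0 < κ) {g : ℝ → ℂ} (hg : Measurable g) :
    ∫⁻ x, expMajorant κ g x ^ (2 : ℝ) ≤
      ENNReal.ofReal κ⁻¹ ^ (2 : ℝ) * ∫⁻ x, ‖g x‖ₑ ^ (2 : ℝ) := by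
  calc ∫⁻ x, expMajorant κ g x ^ (2 : ℝ)
      ≤ ∫⁻ x, ENNReal.ofReal κ⁻¹ * ∫⁻ t in Set.Ioi (0 : ℝ),
          ENNReal.ofReal (Real.exp (-κ * t)) * ‖g (x + t)‖ₑ ^ (2 : ℝ) :=
        lintegral_mono fun x => expMajorant_sq_le hκ hg x
    _ = ENNReal.ofReal κ⁻¹ * ∫⁻ t in Set.Ioi (0 : ℝ), ∫⁻ x,
          ENNReal.ofReal (Real.exp (-κ * t)) * ‖g (x + t)‖ₑ ^ (2 : ℝ) := by
        rw [lintegral_const_mul' _ _ ENNReal.ofReal_ne_top, lintegral_lintegral_swap]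
        fun_prop
    _ = ENNReal.ofReal κ⁻¹ * ∫⁻ t in Set.Ioi (0 : ℝ),
          ENNReal.ofReal (Real.exp (-κ * t)) * ∫⁻ x, ‖g x‖ₑ ^ (2 : ℝ) := by
        congr 1
        refine lintegral_congr fun t => ?_
        rw [lintegral_const_mul' _ _ ENNReal.ofReal_ne_top]
        congr 1
        exact lintegral_add_right_eq_self (fun x => ‖g x‖ₑ ^ (2 : ℝ)) t
    _ = _ := by
        rw [lintegral_mul_const _ (by fun_prop), lintegral_exp_neg hκ, ENNReal.rpow_two, sq,
          mul_assoc]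

theorem eLpNorm_two_rpow (f : ℝ → ℂ) :
    eLpNorm f 2 volume ^ (2 : ℝ) = ∫⁻ x, ‖f x‖ₑ ^ (2 : ℝ) := by
  have := eLpNorm_nnreal_pow_eq_lintegral (f := f) (p := 2) (μ := volume) two_ne_zero
  simpa using this

theorem expMajorant_lt_top {p : ℝ≥0∞} (hp : p = 2 ∨ p = ∞) {κ : ℝ} (hκ : 0 < κ) {g : ℝ → ℂ}
    (hg : MemLp g p volume) (x : ℝ) : expMajorant κ g x < ∞ := by
  rcases hp with rfl | rfl
  · rw [expMajorant_congr hg.1.aemeasurable.ae_eq_mk]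
    set g' := hg.1.aemeasurable.mk g
    have hg' : Measurable g' := hg.1.aemeasurable.measurable_mk
    have h2 : ∫⁻ t, ‖g' t‖ₑ ^ (2 : ℝ) < ∞ := by
      rw [← eLpNorm_two_rpow, ← eLpNorm_congr_ae hg.1.aemeasurable.ae_eq_mk]
      exact ENNReal.rpow_lt_top_of_nonneg zero_le_two hg.2.ne
    have h3 := expMajorant_sq_le hκ hg' x
    have h4 : ∫⁻ t in Set.Ioi (0 : ℝ), ENNReal.ofReal (Real.exp (-κ * t)) *
        ‖g' (x + t)‖ₑ ^ (2 : ℝ) ≤ ∫⁻ t, ‖g' t‖ₑ ^ (2 : ℝ) := by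
      rw [← lintegral_add_left_eq_self (fun t => ‖g' t‖ₑ ^ (2 : ℝ)) x]
      refine (setLIntegral_mono' measurableSet_Ioi fun t ht => ?_).trans
        (setLIntegral_le_lintegral _ _)
      have h5 : ENNReal.ofReal (Real.exp (-κ * t)) ≤ 1 := by
        rw [ENNReal.ofReal_le_one, Real.exp_le_one_iff]
        have := mul_pos hκ (Set.mem_Ioi.1 ht)
        linarith
      calc _ ≤ 1 * ‖g' (x + t)‖ₑ ^ (2 : ℝ) := by gcongr
        _ = _ := one_mul _
    have h6 : expMajorant κ g' x ^ (2 : ℝ) < ∞ :=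
      h3.trans_lt (ENNReal.mul_lt_top ENNReal.ofReal_lt_top (h4.trans_lt h2))
    exact (ENNReal.rpow_lt_top_iff_of_pos zero_lt_two).1 h6
  · exact (expMajorant_le_top hκ g x).trans_lt (ENNReal.mul_lt_top ENNReal.ofReal_lt_top hg.2)

theorem eLpNorm_le_of_enorm_le_expMajorant {p : ℝ≥0∞} (hp : p = 2 ∨ p = ∞) {κ : ℝ} (hκ : 0 < κ)
    {g v : ℝ → ℂ} (hg : MemLp g p volume) (hv : ∀ x, ‖v x‖ₑ ≤ expMajorant κ g x) :
    eLpNorm v p volume ≤ ENNReal.ofReal κ⁻¹ * eLpNorm g p volume := by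
  rcases hp with rfl | rfl
  · rw [← ENNReal.rpow_le_rpow_iff (zero_lt_two' ℝ), ENNReal.mul_rpow_of_nonneg _ _ zero_le_two,
      eLpNorm_two_rpow, eLpNorm_congr_ae hg.1.aemeasurable.ae_eq_mk, eLpNorm_two_rpow]
    refine le_trans (lintegral_mono fun x => ?_)
      (lintegral_sq_expMajorant_le hκ hg.1.aemeasurable.measurable_mk)
    rw [← expMajorant_congr hg.1.aemeasurable.ae_eq_mk]
    exact ENNReal.rpow_le_rpow (hv x) zero_le_two
  · rw [eLpNorm_exponent_top]
    exact eLpNormEssSup_le_of_ae_enorm_bound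
      (Eventually.of_forall fun x => (hv x).trans (expMajorant_le_top hκ g x))

end Majorant

/-! ### Solvability, uniqueness and a priori bounds for first order equations -/

section FirstOrder

open ENNReal

theorem setLIntegral_Ioi_add (f : ℝ → ℝ≥0∞) (x : ℝ) :
    ∫⁻ s in Set.Ioi x, f s = ∫⁻ t in Set.Ioi (0 : ℝ), f (x + t) := by
  have h := (measurePreserving_add_left volume x).setLIntegral_comp_preimage_emb
    (measurableEmbedding_addLeft x) f (Set.Ioi x)
  rw [← h]
  congr 2
  ext t; simp

theorem exists_primitive_of_re_pos {κ : ℝ → ℂ} (hκ : Continuous κ) {κ₀ : ℝ}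
    (hre : ∀ x, κ₀ ≤ (κ x).re) :
    ∃ θ : ℝ → ℂ, (∀ x, HasDerivAt θ (κ x) x) ∧
      ∀ x s, x ≤ s → κ₀ * (s - x) ≤ (θ s - θ x).re := by
  refine ⟨fun x => ∫ t in (0 : ℝ)..x, κ t, fun x =>
    intervalIntegral.integral_hasDerivAt_right (hκ.intervalIntegrable 0 x)
      (hκ.stronglyMeasurableAtFilter _ _) hκ.continuousAt, fun x s hxs => ?_⟩
  rw [intervalIntegral.integral_interval_sub_left (hκ.intervalIntegrable 0 s)
    (hκ.intervalIntegrable 0 x)]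
  have e : (∫ t in x..s, (κ t).re) = (∫ t in x..s, κ t).re :=
    intervalIntegral.intervalIntegral_re (hκ.intervalIntegrable x s)
  rw [← e]
  have h1 : ∫ _ in x..s, κ₀ ≤ ∫ t in x..s, (κ t).re :=
    intervalIntegral.integral_mono_on hxs (by simp)
      ((Complex.continuous_re.comp hκ).intervalIntegrable x s) fun t _ => hre t
  simpa [mul_comm] using h1

/-- Bounded solvability in `Lᵖ` of `v' = κ v - g` when `Re κ ≥ κ₀ > 0`. -/
theorem exists_solution_growing {p : ℝ≥0∞} (hp : p = 2 ∨ p = ∞) {κ : ℝ → ℂ} (hκ : Continuous κ)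
    {κ₀ : ℝ} (hκ₀ : 0 < κ₀) (hre : ∀ x, κ₀ ≤ (κ x).re) {g : ℝ → ℂ} (hg : MemLp g p volume) :
    ∃ v : ℝ → ℂ, IsPrimitive v (fun x => κ x * v x - g x) ∧ MemLp v p volume ∧
      eLpNorm v p volume ≤ ENNReal.ofReal κ₀⁻¹ * eLpNorm g p volume := by
  obtain ⟨θ, hθ, hθre⟩ := exists_primitive_of_re_pos hκ hre
  have hθc : Continuous θ := continuous_iff_continuousAt.2 fun x => (hθ x).continuousAt
  -- The bounded solution is v(x) = ∫_x^∞ e^{θ(x) - θ(s)} g(s) ds, with θ' = κ. Its kernel has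
  -- modulus at most e^{-κ₀ (s - x)}, so v is dominated by `expMajorant κ₀ g`.
  have hmaj : ∀ x, ∫⁻ s in Set.Ioi x, ‖Complex.exp (θ x) * (Complex.exp (-θ s) * g s)‖ₑ ≤
      expMajorant κ₀ g x := by
    intro x
    rw [setLIntegral_Ioi_add]
    refine setLIntegral_mono' measurableSet_Ioi fun t ht => ?_
    rw [← mul_assoc, ← Complex.exp_add, enorm_mul]
    gcongr
    rw [← ofReal_norm, Complex.norm_exp]
    refine ENNReal.ofReal_le_ofReal (Real.exp_le_exp.2 ?_)
    have := hθre x (x + t) (by linarith [Set.mem_Ioi.1 ht])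
    simp only [Complex.sub_re, add_sub_cancel_left] at this
    simp only [Complex.add_re, Complex.neg_re]
    linarith
  have hgInt : ∀ x, IntegrableOn (fun s => Complex.exp (-θ s) * g s) (Set.Ioi x) volume := by
    intro x
    have h1 : IntegrableOn (fun s => Complex.exp (θ x) * (Complex.exp (-θ s) * g s))
        (Set.Ioi x) volume := by
      refine ⟨?_, (hmaj x).trans_lt (expMajorant_lt_top hp hκ₀ hg x)⟩
      have h2 : Continuous fun s => Complex.exp (θ x) * Complex.exp (-θ s) := by fun_prop
      exact (h2.aestronglyMeasurable.mul hg.1).restrict.congr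
        (Eventually.of_forall fun s => by simp [mul_assoc])
    have h3 := h1.const_mul (Complex.exp (θ x))⁻¹
    refine h3.congr (Eventually.of_forall fun s => ?_)
    simp
  have hG : IsPrimitive (fun x => ∫ s in Set.Ioi x, Complex.exp (-θ s) * g s)
      (fun s => -(Complex.exp (-θ s) * g s)) := by
    refine ⟨LocallyIntegrable.neg fun x => ⟨Set.Ioi (x - 1), Ioi_mem_nhds (by linarith),
      hgInt (x - 1)⟩, fun a b => ?_⟩
    rw [intervalIntegral.integral_neg,
      ← intervalIntegral.integral_Ioi_sub_Ioi' (hgInt a) (hgInt b)]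
    ring
  have hE : IsPrimitive (fun x => Complex.exp (θ x)) (fun x => Complex.exp (θ x) * κ x) :=
    isPrimitive_of_hasDerivAt (fun x => (hθ x).cexp) (by fun_prop)
  have hv := hE.mul hG
  set v : ℝ → ℂ := fun x => Complex.exp (θ x) * ∫ s in Set.Ioi x, Complex.exp (-θ s) * g s with hvd
  have hvn : ∀ x, ‖v x‖ₑ ≤ expMajorant κ₀ g x := by
    intro x
    refine le_trans ?_ (hmaj x)
    rw [hvd]
    simp only
    rw [← integral_const_mul]
    exact enorm_integral_le_lintegral_enorm _
  have hn := eLpNorm_le_of_enorm_le_expMajorant hp hκ₀ hg hvn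
  refine ⟨v, ?_, ⟨hv.continuous.aestronglyMeasurable,
    hn.trans_lt (ENNReal.mul_lt_top ENNReal.ofReal_lt_top hg.2)⟩, hn⟩
  convert hv using 2 with x
  have h1 : Complex.exp (θ x) * Complex.exp (-θ x) = 1 := by
    rw [← Complex.exp_add]; simp
  simp only [hvd]
  linear_combination (g x) * h1

theorem integral_norm_le_of_memLp {p : ℝ≥0∞} (hp : 1 ≤ p) {v : ℝ → ℂ} (hv : MemLp v p volume)
    (a b : ℝ) (hab : a ≤ b) :
    ∫ x in a..b, ‖v x‖ ≤ (eLpNorm v p volume).toReal * (b - a) ^ (1 - 1 / p.toReal) := by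
  have h0 : MemLp v 1 (volume.restrict (Set.Ioc a b)) := by
    refine (hv.restrict (Set.Ioc a b)).mono_exponent hp
  rw [intervalIntegral.integral_of_le hab,
    integral_norm_eq_lintegral_enorm h0.1, ← eLpNorm_one_eq_lintegral_enorm]
  have h1 := eLpNorm_le_eLpNorm_mul_rpow_measure_univ hp h0.1
  have h2 : eLpNorm v p (volume.restrict (Set.Ioc a b)) ≤ eLpNorm v p volume :=
    eLpNorm_mono_measure v Measure.restrict_le_self
  -- For p = ∞ the conventions `toReal ∞ = 0` and `1 / 0 = 0` give the exponent 1, which is the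
  -- correct one.
  have hexp : (0 : ℝ) ≤ 1 - 1 / p.toReal := by
    rcases eq_or_ne p ∞ with rfl | hp'
    · simp
    · have : 1 ≤ p.toReal := by
        simpa using ENNReal.toReal_mono hp' hp
      rw [sub_nonneg, div_le_one (by linarith)]; exact this
  rw [Measure.restrict_apply_univ, Real.volume_Ioc, ENNReal.toReal_one, div_one,
    ENNReal.ofReal_rpow_of_nonneg (by linarith) hexp] at h1
  have h3 := ENNReal.toReal_mono (ENNReal.mul_lt_top hv.2 ENNReal.ofReal_lt_top).ne
    (h1.trans (mul_le_mul_left h2 _))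
  rwa [ENNReal.toReal_mul, ENNReal.toReal_ofReal (by
    exact Real.rpow_nonneg (by linarith) _)] at h3

/-- Uniqueness in `Lᵖ` for `v' = κ v - g` when `Re κ ≥ κ₀ > 0`. -/
theorem eq_zero_of_growing {p : ℝ≥0∞} (hp : 1 ≤ p) {κ : ℝ → ℂ} (hκ : Continuous κ)
    {κ₀ : ℝ} (hκ₀ : 0 < κ₀) (hre : ∀ x, κ₀ ≤ (κ x).re) {v w : ℝ → ℂ} (hv : IsPrimitive v w)
    (hw : w =ᵐ[volume] fun x => κ x * v x) (hvp : MemLp v p volume) : v = 0 := by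
  obtain ⟨θ, hθ, hθre⟩ := exists_primitive_of_re_pos hκ hre
  have hθc : Continuous θ := continuous_iff_continuousAt.2 fun x => (hθ x).continuousAt
  have hE : IsPrimitive (fun x => Complex.exp (-θ x)) (fun x => Complex.exp (-θ x) * -κ x) :=
    isPrimitive_of_hasDerivAt (fun x => (hθ x).neg.cexp) (by fun_prop)
  have h1 := hE.mul hv
  have h2 := h1.const_of_ae_eq_zero (by
    filter_upwards [hw] with x hx
    rw [hx]; simp; ring)
  by_contra hne
  obtain ⟨x₀, hx₀⟩ := Function.ne_iff.1 hne
  simp only [Pi.zero_apply] at hx₀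
  -- A nonzero solution is a constant times e^θ and grows at least linearly to the right. Its
  -- integrals over far unit intervals then exceed the Hölder bound by the Lᵖ norm.
  have hlow : ∀ s, x₀ ≤ s → ‖v x₀‖ * (1 + κ₀ * (s - x₀)) ≤ ‖v s‖ := by
    intro s hs
    have h3 := h2 s x₀
    have h4 : v s = Complex.exp (θ s - θ x₀) * v x₀ := by
      have h5 : Complex.exp (θ s) * Complex.exp (-θ s) = 1 := by rw [← Complex.exp_add]; simp
      rw [sub_eq_add_neg, Complex.exp_add, mul_assoc, ← h3, ← mul_assoc, h5, one_mul]
    rw [h4, norm_mul, Complex.norm_exp, mul_comm]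
    gcongr
    have h6 := hθre x₀ s hs
    linarith [Real.add_one_le_exp (θ s - θ x₀).re]
  set N := (eLpNorm v p volume).toReal with hN
  obtain ⟨n, hn⟩ := exists_nat_gt (N / (‖v x₀‖ * κ₀))
  have hpos : 0 < ‖v x₀‖ := norm_pos_iff.2 hx₀
  have h7 := integral_norm_le_of_memLp hp hvp (x₀ + n) (x₀ + n + 1) (by linarith)
  have h8 : ∫ _ in (x₀ + n)..(x₀ + n + 1), ‖v x₀‖ * (1 + κ₀ * n) ≤
      ∫ x in (x₀ + n)..(x₀ + n + 1), ‖v x‖ := by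
    refine intervalIntegral.integral_mono_on (by linarith) (by simp)
      (hv.continuous.norm.intervalIntegrable _ _) fun s hs => ?_
    refine le_trans ?_ (hlow s (by linarith [hs.1, (Nat.cast_nonneg n : (0 : ℝ) ≤ n)]))
    gcongr
    linarith [hs.1]
  simp only [intervalIntegral.integral_const, add_sub_cancel_left, one_smul, Real.one_rpow,
    mul_one] at h7 h8
  rw [div_lt_iff₀ (by positivity)] at hn
  nlinarith

/-- By uniqueness every Lᵖ solution is the constructed one, so the bound of the construction applies
to it. -/
theorem eLpNorm_le_of_growing {p : ℝ≥0∞} (hp : p = 2 ∨ p = ∞) {κ : ℝ → ℂ} (hκ : Continuous κ)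
    {κ₀ : ℝ} (hκ₀ : 0 < κ₀) (hre : ∀ x, κ₀ ≤ (κ x).re) {v w g : ℝ → ℂ} (hv : IsPrimitive v w)
    (hw : w =ᵐ[volume] fun x => κ x * v x - g x) (hvp : MemLp v p volume)
    (hg : MemLp g p volume) :
    eLpNorm v p volume ≤ ENNReal.ofReal κ₀⁻¹ * eLpNorm g p volume := by
  have hp1 : 1 ≤ p := by
    rcases hp with rfl | rfl
    · exact one_le_two
    · exact le_top
  obtain ⟨v', hv', hvp', hn⟩ := exists_solution_growing hp hκ hκ₀ hre hg
  have h := eq_zero_of_growing hp1 hκ hκ₀ hre (hv.sub hv')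
    (by filter_upwards [hw] with x hx; rw [hx]; ring) (hvp.sub hvp')
  have : v = v' := by
    funext x
    exact sub_eq_zero.1 (congrFun h x)
  rwa [this]

theorem memLp_comp_neg {p : ℝ≥0∞} {g : ℝ → ℂ} (hg : MemLp g p volume) :
    MemLp (fun x => g (-x)) p volume :=
  hg.comp_measurePreserving (Measure.measurePreserving_neg volume)

theorem eLpNorm_comp_neg {p : ℝ≥0∞} {g : ℝ → ℂ} (hg : AEStronglyMeasurable g volume) :
    eLpNorm (fun x => g (-x)) p volume = eLpNorm g p volume :=
  eLpNorm_comp_measurePreserving hg (Measure.measurePreserving_neg volume)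

/-- Bounded solvability in `Lᵖ` of `v' = -κ v + g` when `Re κ > 0`. -/
theorem exists_solution_decaying {p : ℝ≥0∞} (hp : p = 2 ∨ p = ∞) {κ : ℂ} (hκ : 0 < κ.re)
    {g : ℝ → ℂ} (hg : MemLp g p volume) :
    ∃ v : ℝ → ℂ, IsPrimitive v (fun x => -κ * v x + g x) ∧ MemLp v p volume := by
  -- The reflection x ↦ -x turns the decaying equation into a growing one.
  obtain ⟨v, hv, hvp, -⟩ := exists_solution_growing hp (κ := fun _ => κ) continuous_const hκ
    (fun _ => le_rfl) (memLp_comp_neg hg)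
  refine ⟨fun x => v (-x), ?_, memLp_comp_neg hvp⟩
  convert hv.comp_neg using 2 with x
  simp only [neg_neg]; ring

theorem eLpNorm_le_of_decaying {p : ℝ≥0∞} (hp : p = 2 ∨ p = ∞) {κ : ℂ} (hκ : 0 < κ.re)
    {v w g : ℝ → ℂ} (hv : IsPrimitive v w)
    (hw : w =ᵐ[volume] fun x => -κ * v x + g x) (hvp : MemLp v p volume)
    (hg : MemLp g p volume) :
    eLpNorm v p volume ≤ ENNReal.ofReal κ.re⁻¹ * eLpNorm g p volume := by
  have h := eLpNorm_le_of_growing hp (κ := fun _ => κ) continuous_const hκ (fun _ => le_rfl)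
    hv.comp_neg (g := fun x => g (-x)) (by
      filter_upwards [(Measure.measurePreserving_neg volume).quasiMeasurePreserving.ae hw] with x hx
      rw [hx]; ring) (memLp_comp_neg hvp) (memLp_comp_neg hg)
  rwa [eLpNorm_comp_neg hvp.1, eLpNorm_comp_neg hg.1] at h

end FirstOrder

/-! ### The system over an abstract space with a derivative -/

section System

/-- The coefficients of the linearized system in the weighted variables. -/
structure SystemCoeffs where
  /-- wave speed -/
  c : ℝ
  /-- exponent of the weight -/
  α : ℝ
  /-- heat release parameter -/
  h : ℝ
  α_pos : 0 < α
  α_lt : α < c / 2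

namespace SystemCoeffs

variable (k : SystemCoeffs)

/-- The drift `c - 2 α` of the weighted first equation. -/
def d : ℝ := k.c - 2 * k.α

/-- The damping `α (c - α)` of the weighted first equation. -/
def m : ℝ := k.α * (k.c - k.α)

theorem c_pos : 0 < k.c := by have := k.α_pos; have := k.α_lt; linarith

theorem d_pos : 0 < k.d := by have := k.α_lt; unfold d; linarith

theorem m_pos : 0 < k.m := by
  have := k.α_pos; have := k.α_lt
  exact mul_pos k.α_pos (by linarith)

/-- The second equation is damped at rate c α, and c α - m = α² > 0. The half-plane Re z > -m is
therefore dictated by the first equation alone. -/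
theorem re_pos {z : ℂ} (hz : -k.m < z.re) : 0 < (k.α + z / k.c : ℂ).re := by
  have hc := k.c_pos
  rw [Complex.add_re, Complex.div_ofReal_re, Complex.ofReal_re]
  have : -(k.α * (k.c - k.α)) / k.c < z.re / k.c := by
    gcongr; exact hz
  have h2 : -(k.α * (k.c - k.α)) / k.c = -k.α + k.α ^ 2 / k.c := by field_simp; ring
  have : 0 < k.α ^ 2 / k.c := by have := k.α_pos; positivity
  linarith

end SystemCoeffs

variable {X : Type*} [NormedAddCommGroup X] [NormedSpace ℂ X]

/-- `𝓓` is the graph of a derivation `∂` of `X` for which `∂ - k - t B` with `Re k > 0`, `t ≥ 0` and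
`∂ + k` with `Re k > 0` are boundedly invertible. -/
structure IsDerivation (𝓓 : Submodule ℂ (X × X)) (B : X →L[ℂ] X) : Prop where
  single : ∀ V, ((0 : X), V) ∈ 𝓓 → V = 0
  exists_growing : ∀ (k : ℂ) (t : ℝ), 0 < k.re → 0 ≤ t → ∀ G,
    ∃ V, (V, k • V + (t : ℂ) • B V - G) ∈ 𝓓
  norm_growing : ∀ (k : ℂ) (t : ℝ), 0 < k.re → 0 ≤ t → ∀ V G,
    (V, k • V + (t : ℂ) • B V - G) ∈ 𝓓 → ‖V‖ ≤ k.re⁻¹ * ‖G‖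
  exists_decaying : ∀ k : ℂ, 0 < k.re → ∀ G, ∃ V, (V, -k • V + G) ∈ 𝓓
  norm_decaying : ∀ k : ℂ, 0 < k.re → ∀ V G, (V, -k • V + G) ∈ 𝓓 → ‖V‖ ≤ k.re⁻¹ * ‖G‖

/-- The combination `h P - (1 - h) Q`. -/
def tempPart (h : ℝ) : X × X →L[ℂ] X :=
  (h : ℂ) • ContinuousLinearMap.fst ℂ X X - (1 - (h : ℂ)) • ContinuousLinearMap.snd ℂ X X

theorem tempPart_apply (h : ℝ) (x : X × X) :
    tempPart h x = (h : ℂ) • x.1 - (1 - (h : ℂ)) • x.2 := rfl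

theorem norm_tempPart_le (h : ℝ) (x : X × X) : ‖tempPart h x‖ ≤ (|h| + |1 - h|) * ‖x‖ := by
  rw [tempPart_apply, add_mul]
  refine (norm_sub_le _ _).trans (add_le_add ?_ ?_)
  · rw [norm_smul, Complex.norm_real, Real.norm_eq_abs]
    gcongr; exact norm_fst_le x
  · rw [norm_smul, ← Complex.ofReal_one, ← Complex.ofReal_sub, Complex.norm_real,
      Real.norm_eq_abs]
    gcongr; exact norm_snd_le x

/-- The graph of `(P, Q) ↦ (P'' + d P' - m P + A N + B Q, c Q' - c α Q - A N - B Q)`,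
`N = h P - (1 - h) Q`. -/
def systemGraph (k : SystemCoeffs) (𝓓 : Submodule ℂ (X × X)) (A B : X →L[ℂ] X) :
    Submodule ℂ ((X × X) × (X × X)) where
  carrier := {z | ∃ R S T : X, (z.1.1, R) ∈ 𝓓 ∧ (R, S) ∈ 𝓓 ∧ (z.1.2, T) ∈ 𝓓 ∧
    z.2.1 = S + (k.d : ℂ) • R - (k.m : ℂ) • z.1.1 + A (tempPart k.h z.1) + B z.1.2 ∧
    z.2.2 = (k.c : ℂ) • T - ((k.c : ℂ) * k.α) • z.1.2 - A (tempPart k.h z.1) - B z.1.2}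
  add_mem' := by
    rintro z w ⟨R, S, T, h1, h2, h3, h4, h5⟩ ⟨R', S', T', h1', h2', h3', h4', h5'⟩
    refine ⟨R + R', S + S', T + T', 𝓓.add_mem h1 h1', 𝓓.add_mem h2 h2', 𝓓.add_mem h3 h3', ?_, ?_⟩
    · simp only [Prod.fst_add, Prod.snd_add, h4, h4', map_add, smul_add]; abel
    · simp only [Prod.fst_add, Prod.snd_add, h5, h5', map_add, smul_add]; abel
  zero_mem' := ⟨0, 0, 0, 𝓓.zero_mem, 𝓓.zero_mem, 𝓓.zero_mem, by simp, by simp⟩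
  smul_mem' := by
    rintro a z ⟨R, S, T, h1, h2, h3, h4, h5⟩
    refine ⟨a • R, a • S, a • T, 𝓓.smul_mem a h1, 𝓓.smul_mem a h2, 𝓓.smul_mem a h3, ?_, ?_⟩
    · simp only [Prod.smul_fst, Prod.smul_snd, h4, map_smul, smul_add, smul_sub, smul_comm a]
    · simp only [Prod.smul_fst, Prod.smul_snd, h5, map_smul, smul_sub, smul_comm a]

theorem mem_systemGraph {k : SystemCoeffs} {𝓓 : Submodule ℂ (X × X)} {A B : X →L[ℂ] X}
    {x f : X × X} : (x, f) ∈ systemGraph k 𝓓 A B ↔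
    ∃ R S T : X, (x.1, R) ∈ 𝓓 ∧ (R, S) ∈ 𝓓 ∧ (x.2, T) ∈ 𝓓 ∧
    f.1 = S + (k.d : ℂ) • R - (k.m : ℂ) • x.1 + A (tempPart k.h x) + B x.2 ∧
    f.2 = (k.c : ℂ) • T - ((k.c : ℂ) * k.α) • x.2 - A (tempPart k.h x) - B x.2 := Iff.rfl

variable {k : SystemCoeffs} {𝓓 : Submodule ℂ (X × X)} {A B : X →L[ℂ] X}

theorem systemGraph_single (h𝓓 : IsDerivation 𝓓 B) (f : X × X)
    (hf : ((0 : X × X), f) ∈ systemGraph k 𝓓 A B) : f = 0 := by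
  obtain ⟨R, S, T, h1, h2, h3, h4, h5⟩ := mem_systemGraph.1 hf
  obtain rfl := h𝓓.single R h1
  obtain rfl := h𝓓.single S h2
  obtain rfl := h𝓓.single T h3
  exact Prod.ext (by simpa using h4) (by simpa using h5)

/-- The coefficient A enters only through the bounded perturbation (A N, -A N) of the triangular
system. -/
theorem mem_systemGraph_iff_zero {x f : X × X} : (x, f) ∈ systemGraph k 𝓓 A B ↔
    (x, f - (A (tempPart k.h x), -A (tempPart k.h x))) ∈ systemGraph k 𝓓 0 B := by
  simp only [mem_systemGraph, Prod.fst_sub, Prod.snd_sub, zero_apply, add_zero, sub_zero]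
  refine exists_congr fun R => exists_congr fun S => exists_congr fun T => ?_
  refine and_congr Iff.rfl (and_congr Iff.rfl (and_congr Iff.rfl (and_congr ?_ ?_)))
  · rw [sub_eq_iff_eq_add, add_right_comm]
  · rw [sub_neg_eq_add, ← eq_sub_iff_add_eq, sub_right_comm]

/-- The roots `μ`, `-η` of `X² + d X - ζ`, separated by the imaginary axis. -/
theorem exists_roots {d : ℝ} (hd : 0 < d) {ζ : ℂ} (hζ : 0 < ζ.re) :
    ∃ μ η : ℂ, 0 < μ.re ∧ 0 < η.re ∧ η - μ = d ∧ μ * η = ζ := by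
  obtain ⟨s, hs, hs0⟩ : ∃ s : ℂ, s * s = (d / 2) ^ 2 + ζ ∧ 0 ≤ s.re := by
    obtain ⟨s, hs⟩ := IsAlgClosed.exists_pow_nat_eq ((d / 2 : ℂ) ^ 2 + ζ) zero_lt_two
    rcases le_total 0 s.re with h | h
    · exact ⟨s, by rw [← hs]; ring, h⟩
    · exact ⟨-s, by rw [← hs]; ring, by simpa using h⟩
  have hre : s.re * s.re - s.im * s.im = (d / 2) ^ 2 + ζ.re := by
    have := congrArg Complex.re hs
    have e : ((d / 2 : ℂ) ^ 2).re = (d / 2) ^ 2 := by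
      rw [show ((d / 2 : ℂ) ^ 2) = (((d / 2) ^ 2 : ℝ) : ℂ) by push_cast; ring, Complex.ofReal_re]
    rwa [Complex.mul_re, Complex.add_re, e] at this
  -- Re s² = (Re s)² - (Im s)² equals (d/2)² + Re ζ, which exceeds (d/2)².
  have hlt : d / 2 < s.re := by
    by_contra hle
    push Not at hle
    nlinarith [mul_self_nonneg s.im]
  have e2 : ((d : ℂ) / 2).re = d / 2 := by
    rw [show (d : ℂ) / 2 = ((d / 2 : ℝ) : ℂ) by push_cast; ring, Complex.ofReal_re]
  refine ⟨s - d / 2, s + d / 2, ?_, ?_, by ring, ?_⟩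
  · rw [Complex.sub_re, e2]; linarith
  · rw [Complex.add_re, e2]; linarith
  · linear_combination hs

/-- Factorization of `(ζ - d ∂ - ∂²) P = H`. -/
theorem factor_mem {P R S : X} (h1 : (P, R) ∈ 𝓓) (h2 : (R, S) ∈ 𝓓) {d μ η ζ : ℂ}
    (hd : η - μ = d) (hζ : μ * η = ζ) :
    (R + η • P, μ • (R + η • P) - (ζ • P - d • R - S)) ∈ 𝓓 ∧
      (P, -η • P + (R + η • P)) ∈ 𝓓 := by
  constructor
  · have h := 𝓓.add_mem h2 (𝓓.smul_mem η h1)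
    convert h using 1
    refine Prod.ext rfl ?_
    simp only [Prod.snd_add, Prod.smul_snd]
    subst hd hζ
    module
  · convert h1 using 2
    module

/-- ζ - d ∂ - ∂² = (μ - ∂)(η + ∂): the growing estimate bounds R + η P, and the decaying one then
bounds P. -/
theorem norm_le_of_second_order (h𝓓 : IsDerivation 𝓓 B) {P R S : X} (h1 : (P, R) ∈ 𝓓)
    (h2 : (R, S) ∈ 𝓓) {d μ η ζ : ℂ} (hμ : 0 < μ.re) (hη : 0 < η.re) (hd : η - μ = d)
    (hζ : μ * η = ζ) :
    ‖R + η • P‖ ≤ μ.re⁻¹ * ‖ζ • P - d • R - S‖ ∧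
      ‖P‖ ≤ η.re⁻¹ * (μ.re⁻¹ * ‖ζ • P - d • R - S‖) := by
  obtain ⟨f1, f2⟩ := factor_mem h1 h2 hd hζ
  have e1 := h𝓓.norm_growing μ 0 hμ le_rfl (R + η • P) (ζ • P - d • R - S) (by
    rw [Complex.ofReal_zero, zero_smul, add_zero]; exact f1)
  refine ⟨e1, (h𝓓.norm_decaying η hη _ _ f2).trans ?_⟩
  gcongr

/-- The solution of `(z - A₀) x = y`, `A₀` the system with `A = 0`. -/
theorem exists_system_solution (h𝓓 : IsDerivation 𝓓 B) {z : ℂ} (hz : -k.m < z.re) (y : X × X) :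
    ∃ x, (x, z • x - y) ∈ systemGraph k 𝓓 0 B := by
  have hc := k.c_pos
  have hcC : (k.c : ℂ) ≠ 0 := by exact_mod_cast hc.ne'
  have hκ := k.re_pos hz
  -- With A = 0 the second equation involves Q alone. Division by c makes it Q' = (α + z/c) Q + c⁻¹
  -- B Q - c⁻¹ y₂. The term B Q then joins the source of the first equation, which is solved factor
  -- by factor.
  obtain ⟨Q, hQ⟩ := h𝓓.exists_growing _ k.c⁻¹ hκ (by positivity) ((k.c : ℂ)⁻¹ • y.2)
  obtain ⟨μ, η, hμ, hη, hdd, hζ⟩ := exists_roots k.d_pos (ζ := k.m + z)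
    (by rw [Complex.add_re, Complex.ofReal_re]; linarith)
  obtain ⟨v, hv⟩ := h𝓓.exists_growing μ 0 hμ le_rfl (y.1 + B Q)
  obtain ⟨P, hP⟩ := h𝓓.exists_decaying η hη v
  refine ⟨(P, Q), mem_systemGraph.2 ⟨_, (-η) • (-η • P + v) +
    (μ • v + ((0 : ℝ) : ℂ) • B v - (y.1 + B Q)), _, hP, ?_, hQ, ?_, ?_⟩⟩
  · exact 𝓓.add_mem (𝓓.smul_mem (-η) hP) hv
  · have hz' : z = μ * η - k.m := by rw [hζ]; ring
    have hd' : (k.d : ℂ) = η - μ := hdd.symm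
    simp only [Prod.fst_sub, Prod.smul_fst, zero_apply]
    rw [hz', hd']
    simp only [Complex.ofReal_zero]
    module
  · simp only [Prod.snd_sub, Prod.smul_snd, zero_apply]
    simp only [smul_add, smul_sub, smul_smul, Complex.ofReal_inv, mul_inv_cancel₀ hcC,
      mul_div_cancel₀ _ hcC, one_smul, add_smul, sub_zero]
    abel

/-- A priori estimate for the system with `A = 0`. -/
theorem norm_system_le (h𝓓 : IsDerivation 𝓓 B) {z : ℂ} (hz : -k.m < z.re) :
    ∃ C, 0 ≤ C ∧ ∀ (x f : X × X) (R S T : X), (x.1, R) ∈ 𝓓 → (R, S) ∈ 𝓓 → (x.2, T) ∈ 𝓓 →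
    f.1 = S + (k.d : ℂ) • R - (k.m : ℂ) • x.1 + B x.2 →
    f.2 = (k.c : ℂ) • T - ((k.c : ℂ) * k.α) • x.2 - B x.2 →
      ‖x‖ ≤ C * ‖z • x - f‖ ∧ ‖R‖ ≤ C * ‖z • x - f‖ ∧ ‖T‖ ≤ C * ‖z • x - f‖ := by
  have hc := k.c_pos
  have hcC : (k.c : ℂ) ≠ 0 := by exact_mod_cast hc.ne'
  set κ : ℂ := k.α + z / k.c with hκd
  have hκ : 0 < κ.re := k.re_pos hz
  obtain ⟨μ, η, hμ, hη, hdd, hζ⟩ := exists_roots k.d_pos (ζ := k.m + z)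
    (by rw [Complex.add_re, Complex.ofReal_re]; linarith)
  -- The constants follow the back substitution: Q from the second equation, then the source H = y₁
  -- + B Q, the intermediate v = P' + η P, then P, P' and finally Q'.
  set CQ : ℝ := κ.re⁻¹ * k.c⁻¹ with hCQ
  set CH : ℝ := 1 + ‖B‖ * CQ with hCH
  set Cv : ℝ := μ.re⁻¹ * CH with hCv
  set CP : ℝ := η.re⁻¹ * Cv with hCP
  set CR : ℝ := Cv + ‖η‖ * CP with hCR
  set CT : ℝ := (‖κ‖ + k.c⁻¹ * ‖B‖) * CQ + k.c⁻¹ with hCT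
  have hCQ0 : 0 ≤ CQ := by positivity
  have hCP0 : 0 ≤ CP := by positivity
  have hCR0 : 0 ≤ CR := by positivity
  have hCT0 : 0 ≤ CT := by positivity
  refine ⟨CQ + CP + CR + CT, by positivity, fun x f R S T h1 h2 h3 h4 h5 => ?_⟩
  set y := z • x - f with hy
  have hy1 : ‖y.1‖ ≤ ‖y‖ := norm_fst_le y
  have hy2 : ‖y.2‖ ≤ ‖y‖ := norm_snd_le y
  have eT : T = κ • x.2 + ((k.c⁻¹ : ℝ) : ℂ) • B x.2 - (k.c : ℂ)⁻¹ • y.2 := by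
    simp only [hy, hκd, Prod.snd_sub, Prod.smul_snd, h5, smul_sub, smul_smul, Complex.ofReal_inv,
      inv_mul_cancel₀ hcC, one_smul, add_smul, ← mul_assoc, one_mul]
    rw [show z / (k.c : ℂ) = (k.c : ℂ)⁻¹ * z by field_simp]
    abel
  have hQ : ‖x.2‖ ≤ CQ * ‖y‖ := by
    have := h𝓓.norm_growing κ k.c⁻¹ hκ (by positivity) x.2 ((k.c : ℂ)⁻¹ • y.2) (eT ▸ h3)
    rw [norm_smul, norm_inv, Complex.norm_real, Real.norm_eq_abs, abs_of_pos hc] at this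
    refine this.trans ?_
    rw [hCQ, mul_assoc]; gcongr
  have hH : ‖((k.m : ℂ) + z) • x.1 - (k.d : ℂ) • R - S‖ ≤ CH * ‖y‖ := by
    have e : ((k.m : ℂ) + z) • x.1 - (k.d : ℂ) • R - S = y.1 + B x.2 := by
      simp only [hy, Prod.fst_sub, Prod.smul_fst, h4]
      module
    rw [e, hCH, add_mul, one_mul, mul_assoc]
    refine (norm_add_le _ _).trans (add_le_add hy1 ((B.le_opNorm _).trans ?_))
    gcongr
  obtain ⟨e1, e2⟩ := norm_le_of_second_order h𝓓 h1 h2 hμ hη hdd hζ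
  have hv : ‖R + η • x.1‖ ≤ Cv * ‖y‖ := by
    rw [hCv, mul_assoc]; exact e1.trans (by gcongr)
  have hP : ‖x.1‖ ≤ CP * ‖y‖ := by
    rw [hCP, hCv, mul_assoc, mul_assoc]; exact e2.trans (by gcongr)
  have hR : ‖R‖ ≤ CR * ‖y‖ := by
    have : R = (R + η • x.1) - η • x.1 := by abel
    rw [this, hCR, add_mul, mul_assoc ‖η‖]
    refine (norm_sub_le _ _).trans (add_le_add hv ?_)
    rw [norm_smul]; gcongr
  have hT : ‖T‖ ≤ CT * ‖y‖ := by
    have e3 : ‖κ • x.2‖ ≤ ‖κ‖ * (CQ * ‖y‖) := by rw [norm_smul]; gcongr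
    have e4 : ‖((k.c⁻¹ : ℝ) : ℂ) • B x.2‖ ≤ k.c⁻¹ * (‖B‖ * (CQ * ‖y‖)) := by
      rw [norm_smul, Complex.norm_real, Real.norm_eq_abs, abs_of_pos (by positivity)]
      gcongr
      exact (B.le_opNorm _).trans (by gcongr)
    have e5 : ‖(k.c : ℂ)⁻¹ • y.2‖ ≤ k.c⁻¹ * ‖y‖ := by
      rw [norm_smul, norm_inv, Complex.norm_real, Real.norm_eq_abs, abs_of_pos hc]
      gcongr
    rw [eT]
    calc _ ≤ ‖κ • x.2‖ + ‖((k.c⁻¹ : ℝ) : ℂ) • B x.2‖ + ‖(k.c : ℂ)⁻¹ • y.2‖ :=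
          (norm_sub_le _ _).trans (add_le_add_left (norm_add_le _ _) _)
      _ ≤ ‖κ‖ * (CQ * ‖y‖) + k.c⁻¹ * (‖B‖ * (CQ * ‖y‖)) + k.c⁻¹ * ‖y‖ := by gcongr
      _ = CT * ‖y‖ := by rw [hCT]; ring
  have hyn := norm_nonneg y
  refine ⟨?_, hR.trans (by gcongr; linarith), hT.trans (by gcongr; linarith)⟩
  rw [Prod.norm_def]
  exact max_le (hP.trans (by gcongr; linarith)) (hQ.trans (by gcongr; linarith))

/-- The resolvent of the system with `A = 0`. -/
theorem exists_system_resolvent (h𝓓 : IsDerivation 𝓓 B) {z : ℂ} (hz : -k.m < z.re) :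
    ∃ S, IsGraphResolvent (systemGraph k 𝓓 0 B) z S := by
  obtain ⟨C, hC0, hC⟩ := norm_system_le (k := k) h𝓓 hz
  have hest : ∀ x f, (x, f) ∈ systemGraph k 𝓓 0 B → ‖x‖ ≤ C * ‖z • x - f‖ := by
    intro x f hxf
    obtain ⟨R, S, T, h1, h2, h3, h4, h5⟩ := mem_systemGraph.1 hxf
    exact (hC x f R S T h1 h2 h3 (by simpa using h4) (by simpa using h5)).1
  have huniq : ∀ x x' y, (x, z • x - y) ∈ systemGraph k 𝓓 0 B →
      (x', z • x' - y) ∈ systemGraph k 𝓓 0 B → x = x' := by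
    intro x x' y h h'
    have h1 := hest _ _ ((systemGraph k 𝓓 0 B).sub_mem h h')
    have e : z • (x - x') - (z • x - y - (z • x' - y)) = 0 := by rw [smul_sub]; abel
    change ‖x - x'‖ ≤ C * ‖z • (x - x') - (z • x - y - (z • x' - y))‖ at h1
    rw [e, norm_zero, mul_zero, norm_le_zero_iff] at h1
    exact sub_eq_zero.1 h1
  choose S hS using exists_system_solution (k := k) h𝓓 hz
  let S' : X × X →ₗ[ℂ] X × X :=
    { toFun := S
      map_add' := fun a b => huniq _ _ (a + b) (hS _) (by
        convert (systemGraph k 𝓓 0 B).add_mem (hS a) (hS b) using 1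
        refine Prod.ext rfl ?_
        simp only [Prod.snd_add, smul_add]; abel)
      map_smul' := fun t a => huniq _ _ (t • a) (hS _) (by
        convert (systemGraph k 𝓓 0 B).smul_mem t (hS a) using 1
        refine Prod.ext rfl ?_
        simp only [RingHom.id_apply, Prod.smul_snd, smul_sub, smul_comm t z]) }
  refine ⟨S'.mkContinuous C fun y => ?_, fun y => hS y, fun x f hxf => ?_⟩
  · have := hest _ _ (hS y)
    rwa [sub_sub_cancel] at this
  · refine huniq _ _ (z • x - f) (hS _) ?_
    rwa [sub_sub_cancel]

/-- `v ↦ (v, -v)`. -/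
def antidiag : X →L[ℂ] X × X :=
  ContinuousLinearMap.inl ℂ X X - ContinuousLinearMap.inr ℂ X X

theorem antidiag_apply (v : X) : antidiag v = (v, -v) := by
  simp [antidiag]

theorem norm_antidiag (v : X) : ‖antidiag v‖ = ‖v‖ := by
  rw [antidiag_apply, Prod.norm_def]; simp

/-- The operator `A` is approximated by operators of finite rank on the domain of the derivation. -/
def IsApproximable (𝓓 : Submodule ℂ (X × X)) (A : X →L[ℂ] X) : Prop :=
  ∀ ε > 0, ∃ (n : ℕ) (π : Fin n → X →L[ℂ] ℂ) (e : Fin n → X), ∀ U V, (U, V) ∈ 𝓓 →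
    ‖A U - ∑ i, π i U • e i‖ ≤ ε * (‖U‖ + ‖V‖)

theorem tempPart_mem {x : X × X} {R T : X} (h1 : (x.1, R) ∈ 𝓓) (h2 : (x.2, T) ∈ 𝓓) (h : ℝ) :
    (tempPart h x, tempPart h (R, T)) ∈ 𝓓 :=
  𝓓.sub_mem (𝓓.smul_mem _ h1) (𝓓.smul_mem _ h2)

/-- Let S be the resolvent for A = 0 and N the combination h P - (1 - h) Q. Then (z - 𝓛) S y = y -
(A N S y, -A N S y). Since N S y and its derivative are bounded by a multiple of ‖y‖,
approximability splits the perturbation into K with ‖K‖ ≤ 1/2 and a finite rank operator. The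
parametrix is S (1 - K)⁻¹. -/
theorem exists_system_parametrix [CompleteSpace X] (h𝓓 : IsDerivation 𝓓 B)
    (hA : IsApproximable 𝓓 A) {z : ℂ} (hz : -k.m < z.re) :
    ∃ (n : ℕ) (W : X × X →L[ℂ] X × X) (π : Fin n → X × X →L[ℂ] ℂ) (e : Fin n → X × X),
      IsParametrix (systemGraph k 𝓓 A B) z W π e := by
  obtain ⟨S, hS⟩ := exists_system_resolvent (k := k) h𝓓 hz
  obtain ⟨C, hC0, hC⟩ := norm_system_le (k := k) h𝓓 hz
  set h₀ : ℝ := |k.h| + |1 - k.h| with hh₀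
  have hh₀0 : 0 ≤ h₀ := by positivity
  -- Both N S y and its derivative have norm at most h₀ C ‖y‖. The total 2 h₀ C ‖y‖ times this ε is
  -- at most ‖y‖ / 2; the added 1 avoids a zero denominator.
  obtain ⟨n, π, e, hπ⟩ := hA (1 / (4 * (h₀ * C + 1))) (by positivity)
  set NS : X × X →L[ℂ] X := tempPart k.h ∘L S with hNS
  set K : X × X →L[ℂ] X × X := antidiag ∘L A ∘L NS -
    ∑ i, (π i ∘L NS).smulRight (antidiag (e i)) with hK
  have hKy : ∀ y, K y = antidiag (A (NS y)) - ∑ i, π i (NS y) • antidiag (e i) := by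
    intro y; simp [hK]
  have hKn : ‖K‖ ≤ 1 / 2 := by
    refine ContinuousLinearMap.opNorm_le_bound _ (by norm_num) fun y => ?_
    obtain ⟨R, S', T, h1, h2, h3, h4, h5⟩ := mem_systemGraph.1 (hS.1 y)
    obtain ⟨b1, b2, b3⟩ := hC (S y) (z • S y - y) R S' T h1 h2 h3 (by simpa using h4) (by simpa using h5)
    rw [sub_sub_cancel] at b1 b2 b3
    have e1 := hπ _ _ (tempPart_mem h1 h3 k.h)
    have e2 : ‖tempPart k.h (S y)‖ ≤ h₀ * (C * ‖y‖) :=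
      (norm_tempPart_le _ _).trans (by gcongr)
    have e3 : ‖tempPart k.h (R, T)‖ ≤ h₀ * (C * ‖y‖) := by
      refine (norm_tempPart_le _ _).trans ?_
      gcongr
      rw [Prod.norm_def]; exact max_le b2 b3
    have e4 : K y = antidiag (A (NS y) - ∑ i, π i (NS y) • e i) := by
      rw [hKy, map_sub, map_sum]; simp only [map_smul]
    rw [e4, norm_antidiag]
    calc _ ≤ 1 / (4 * (h₀ * C + 1)) * (h₀ * (C * ‖y‖) + h₀ * (C * ‖y‖)) :=
          e1.trans (by gcongr)
      _ = (h₀ * C / (h₀ * C + 1)) * (1 / 2 * ‖y‖) := by field_simp; ring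
      _ ≤ 1 * (1 / 2 * ‖y‖) := by
          gcongr
          rw [div_le_one (by positivity)]; linarith
      _ = _ := one_mul _
  have hu : IsUnit (1 - K) := isUnit_one_sub_of_norm_lt_one (by linarith)
  set L : X × X →L[ℂ] X × X := Ring.inverse (1 - K) with hL
  have hL1 : ∀ y, L y - K (L y) = y := by
    intro y
    have := congrArg (fun T : X × X →L[ℂ] X × X => T y) (Ring.mul_inverse_cancel _ hu)
    simpa using this
  have hL2 : ∀ y, L (y - K y) = y := by
    intro y
    have := congrArg (fun T : X × X →L[ℂ] X × X => T y) (Ring.inverse_mul_cancel _ hu)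
    simpa using this
  refine ⟨n, S ∘L L, fun i => π i ∘L NS ∘L L, fun i => antidiag (e i), fun y => ?_,
    fun x f hxf => ?_, ?_⟩
  · rw [mem_systemGraph_iff_zero]
    convert hS.1 (L y) using 1
    refine Prod.ext rfl ?_
    rw [← antidiag_apply]
    have e1 := hL1 y
    rw [hKy] at e1
    simp only [ContinuousLinearMap.comp_apply]
    have e2 : NS (L y) = tempPart k.h (S (L y)) := rfl
    rw [← e2]
    have aux : ∀ a b l s : X × X, l - (a - s) = b → z • S (L y) - b + s - a = z • S (L y) - l := by
      rintro a _ l s rfl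
      abel
    exact aux _ _ _ _ e1
  · rw [mem_systemGraph_iff_zero] at hxf
    set y := z • x - (f - (A (tempPart k.h x), -A (tempPart k.h x))) with hy
    refine ⟨y - K y, ?_⟩
    rw [ContinuousLinearMap.comp_apply, hL2]
    exact hS.2 _ _ hxf
  · refine (injective_iff_map_eq_zero _).2 fun y hy => ?_
    have h1 := hS.1 (L y)
    change S (L y) = 0 at hy
    rw [hy, smul_zero, zero_sub] at h1
    have h2 : L y = 0 := neg_eq_zero.1 (systemGraph_single h𝓓 _ h1)
    rw [← hL1 y, h2]; simp

/-- For large real z = l both scalar problems have inverses of norm at most 1/l against coupling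
terms bounded by K ‖x‖, so an eigenvector satisfies ‖x‖ ≤ (K / l) ‖x‖. The choice l = K + 1 forces x
= 0. -/
theorem exists_system_injective (h𝓓 : IsDerivation 𝓓 B) :
    ∃ z : ℂ, -k.m < z.re ∧ ∀ x, (x, z • x) ∈ systemGraph k 𝓓 A B → x = 0 := by
  set h₀ : ℝ := |k.h| + |1 - k.h| with hh₀
  set K : ℝ := ‖A‖ * h₀ + ‖B‖ with hK
  have hK0 : 0 ≤ K := by positivity
  have hm := k.m_pos
  have hc := k.c_pos
  have hcC : (k.c : ℂ) ≠ 0 := by exact_mod_cast hc.ne'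
  set l : ℝ := K + 1 with hl
  have hl0 : 0 < l := by positivity
  refine ⟨(l : ℂ), by rw [Complex.ofReal_re]; linarith, fun x hx => ?_⟩
  obtain ⟨R, S, T, h1, h2, h3, h4, h5⟩ := mem_systemGraph.1 hx
  simp only [Prod.smul_fst, Prod.smul_snd] at h4 h5
  have hN : ‖A (tempPart k.h x)‖ ≤ ‖A‖ * (h₀ * ‖x‖) :=
    (A.le_opNorm _).trans (by gcongr; exact norm_tempPart_le _ _)
  have hQ : ‖x.2‖ ≤ l⁻¹ * (K * ‖x‖) := by
    have eT : T = (k.α + l / k.c : ℂ) • x.2 + ((k.c⁻¹ : ℝ) : ℂ) • B x.2 -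
        (-(k.c : ℂ)⁻¹ • A (tempPart k.h x)) := by
      have : T = (k.c : ℂ)⁻¹ • ((l : ℂ) • x.2 + ((k.c : ℂ) * k.α) • x.2 + A (tempPart k.h x) +
          B x.2) := by
        rw [h5, eq_inv_smul_iff₀ hcC]; abel
      rw [this]
      simp only [smul_add, smul_smul, Complex.ofReal_inv, ← mul_assoc, inv_mul_cancel₀ hcC, one_mul,
        add_smul, div_eq_mul_inv, mul_comm (l : ℂ), neg_smul, sub_neg_eq_add]
      abel
    have hre : (k.α + l / k.c : ℂ).re = k.α + l / k.c := by
      rw [Complex.add_re, Complex.div_ofReal_re, Complex.ofReal_re, Complex.ofReal_re]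
    have hα := k.α_pos
    have h6 := h𝓓.norm_growing (k.α + l / k.c) k.c⁻¹ (by rw [hre]; positivity) (by positivity)
      x.2 _ (eT ▸ h3)
    rw [hre, norm_smul, norm_neg, norm_inv, Complex.norm_real, Real.norm_eq_abs, abs_of_pos hc] at h6
    have h7 : (k.α + l / k.c)⁻¹ ≤ (l / k.c)⁻¹ := by
      gcongr; linarith
    calc ‖x.2‖ ≤ (l / k.c)⁻¹ * (k.c⁻¹ * (‖A‖ * (h₀ * ‖x‖))) := h6.trans (by gcongr)
      _ = l⁻¹ * (‖A‖ * h₀ * ‖x‖) := by field_simp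
      _ ≤ l⁻¹ * (K * ‖x‖) := by
          gcongr
          rw [hK]; linarith [norm_nonneg B]
  have hP : ‖x.1‖ ≤ l⁻¹ * (K * ‖x‖) := by
    -- The explicit real roots have product exactly m + l, so the two first order estimates multiply
    -- to (m + l)⁻¹ ≤ l⁻¹.
    set s : ℝ := Real.sqrt ((k.d / 2) ^ 2 + (k.m + l)) with hs
    have hd := k.d_pos
    have hss : s * s = (k.d / 2) ^ 2 + (k.m + l) := Real.mul_self_sqrt (by positivity)
    have hs0 : 0 ≤ s := Real.sqrt_nonneg _
    have hds : k.d / 2 < s := by nlinarith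
    have hprod : (s - k.d / 2) * (s + k.d / 2) = k.m + l := by linarith [hss]
    have h6 := (norm_le_of_second_order h𝓓 h1 h2 (d := k.d) (ζ := k.m + l)
      (μ := ((s - k.d / 2 : ℝ) : ℂ)) (η := ((s + k.d / 2 : ℝ) : ℂ))
      (by rw [Complex.ofReal_re]; linarith) (by rw [Complex.ofReal_re]; linarith)
      (by push_cast; ring) (by exact_mod_cast hprod)).2
    have e : ((k.m : ℂ) + l) • x.1 - (k.d : ℂ) • R - S = A (tempPart k.h x) + B x.2 := by
      rw [add_smul, h4]; abel
    rw [e, Complex.ofReal_re, Complex.ofReal_re, ← mul_assoc, ← mul_inv, mul_comm (s + k.d / 2),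
      hprod] at h6
    have h8 : ‖A (tempPart k.h x) + B x.2‖ ≤ K * ‖x‖ := by
      refine (norm_add_le _ _).trans ?_
      rw [hK, add_mul, mul_assoc]
      refine add_le_add hN ((B.le_opNorm _).trans ?_)
      gcongr; exact norm_snd_le x
    refine h6.trans ?_
    gcongr
    linarith
  have hx : ‖x‖ ≤ l⁻¹ * (K * ‖x‖) := by
    conv_lhs => rw [Prod.norm_def]
    exact max_le hP hQ
  rw [← norm_le_zero_iff]
  rw [le_inv_mul_iff₀ hl0, hl] at hx
  linarith

/-- The derivatives are controlled by the graph norm. -/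
theorem exists_system_deriv_le (h𝓓 : IsDerivation 𝓓 B) :
    ∃ C, 0 ≤ C ∧ ∀ x f, (x, f) ∈ systemGraph k 𝓓 A B → ∃ R T, (x.1, R) ∈ 𝓓 ∧ (x.2, T) ∈ 𝓓 ∧
      ‖R‖ ≤ C * (‖x‖ + ‖f‖) ∧ ‖T‖ ≤ C * (‖x‖ + ‖f‖) := by
  obtain ⟨C, hC0, hC⟩ := norm_system_le (k := k) h𝓓 (z := 0) (by simpa using k.m_pos)
  set h₀ : ℝ := |k.h| + |1 - k.h| with hh₀
  refine ⟨C * (‖A‖ * h₀ + 1), by positivity, fun x f hxf => ?_⟩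
  rw [mem_systemGraph_iff_zero] at hxf
  obtain ⟨R, S, T, h1, h2, h3, h4, h5⟩ := mem_systemGraph.1 hxf
  obtain ⟨-, b2, b3⟩ := hC x (f - (A (tempPart k.h x), -A (tempPart k.h x))) R S T h1 h2 h3 (by simpa using h4) (by simpa using h5)
  have hb : ‖(0 : ℂ) • x - (f - (A (tempPart k.h x), -A (tempPart k.h x)))‖ ≤
      (‖A‖ * h₀ + 1) * (‖x‖ + ‖f‖) := by
    rw [zero_smul, zero_sub, norm_neg, ← antidiag_apply]
    have hN : ‖A (tempPart k.h x)‖ ≤ ‖A‖ * (h₀ * ‖x‖) :=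
      (A.le_opNorm _).trans (by gcongr; exact norm_tempPart_le _ _)
    have := norm_sub_le f (antidiag (A (tempPart k.h x)))
    rw [norm_antidiag] at this
    have h6 : 0 ≤ ‖A‖ * h₀ * ‖f‖ := by positivity
    nlinarith [norm_nonneg x, norm_nonneg f]
  exact ⟨R, T, h1, h3, b2.trans (by rw [mul_assoc]; gcongr), b3.trans (by rw [mul_assoc]; gcongr)⟩

end System

/-! ### The weak derivative and multiplication operators in `Lᵖ` -/

section LpDeriv

open ENNReal

variable {p : ℝ≥0∞}

/-- The graph of the weak derivative in `Lᵖ(ℝ; ℂ)`. -/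
def weakDeriv (p : ℝ≥0∞) [Fact (1 ≤ p)] :
    Submodule ℂ (Lp ℂ p (volume : Measure ℝ) × Lp ℂ p (volume : Measure ℝ)) where
  carrier := {z | ∃ u, z.1 =ᵐ[volume] u ∧ IsPrimitive u z.2}
  add_mem' := by
    rintro z w ⟨u, hu, hu'⟩ ⟨v, hv, hv'⟩
    refine ⟨fun x => u x + v x, ?_, (hu'.add hv').congr (Lp.coeFn_add _ _).symm⟩
    filter_upwards [Lp.coeFn_add z.1 w.1, hu, hv] with x h1 h2 h3
    rw [Prod.fst_add, h1, Pi.add_apply, h2, h3]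
  zero_mem' := ⟨fun _ => 0, Lp.coeFn_zero _ _ _, isPrimitive_zero.congr (Lp.coeFn_zero _ _ _).symm⟩
  smul_mem' := by
    rintro a z ⟨u, hu, hu'⟩
    refine ⟨fun x => a * u x, ?_, (hu'.const_mul a).congr (Lp.coeFn_smul a z.2).symm⟩
    filter_upwards [Lp.coeFn_smul a z.1, hu] with x h1 h2
    rw [Prod.smul_fst, h1, Pi.smul_apply, h2, smul_eq_mul]

theorem mem_weakDeriv [Fact (1 ≤ p)] {U V : Lp ℂ p (volume : Measure ℝ)} :
    (U, V) ∈ weakDeriv p ↔ ∃ u, U =ᵐ[volume] u ∧ IsPrimitive u V := Iff.rfl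

theorem memLp_bounded_mul {b : ℝ → ℂ} (hb : AEStronglyMeasurable b volume) {C : ℝ}
    (hC : ∀ x, ‖b x‖ ≤ C) {f : ℝ → ℂ} (hf : MemLp f p volume) :
    MemLp (fun x => b x * f x) p volume :=
  hf.of_le_mul (hb.mul hf.1) (c := C) (Eventually.of_forall fun x => by
    rw [norm_mul]; gcongr; exact hC x)

theorem norm_le_of_eLpNorm_le {U V : Lp ℂ p (volume : Measure ℝ)} {u g : ℝ → ℂ} {K : ℝ}
    (hK : 0 ≤ K) (hu : U =ᵐ[volume] u) (hg : V =ᵐ[volume] g)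
    (h : eLpNorm u p volume ≤ ENNReal.ofReal K * eLpNorm g p volume) : ‖U‖ ≤ K * ‖V‖ := by
  rw [Lp.norm_def, Lp.norm_def, eLpNorm_congr_ae hu]
  have h1 : eLpNorm g p volume = eLpNorm V p volume := eLpNorm_congr_ae hg.symm
  rw [h1] at h
  have := ENNReal.toReal_mono (ENNReal.mul_lt_top ENNReal.ofReal_lt_top (Lp.eLpNorm_lt_top V)).ne h
  rwa [ENNReal.toReal_mul, ENNReal.toReal_ofReal hK] at this

variable [hp1 : Fact (1 ≤ p)]

/-- Multiplication by a bounded measurable function. -/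
def mulOp {b : ℝ → ℂ} (hb : AEStronglyMeasurable b volume) {C : ℝ} (hC : ∀ x, ‖b x‖ ≤ C) :
    Lp ℂ p (volume : Measure ℝ) →L[ℂ] Lp ℂ p (volume : Measure ℝ) :=
  LinearMap.mkContinuous
    { toFun := fun U => (memLp_bounded_mul hb hC (Lp.memLp U)).toLp _
      map_add' := fun U V => by
        rw [← MemLp.toLp_add]
        refine MemLp.toLp_congr _ _ ?_
        filter_upwards [Lp.coeFn_add U V] with x hx
        rw [hx, Pi.add_apply, Pi.add_apply, mul_add]
      map_smul' := fun a U => by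
        rw [RingHom.id_apply, ← MemLp.toLp_const_smul]
        refine MemLp.toLp_congr _ _ ?_
        filter_upwards [Lp.coeFn_smul a U] with x hx
        rw [hx, Pi.smul_apply, Pi.smul_apply, smul_eq_mul, smul_eq_mul, mul_left_comm] } C
    fun U => by
      refine Lp.norm_le_mul_norm_of_ae_le_mul ?_
      filter_upwards [(memLp_bounded_mul hb hC (Lp.memLp U)).coeFn_toLp] with x hx
      change ‖((memLp_bounded_mul hb hC (Lp.memLp U)).toLp _ : ℝ → ℂ) x‖ ≤ _
      rw [hx, norm_mul]
      gcongr
      exact hC x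

theorem coeFn_mulOp {b : ℝ → ℂ} (hb : AEStronglyMeasurable b volume) {C : ℝ}
    (hC : ∀ x, ‖b x‖ ≤ C) (U : Lp ℂ p (volume : Measure ℝ)) :
    mulOp hb hC U =ᵐ[volume] fun x => b x * U x :=
  (memLp_bounded_mul hb hC (Lp.memLp U)).coeFn_toLp

theorem weakDeriv_single (V : Lp ℂ p (volume : Measure ℝ)) (hV : (0, V) ∈ weakDeriv p) : V = 0 := by
  obtain ⟨u, hu, hu'⟩ := hV
  have h1 : u = 0 := ((hu'.continuous.ae_eq_iff_eq volume continuous_zero).1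
    (hu.symm.trans (Lp.coeFn_zero _ _ _)))
  subst h1
  refine Lp.ext ((IsPrimitive.ae_eq hu' isPrimitive_zero).trans ?_)
  exact (Lp.coeFn_zero _ _ _).symm

/-- Because β ≥ 0 and t ≥ 0, Re (k + t β) ≥ Re k, so the variable coefficient equations obey the
same bounds as the constant coefficient ones. -/
theorem isDerivation_weakDeriv (hp : p = 2 ∨ p = ∞) {β : ℝ → ℝ} (hβ : Continuous β)
    (hβ0 : ∀ x, 0 ≤ β x) (hβm : AEStronglyMeasurable (fun x => (β x : ℂ)) volume) {C : ℝ}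
    (hC : ∀ x, ‖(β x : ℂ)‖ ≤ C) : IsDerivation (weakDeriv p) (mulOp hβm hC) := by
  have hκc : ∀ (k : ℂ) (t : ℝ), Continuous fun x => k + (t : ℂ) * β x := fun k t => by fun_prop
  have hκr : ∀ (k : ℂ) (t : ℝ), 0 ≤ t → ∀ x, k.re ≤ (k + (t : ℂ) * β x).re := by
    intro k t ht x
    rw [← Complex.ofReal_mul, Complex.add_re, Complex.ofReal_re]
    have := mul_nonneg ht (hβ0 x)
    linarith
  have hrhs : ∀ (k : ℂ) (t : ℝ) (V G : Lp ℂ p (volume : Measure ℝ)),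
      (k • V + (t : ℂ) • mulOp hβm hC V - G : Lp ℂ p (volume : Measure ℝ)) =ᵐ[volume]
        fun x => (k + (t : ℂ) * β x) * V x - G x := by
    intro k t V G
    filter_upwards [Lp.coeFn_sub (k • V + (t : ℂ) • mulOp hβm hC V) G,
      Lp.coeFn_add (k • V) ((t : ℂ) • mulOp hβm hC V), Lp.coeFn_smul k V,
      Lp.coeFn_smul (t : ℂ) (mulOp hβm hC V), coeFn_mulOp hβm hC V] with x h1 h2 h3 h4 h5
    rw [h1, Pi.sub_apply, h2, Pi.add_apply, h3, h4, Pi.smul_apply, Pi.smul_apply, h5]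
    simp only [smul_eq_mul]; ring
  have hrhs' : ∀ (k : ℂ) (V G : Lp ℂ p (volume : Measure ℝ)),
      (-k • V + G : Lp ℂ p (volume : Measure ℝ)) =ᵐ[volume] fun x => -k * V x + G x := by
    intro k V G
    filter_upwards [Lp.coeFn_add (-k • V) G, Lp.coeFn_smul (-k) V] with x h1 h2
    rw [h1, Pi.add_apply, h2, Pi.smul_apply, smul_eq_mul]
  refine ⟨weakDeriv_single, fun k t hk ht G => ?_, fun k t hk ht V G hV => ?_, fun k hk G => ?_,
    fun k hk V G hV => ?_⟩
  · obtain ⟨v, hv, hvp, -⟩ := exists_solution_growing hp (hκc k t) hk (hκr k t ht) (Lp.memLp G)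
    refine ⟨hvp.toLp v, v, hvp.coeFn_toLp, hv.congr ?_⟩
    filter_upwards [hrhs k t (hvp.toLp v) G, hvp.coeFn_toLp] with x h1 h2
    rw [h1, h2]
  · obtain ⟨u, hu, hu'⟩ := hV
    refine norm_le_of_eLpNorm_le (inv_nonneg.2 hk.le) hu (EventuallyEq.refl _ _)
      (eLpNorm_le_of_growing hp (hκc k t) hk (hκr k t ht) hu' ?_ ((memLp_congr_ae hu).1 (Lp.memLp V))
        (Lp.memLp G))
    filter_upwards [hrhs k t V G, hu] with x h1 h2
    rw [h1, h2]
  · obtain ⟨v, hv, hvp⟩ := exists_solution_decaying hp hk (Lp.memLp G)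
    refine ⟨hvp.toLp v, v, hvp.coeFn_toLp, hv.congr ?_⟩
    filter_upwards [hrhs' k (hvp.toLp v) G, hvp.coeFn_toLp] with x h1 h2
    rw [h1, h2]
  · obtain ⟨u, hu, hu'⟩ := hV
    refine norm_le_of_eLpNorm_le (inv_nonneg.2 hk.le) hu (EventuallyEq.refl _ _)
      (eLpNorm_le_of_decaying hp hk hu' ?_ ((memLp_congr_ae hu).1 (Lp.memLp V)) (Lp.memLp G))
    filter_upwards [hrhs' k V G, hu] with x h1 h2
    rw [h1, h2]

end LpDeriv

/-! ### Finite rank approximation of decaying multipliers -/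

section Approximation

open ENNReal

/-- One modulus of continuity for both exponents: Hölder gives √δ for p = 2 and δ for p = ∞, and δ ≤
√δ when δ ≤ 1. -/
theorem integral_norm_le_sqrt {p : ℝ≥0∞} (hp : p = 2 ∨ p = ∞) {v : ℝ → ℂ} (hv : MemLp v p volume)
    {a b δ : ℝ} (hab : a ≤ b) (hδ : b - a ≤ δ) (hδ1 : δ ≤ 1) :
    ∫ x in a..b, ‖v x‖ ≤ (eLpNorm v p volume).toReal * Real.sqrt δ := by
  have hp1 : 1 ≤ p := by
    rcases hp with rfl | rfl
    · exact one_le_two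
    · exact le_top
  refine (integral_norm_le_of_memLp hp1 hv a b hab).trans ?_
  gcongr
  have h1 : Real.sqrt (b - a) ≤ Real.sqrt δ := Real.sqrt_le_sqrt hδ
  refine le_trans ?_ h1
  rcases hp with rfl | rfl
  · rw [ENNReal.toReal_ofNat, Real.sqrt_eq_rpow]
    norm_num
  · have e : (1 : ℝ) - 1 / (∞ : ℝ≥0∞).toReal = 1 := by simp
    rw [e, Real.rpow_one]
    refine Real.le_sqrt_of_sq_le ?_
    nlinarith

variable {p : ℝ≥0∞}

/-- A Poincaré estimate on one cell: the oscillation of u there is bounded by the integral of |v|.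
-/
theorem norm_sub_average_le (hp : p = 2 ∨ p = ∞) {u v : ℝ → ℂ} (hu : IsPrimitive u v)
    (hv : MemLp v p volume) {s δ : ℝ} (hδ : 0 < δ) (hδ1 : δ ≤ 1) {x : ℝ}
    (hx : x ∈ Set.Ioc s (s + δ)) :
    ‖u x - (δ : ℂ)⁻¹ * ∫ t in s..(s + δ), u t‖ ≤ (eLpNorm v p volume).toReal * Real.sqrt δ := by
  have hδC : (δ : ℂ) ≠ 0 := by exact_mod_cast hδ.ne'
  have hdiff : ∀ t ∈ Set.uIoc s (s + δ), ‖u x - u t‖ ≤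
      (eLpNorm v p volume).toReal * Real.sqrt δ := by
    intro t ht
    rw [Set.uIoc_of_le (by linarith)] at ht
    rw [← hu.2 t x]
    refine (intervalIntegral.norm_integral_le_abs_integral_norm).trans ?_
    rcases le_total t x with h | h
    · rw [abs_of_nonneg (intervalIntegral.integral_nonneg h fun _ _ => norm_nonneg _)]
      exact integral_norm_le_sqrt hp hv h (by linarith [ht.1, hx.2]) hδ1
    · rw [intervalIntegral.integral_symm, abs_neg,
        abs_of_nonneg (intervalIntegral.integral_nonneg h fun _ _ => norm_nonneg _)]
      exact integral_norm_le_sqrt hp hv h (by linarith [ht.2, hx.1]) hδ1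
  have e : u x - (δ : ℂ)⁻¹ * ∫ t in s..(s + δ), u t =
      (δ : ℂ)⁻¹ * ∫ t in s..(s + δ), (u x - u t) := by
    rw [intervalIntegral.integral_sub (by simp) (hu.continuous.intervalIntegrable _ _),
      intervalIntegral.integral_const, add_sub_cancel_left, mul_sub, Complex.real_smul,
      inv_mul_cancel_left₀ hδC]
  rw [e, norm_mul, norm_inv, Complex.norm_real, Real.norm_eq_abs, abs_of_pos hδ]
  have h1 := intervalIntegral.norm_integral_le_of_norm_le_const hdiff
  rw [add_sub_cancel_left, abs_of_pos hδ] at h1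
  rw [inv_mul_le_iff₀ hδ]
  linarith

variable [hp1 : Fact (1 ≤ p)]

/-- Integration over a bounded interval. -/
def intervalFunctional (p : ℝ≥0∞) [hp1 : Fact (1 ≤ p)] {a b : ℝ} (hab : a ≤ b) :
    Lp ℂ p (volume : Measure ℝ) →L[ℂ] ℂ :=
  have hi : ∀ U : Lp ℂ p (volume : Measure ℝ), IntervalIntegrable U volume a b := fun U => by
    rw [intervalIntegrable_iff_integrableOn_Ioc_of_le hab]
    exact ((Lp.memLp U).restrict (Set.Ioc a b)).integrable hp1.out
  LinearMap.mkContinuous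
    { toFun := fun U => ∫ x in a..b, U x
      map_add' := fun U V => by
        rw [← intervalIntegral.integral_add (hi U) (hi V)]
        exact intervalIntegral.integral_congr_ae ((Lp.coeFn_add U V).mono fun x hx _ => hx)
      map_smul' := fun t U => by
        rw [RingHom.id_apply, ← intervalIntegral.integral_smul]
        exact intervalIntegral.integral_congr_ae ((Lp.coeFn_smul t U).mono fun x hx _ => hx) }
    ((b - a) ^ (1 - 1 / p.toReal)) fun U => by
      refine (intervalIntegral.norm_integral_le_integral_norm hab).trans ?_
      rw [mul_comm]
      exact integral_norm_le_of_memLp hp1.out (Lp.memLp U) a b hab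

theorem intervalFunctional_apply {a b : ℝ} (hab : a ≤ b) (U : Lp ℂ p (volume : Measure ℝ)) :
    intervalFunctional p hab U = ∫ x in a..b, U x := rfl

theorem exists_mem_Ioc_grid {M δ : ℝ} (hδ : 0 < δ) {n : ℕ} (hn : n * δ = 2 * M) {x : ℝ}
    (hx : x ∈ Set.Ioc (-M) M) : ∃ i : Fin n, x ∈ Set.Ioc (-M + i * δ) (-M + i * δ + δ) ∧
      ∀ j : Fin n, j ≠ i → x ∉ Set.Ioc (-M + j * δ) (-M + j * δ + δ) := by
  set t : ℝ := (x + M) / δ with ht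
  have htx : t * δ = x + M := div_mul_cancel₀ _ hδ.ne'
  have ht0 : 0 < t := div_pos (by linarith [hx.1]) hδ
  have htn : t ≤ n := by
    rw [ht, div_le_iff₀ hδ, hn]; linarith [hx.2]
  have hc0 : 0 < ⌈t⌉₊ := Nat.ceil_pos.2 ht0
  have hcn : ⌈t⌉₊ ≤ n := Nat.ceil_le.2 htn
  have hlt : ((⌈t⌉₊ - 1 : ℕ) : ℝ) < t := by
    rw [← Nat.lt_ceil]; omega
  have hle : t ≤ ((⌈t⌉₊ - 1 : ℕ) : ℝ) + 1 := by
    have h := Nat.le_ceil t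
    have e : ((⌈t⌉₊ - 1 : ℕ) : ℝ) + 1 = ⌈t⌉₊ := by
      exact_mod_cast Nat.sub_add_cancel hc0
    rwa [e]
  -- The cells are open on the left and closed on the right, so the point with rescaled coordinate t
  -- lies in cell ⌈t⌉ - 1, counted from 0.
  refine ⟨⟨⌈t⌉₊ - 1, by omega⟩, ⟨?_, ?_⟩, fun j hj hxj => hj (Fin.ext ?_)⟩
  · simp only; nlinarith
  · simp only; nlinarith
  · have h1 : (j : ℝ) < t := by
      have := hxj.1
      by_contra hc
      push Not at hc
      nlinarith
    have h2 : t ≤ (j : ℝ) + 1 := by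
      have := hxj.2
      by_contra hc
      push Not at hc
      nlinarith
    have h3 : (j : ℕ) < ⌈t⌉₊ := Nat.lt_ceil.2 h1
    have h4 : ⌈t⌉₊ ≤ (j : ℕ) + 1 := Nat.ceil_le.2 (by exact_mod_cast h2)
    simp only; omega

/-- Multiplication by a bounded function vanishing at infinity is approximable by operators of
finite rank on the domain of the weak derivative. -/
theorem isApproximable_mulOp (hp : p = 2 ∨ p = ∞) {a : ℝ → ℂ}
    (ha : AEStronglyMeasurable a volume) {C : ℝ} (hC : ∀ x, ‖a x‖ ≤ C)
    (hbot : Tendsto a atBot (𝓝 0)) (htop : Tendsto a atTop (𝓝 0)) :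
    IsApproximable (weakDeriv p) (mulOp ha hC) := by
  intro ε hε
  have hC0 : 0 ≤ C := (norm_nonneg _).trans (hC 0)
  obtain ⟨M, hM1, hM⟩ : ∃ M : ℝ, 1 ≤ M ∧ ∀ x, x ∉ Set.Ioc (-M) M → ‖a x‖ ≤ ε := by
    have h1 : ∀ᶠ x in atBot, ‖a x‖ ≤ ε := by
      have := (tendsto_norm_zero.comp hbot).eventually_le_const hε
      simpa using this
    have h2 : ∀ᶠ x in atTop, ‖a x‖ ≤ ε := by
      have := (tendsto_norm_zero.comp htop).eventually_le_const hε
      simpa using this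
    obtain ⟨m₁, hm₁⟩ := eventually_atBot.1 h1
    obtain ⟨m₂, hm₂⟩ := eventually_atTop.1 h2
    refine ⟨max 1 (max (-m₁) m₂), le_max_left _ _, fun x hx => ?_⟩
    have e1 : -m₁ ≤ max 1 (max (-m₁) m₂) := (le_max_left _ _).trans (le_max_right _ _)
    have e2 : m₂ ≤ max 1 (max (-m₁) m₂) := (le_max_right _ _).trans (le_max_right _ _)
    rw [Set.mem_Ioc, not_and_or, not_lt, not_le] at hx
    rcases hx with hx | hx
    · exact hm₁ x (by linarith)
    · exact hm₂ x (by linarith)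
  set J : Set ℝ := Set.Ioc (-M) M with hJ
  have hJp : MemLp (J.indicator fun _ => (1 : ℂ)) p volume :=
    memLp_indicator_const p measurableSet_Ioc 1 (Or.inr (by simp))
  set N : ℝ := (eLpNorm (J.indicator fun _ => (1 : ℂ)) p volume).toReal with hN
  -- The window is fixed before the mesh, because δ has to compensate N, the Lᵖ norm of the
  -- indicator of the window. It must also divide the length 2M.
  obtain ⟨δ, hδ0, hδ1, hδN, n, hn⟩ : ∃ δ : ℝ, 0 < δ ∧ δ ≤ 1 ∧ C * N * Real.sqrt δ ≤ ε ∧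
      ∃ n : ℕ, n * δ = 2 * M := by
    set η : ℝ := min 1 ((ε / (C * N + 1)) ^ 2) with hη
    have hN0 : 0 ≤ N := ENNReal.toReal_nonneg
    have hη0 : 0 < η := by positivity
    obtain ⟨n, hn⟩ := exists_nat_gt (2 * M / η)
    have hn0 : (0 : ℝ) < n := lt_of_le_of_lt (by positivity) hn
    have hle : 2 * M / n ≤ η := by
      rw [div_lt_iff₀ hη0] at hn
      rw [div_le_iff₀ hn0]; linarith
    refine ⟨2 * M / n, by positivity, hle.trans (min_le_left _ _), ?_, n, by field_simp⟩
    have h1 : Real.sqrt (2 * M / n) ≤ ε / (C * N + 1) := by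
      rw [← Real.sqrt_sq (show 0 ≤ ε / (C * N + 1) by positivity)]
      exact Real.sqrt_le_sqrt (hle.trans (min_le_right _ _))
    calc C * N * Real.sqrt (2 * M / n) ≤ C * N * (ε / (C * N + 1)) := by gcongr
      _ = ε * (C * N / (C * N + 1)) := by ring
      _ ≤ ε * 1 := by
          gcongr
          rw [div_le_one (by positivity)]; linarith
      _ = ε := mul_one _
  set I : Fin n → Set ℝ := fun i => Set.Ioc (-M + i * δ) (-M + i * δ + δ) with hI
  have hIJ : ∀ i, I i ⊆ J := by
    intro i x hx
    have h1 : ((i : ℕ) : ℝ) + 1 ≤ n := by exact_mod_cast i.2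
    have h2 : (0 : ℝ) ≤ (i : ℕ) * δ := by positivity
    refine ⟨by linarith [hx.1], ?_⟩
    have := hx.2
    nlinarith
  have hep : ∀ i, MemLp (fun x => a x * (I i).indicator (fun _ => (1 : ℂ)) x) p volume := fun i =>
    memLp_bounded_mul ha hC (memLp_indicator_const p measurableSet_Ioc 1 (Or.inr (by simp)))
  -- The finite rank operator replaces U on each cell by its average, multiplies by a, and gives 0
  -- outside the window.
  refine ⟨n, fun i => (δ : ℂ)⁻¹ • intervalFunctional p
    (show -M + i * δ ≤ -M + i * δ + δ by linarith), fun i => (hep i).toLp _, fun U V hUV => ?_⟩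
  obtain ⟨u, hu, huV⟩ := hUV
  set D : ℝ → ℂ := fun x => a x * u x - ∑ i : Fin n, ((δ : ℂ)⁻¹ *
    ∫ t in (-M + i * δ)..(-M + i * δ + δ), u t) * (a x * (I i).indicator (fun _ => (1 : ℂ)) x)
    with hD
  have hav : ∀ i : Fin n, ∫ t in (-M + i * δ)..(-M + i * δ + δ), U t =
      ∫ t in (-M + i * δ)..(-M + i * δ + δ), u t := fun i =>
    intervalIntegral.integral_congr_ae (hu.mono fun x hx _ => hx)
  have hcoe : (mulOp ha hC U - ∑ i : Fin n, ((δ : ℂ)⁻¹ • intervalFunctional p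
      (show -M + (i : ℕ) * δ ≤ -M + (i : ℕ) * δ + δ by linarith)) U • (hep i).toLp _ :
      Lp ℂ p (volume : Measure ℝ)) =ᵐ[volume] D := by
    have h1 := Lp.coeFn_sub (mulOp ha hC U) (∑ i : Fin n, ((δ : ℂ)⁻¹ • intervalFunctional p
      (show -M + (i : ℕ) * δ ≤ -M + (i : ℕ) * δ + δ by linarith)) U • (hep i).toLp _)
    have h2 := Lp.coeFn_finsetSum Finset.univ (fun i : Fin n =>
      ((δ : ℂ)⁻¹ • intervalFunctional p
      (show -M + (i : ℕ) * δ ≤ -M + (i : ℕ) * δ + δ by linarith)) U • (hep i).toLp _)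
    have h3 : ∀ᵐ x, ∀ i : Fin n, (((δ : ℂ)⁻¹ • intervalFunctional p
      (show -M + (i : ℕ) * δ ≤ -M + (i : ℕ) * δ + δ by linarith)) U • (hep i).toLp _ :
      Lp ℂ p (volume : Measure ℝ)) x = ((δ : ℂ)⁻¹ *
        ∫ t in (-M + i * δ)..(-M + i * δ + δ), u t) *
          (a x * (I i).indicator (fun _ => (1 : ℂ)) x) := by
      rw [ae_all_iff]
      intro i
      filter_upwards [Lp.coeFn_smul (((δ : ℂ)⁻¹ • intervalFunctional p
        (show -M + (i : ℕ) * δ ≤ -M + (i : ℕ) * δ + δ by linarith)) U) ((hep i).toLp _),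
        (hep i).coeFn_toLp] with x h1 h2
      rw [h1, Pi.smul_apply, h2, smul_apply, intervalFunctional_apply, hav, smul_eq_mul,
        smul_eq_mul]
    filter_upwards [h1, h2, h3, hu, coeFn_mulOp ha hC U] with x e1 e2 e3 e4 e5
    rw [e1, Pi.sub_apply, e5, e4, e2, Finset.sum_apply, hD]
    simp only [e3]
  set K : ℝ := C * (‖V‖ * Real.sqrt δ) with hK
  -- Inside the window the error is a times the deviation of u from its cell average, at most K = C
  -- ‖V‖ √δ. Outside, it is a u with |a| ≤ ε.
  have hDle : ∀ x, ‖D x‖ ≤ ‖ε * ‖u x‖ + ‖(J.indicator (fun _ => (K : ℂ)) x)‖‖ := by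
    intro x
    rw [Real.norm_of_nonneg (by positivity)]
    by_cases hx : x ∈ J
    · obtain ⟨i, hi, hne⟩ := exists_mem_Ioc_grid hδ0 hn hx
      have e1 : D x = a x * (u x - (δ : ℂ)⁻¹ *
          ∫ t in (-M + i * δ)..(-M + i * δ + δ), u t) := by
        simp only [hD]
        rw [Finset.sum_eq_single i]
        · rw [Set.indicator_of_mem hi]; ring
        · intro j _ hj
          rw [Set.indicator_of_notMem (hne j hj)]; ring
        · simp
      have e2 := norm_sub_average_le hp huV (Lp.memLp V) hδ0 hδ1 hi
      rw [Set.indicator_of_mem hx, e1, norm_mul]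
      have e3 : ‖(K : ℂ)‖ = K := by
        rw [Complex.norm_real, Real.norm_of_nonneg]; positivity
      rw [e3, hK]
      have e4 : ‖a x‖ * ‖u x - (δ : ℂ)⁻¹ * ∫ t in (-M + i * δ)..(-M + i * δ + δ), u t‖ ≤
          C * (‖V‖ * Real.sqrt δ) := mul_le_mul (hC x) e2 (norm_nonneg _) hC0
      have e5 : 0 ≤ ε * ‖u x‖ := by positivity
      linarith
    · have e1 : D x = a x * u x := by
        simp only [hD]
        rw [Finset.sum_eq_zero, sub_zero]
        intro i _
        rw [Set.indicator_of_notMem fun h => hx (hIJ i h)]; ring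
      rw [Set.indicator_of_notMem hx, e1, norm_mul, norm_zero, add_zero]
      gcongr
      exact hM x hx
  have hup : MemLp u p volume := (memLp_congr_ae hu).1 (Lp.memLp U)
  have hKi : J.indicator (fun _ => (K : ℂ)) = fun x => (K : ℂ) * J.indicator (fun _ => (1 : ℂ)) x := by
    funext x
    by_cases hx : x ∈ J <;> simp [hx]
  have hfin : eLpNorm D p volume ≤ ENNReal.ofReal (ε * ‖U‖ + K * N) := by
    have h1 : eLpNorm D p volume ≤ eLpNorm (fun x => ε * ‖u x‖) p volume +
        eLpNorm (fun x => ‖(J.indicator (fun _ => (K : ℂ)) x)‖) p volume := by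
      refine (eLpNorm_mono hDle).trans ?_
      refine eLpNorm_add_le ?_ ?_ hp1.out
      · exact (hup.1.norm.const_mul ε)
      · exact (aestronglyMeasurable_const.indicator measurableSet_Ioc).norm
    refine h1.trans ?_
    have h2 : eLpNorm (fun x => ε * ‖u x‖) p volume = ENNReal.ofReal (ε * ‖U‖) := by
      have := eLpNorm_const_smul ε (fun x => ‖u x‖) p volume
      simp only [Pi.smul_def, smul_eq_mul] at this
      rw [this, eLpNorm_norm, ENNReal.ofReal_mul hε.le, Lp.norm_def,
        ENNReal.ofReal_toReal (Lp.eLpNorm_ne_top U), eLpNorm_congr_ae hu, Real.enorm_of_nonneg hε.le]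
    have h3 : eLpNorm (fun x => ‖(J.indicator (fun _ => (K : ℂ)) x)‖) p volume =
        ENNReal.ofReal (K * N) := by
      rw [eLpNorm_norm, hKi]
      have := eLpNorm_const_smul (K : ℂ) (J.indicator fun _ => (1 : ℂ)) p volume
      simp only [Pi.smul_def, smul_eq_mul] at this
      have hK0 : 0 ≤ K := by positivity
      rw [this, ENNReal.ofReal_mul hK0, hN, ENNReal.ofReal_toReal hJp.2.ne, ← ofReal_norm,
        Complex.norm_real, Real.norm_of_nonneg hK0]
    rw [h2, h3, ← ENNReal.ofReal_add (by positivity)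
      (mul_nonneg (by positivity) ENNReal.toReal_nonneg)]
  rw [Lp.norm_def, eLpNorm_congr_ae hcoe]
  refine (ENNReal.toReal_le_of_le_ofReal ?_ hfin).trans ?_
  · exact add_nonneg (by positivity) (mul_nonneg (by positivity) ENNReal.toReal_nonneg)
  · rw [mul_add]
    have : K * N ≤ ε * ‖V‖ := by
      calc K * N = (C * N * Real.sqrt δ) * ‖V‖ := by rw [hK]; ring
        _ ≤ ε * ‖V‖ := by gcongr
    linarith

end Approximation

/-! ### From the weighted spaces to `Lᵖ` -/

section Transfer

open ENNReal

theorem weight_apply (α : ℝ) (v : ℝ → ℂ) (x : ℝ) :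
    weight α v x = (Real.exp (α * x) : ℂ) * v x := rfl

theorem weight_neg_weight (α : ℝ) (v : ℝ → ℂ) : weight (-α) (weight α v) = v := by
  funext ξ
  simp [weight, ← mul_assoc, ← Complex.exp_add]

theorem weight_weight_neg (α : ℝ) (v : ℝ → ℂ) : weight α (weight (-α) v) = v := by
  simpa using weight_neg_weight (-α) v

theorem continuous_weight (α : ℝ) {v : ℝ → ℂ} (hv : Continuous v) : Continuous (weight α v) := by
  have : Continuous fun ξ : ℝ => (Real.exp (α * ξ) : ℂ) := by fun_prop
  exact this.mul hv

theorem IsPrimitive.weight (α : ℝ) {v r : ℝ → ℂ} (hv : IsPrimitive v r) :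
    IsPrimitive (weight α v)
      (fun x => CombustionFront.weight α r x + α * CombustionFront.weight α v x) := by
  have h1 : IsPrimitive (fun x : ℝ => (Real.exp (α * x) : ℂ))
      (fun x : ℝ => (α : ℂ) * (Real.exp (α * x) : ℂ)) := by
    refine isPrimitive_of_hasDerivAt (fun x => ?_) (by fun_prop)
    have h2 : HasDerivAt (fun x : ℝ => Real.exp (α * x)) (Real.exp (α * x) * (α * 1)) x :=
      ((hasDerivAt_id x).const_mul α).exp
    have h3 := h2.ofReal_comp
    convert h3 using 1
    push_cast; ring
  have h4 := h1.mul hv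
  refine ⟨?_, ?_⟩
  · convert h4.1 using 1
    funext x; simp only [weight_apply]; ring
  · intro a b
    have h5 := h4.2 a b
    simp only [weight_apply]
    rw [← h5]
    congr 1
    funext x; ring

/-- The first derivative of `e^{α ξ} v` when `v' = r`. -/
def weightedDeriv (α : ℝ) (v r : ℝ → ℂ) (x : ℝ) : ℂ := weight α r x + α * weight α v x

theorem isPrimitive_weight_deriv (α : ℝ) {v : ℝ → ℂ} (hv : Differentiable ℝ v)
    (hv' : LocAC (deriv v)) : IsPrimitive (weight α v) (weightedDeriv α v (deriv v)) :=
  (isPrimitive_of_hasDerivAt (fun x => (hv x).hasDerivAt) hv'.continuous).weight α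

theorem isPrimitive_weightedDeriv (α : ℝ) {v : ℝ → ℂ} (hv : Differentiable ℝ v)
    (hv' : LocAC (deriv v)) : IsPrimitive (weightedDeriv α v (deriv v))
      (fun x => weightedDeriv α (deriv v) (deriv (deriv v)) x
        + α * weightedDeriv α v (deriv v) x) :=
  (hv'.isPrimitive.weight α).add ((isPrimitive_weight_deriv α hv hv').const_mul α)

/-- A solution of `v' = r` for the weighted function gives regularity of the function. -/
theorem differentiable_of_weight {α : ℝ} {v r s : ℝ → ℂ} (hv : IsPrimitive (weight α v) r)
    (hr : IsPrimitive r s) : Differentiable ℝ v ∧ LocAC (deriv v) := by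
  have h1 := hv.weight (-α)
  rw [weight_neg_weight] at h1
  have h2 := (hr.weight (-α)).add (h1.const_mul ((-α : ℝ) : ℂ))
  have h3 : ∀ x, HasDerivAt v _ x := h1.hasDerivAt h2.continuous
  refine ⟨fun x => (h3 x).differentiableAt, ?_⟩
  rw [funext fun x => (h3 x).deriv]
  exact h2.locAC

theorem locAC_of_weight {α : ℝ} {v r : ℝ → ℂ} (hv : IsPrimitive (weight α v) r) : LocAC v := by
  have h1 := hv.weight (-α)
  rw [weight_neg_weight] at h1
  exact h1.locAC

variable {p : ℝ≥0∞}

theorem coeFn_linear (d m : ℂ) {S R U : Lp ℂ p (volume : Measure ℝ)} {s r P : ℝ → ℂ}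
    (hS : S =ᵐ[volume] s) (hR : R =ᵐ[volume] r) (hU : U =ᵐ[volume] P) :
    (S + d • R - m • U : Lp ℂ p (volume : Measure ℝ)) =ᵐ[volume]
      fun ξ => s ξ + d * r ξ - m * P ξ := by
  filter_upwards [Lp.coeFn_sub (S + d • R) (m • U), Lp.coeFn_add S (d • R), Lp.coeFn_smul d R,
    Lp.coeFn_smul m U, hS, hR, hU] with ξ h1 h2 h3 h4 h5 h6 h7
  rw [h1, Pi.sub_apply, h2, Pi.add_apply, h3, h4, Pi.smul_apply, Pi.smul_apply, h5, h6, h7,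
    smul_eq_mul, smul_eq_mul]

theorem memLp_reaction {a b : ℝ → ℂ} {Ca Cb : ℝ} (h : ℝ) (ha : AEStronglyMeasurable a volume)
    (hb : AEStronglyMeasurable b volume) (hCa : ∀ x, ‖a x‖ ≤ Ca) (hCb : ∀ x, ‖b x‖ ≤ Cb)
    {P Q : ℝ → ℂ} (hP : MemLp P p volume) (hQ : MemLp Q p volume) :
    MemLp (fun ξ => a ξ * ((h : ℂ) * P ξ - (1 - (h : ℂ)) * Q ξ) + b ξ * Q ξ) p volume :=
  (memLp_bounded_mul ha hCa ((hP.const_mul _).sub (hQ.const_mul _))).add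
    (memLp_bounded_mul hb hCb hQ)

variable [hp1 : Fact (1 ≤ p)]

/-- `ι` and `j` read the elements of `E` as functions and, after multiplication with the weight, as
elements of `Lᵖ`; the image of `j` contains the functions with a weak derivative in `Lᵖ`. -/
structure IsWeightedSpace (p : ℝ≥0∞) [Fact (1 ≤ p)] (α : ℝ) {E : Type} [NormedAddCommGroup E]
    [NormedSpace ℂ E] (ι : E →ₗ[ℂ] (ℝ → ℂ)) (j : E →L[ℂ] Lp ℂ p (volume : Measure ℝ)) :
    Prop where
  coe : ∀ e, j e =ᵐ[volume] weight α (ι e)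
  inj : Function.Injective ι
  cont : ∀ e, Continuous (ι e)
  lift : ∀ U V, (U, V) ∈ weakDeriv p → ∃ e, j e = U ∧ ‖e‖ ≤ ‖U‖ + ‖V‖
  memLp_deriv : ∀ (e : E) (r s : ℝ → ℂ) (t : ℂ), IsPrimitive (weight α (ι e)) r →
    IsPrimitive r s → MemLp (fun x => s x + t * r x) p volume → MemLp r p volume

variable {α : ℝ} {E : Type} [NormedAddCommGroup E] [NormedSpace ℂ E] {ι : E →ₗ[ℂ] (ℝ → ℂ)}
  {j : E →L[ℂ] Lp ℂ p (volume : Measure ℝ)}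

namespace IsWeightedSpace

theorem injective (h : IsWeightedSpace p α ι j) : Function.Injective j := by
  intro e e' he
  refine h.inj (weight_injective α ?_)
  refine ((continuous_weight α (h.cont e)).ae_eq_iff_eq volume (continuous_weight α (h.cont e'))).1 ?_
  exact (h.coe e).symm.trans (he ▸ h.coe e')

theorem memLp (h : IsWeightedSpace p α ι j) (e : E) : MemLp (weight α (ι e)) p volume :=
  (memLp_congr_ae (h.coe e)).1 (Lp.memLp _)

theorem isPrimitive (h : IsWeightedSpace p α ι j) {e : E} {V : Lp ℂ p (volume : Measure ℝ)}
    (hV : (j e, V) ∈ weakDeriv p) : IsPrimitive (weight α (ι e)) V := by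
  obtain ⟨v, hv, hv'⟩ := mem_weakDeriv.1 hV
  have : v = weight α (ι e) :=
    (hv'.continuous.ae_eq_iff_eq volume (continuous_weight α (h.cont e))).1 (hv.symm.trans (h.coe e))
  exact this ▸ hv'

end IsWeightedSpace

variable {a b : ℝ → ℂ} {ha : AEStronglyMeasurable a volume} {hb : AEStronglyMeasurable b volume}
  {Ca Cb : ℝ} {hCa : ∀ x, ‖a x‖ ≤ Ca} {hCb : ∀ x, ‖b x‖ ≤ Cb}

theorem coeFn_reaction (h : ℝ) {x : Lp ℂ p (volume : Measure ℝ) × Lp ℂ p (volume : Measure ℝ)}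
    {P Q : ℝ → ℂ} (hP : x.1 =ᵐ[volume] P) (hQ : x.2 =ᵐ[volume] Q) :
    (mulOp ha hCa (tempPart h x) + mulOp hb hCb x.2 : Lp ℂ p (volume : Measure ℝ)) =ᵐ[volume]
      fun ξ => a ξ * ((h : ℂ) * P ξ - (1 - (h : ℂ)) * Q ξ) + b ξ * Q ξ := by
  filter_upwards [Lp.coeFn_add (mulOp ha hCa (tempPart h x)) (mulOp hb hCb x.2),
    coeFn_mulOp ha hCa (tempPart h x), coeFn_mulOp hb hCb x.2,
    Lp.coeFn_sub ((h : ℂ) • x.1) ((1 - (h : ℂ)) • x.2), Lp.coeFn_smul (h : ℂ) x.1,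
    Lp.coeFn_smul (1 - (h : ℂ)) x.2, hP, hQ] with ξ h1 h2 h3 h4 h5 h6 h7 h8
  rw [h1, Pi.add_apply, h2, h3, tempPart_apply, h4, Pi.sub_apply, h5, h6, Pi.smul_apply,
    Pi.smul_apply, h7, h8, smul_eq_mul, smul_eq_mul]

theorem coeFn_system_fst (d m : ℂ) (h : ℝ)
    {x : Lp ℂ p (volume : Measure ℝ) × Lp ℂ p (volume : Measure ℝ)}
    {R S : Lp ℂ p (volume : Measure ℝ)} {P Q r s : ℝ → ℂ} (hP : x.1 =ᵐ[volume] P)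
    (hQ : x.2 =ᵐ[volume] Q) (hR : R =ᵐ[volume] r) (hS : S =ᵐ[volume] s) :
    (S + d • R - m • x.1 + mulOp ha hCa (tempPart h x) + mulOp hb hCb x.2 :
      Lp ℂ p (volume : Measure ℝ)) =ᵐ[volume] fun ξ => s ξ + d * r ξ - m * P ξ +
        (a ξ * ((h : ℂ) * P ξ - (1 - (h : ℂ)) * Q ξ) + b ξ * Q ξ) := by
  rw [add_assoc]
  filter_upwards [Lp.coeFn_add (S + d • R - m • x.1)
    (mulOp ha hCa (tempPart h x) + mulOp hb hCb x.2),
    coeFn_reaction (ha := ha) (hb := hb) (hCa := hCa) (hCb := hCb) h hP hQ,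
    coeFn_linear d m hS hR hP] with ξ h1 h2 h3
  rw [h1, Pi.add_apply, h2, h3]

theorem coeFn_system_snd (c m : ℂ) (h : ℝ)
    {x : Lp ℂ p (volume : Measure ℝ) × Lp ℂ p (volume : Measure ℝ)}
    {T : Lp ℂ p (volume : Measure ℝ)} {P Q t : ℝ → ℂ} (hP : x.1 =ᵐ[volume] P)
    (hQ : x.2 =ᵐ[volume] Q) (hT : T =ᵐ[volume] t) :
    (c • T - m • x.2 - mulOp ha hCa (tempPart h x) - mulOp hb hCb x.2 :
      Lp ℂ p (volume : Measure ℝ)) =ᵐ[volume] fun ξ => c * t ξ - m * Q ξ -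
        (a ξ * ((h : ℂ) * P ξ - (1 - (h : ℂ)) * Q ξ) + b ξ * Q ξ) := by
  rw [sub_sub]
  have h0 : ((0 : Lp ℂ p (volume : Measure ℝ)) : ℝ → ℂ) =ᵐ[volume] 0 := Lp.coeFn_zero _ _ _
  have h3 := coeFn_linear c m h0 hT hQ
  rw [zero_add] at h3
  filter_upwards [Lp.coeFn_sub (c • T - m • x.2)
    (mulOp ha hCa (tempPart h x) + mulOp hb hCb x.2),
    coeFn_reaction (ha := ha) (hb := hb) (hCa := hCa) (hCb := hCb) h hP hQ, h3] with ξ h1 h2 h3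
  rw [h1, Pi.sub_apply, h2, h3, Pi.zero_apply, zero_add]

/-- Conjugation with the weight: (∂ - α)² + c (∂ - α) = ∂² + (c - 2α) ∂ - α (c - α), which is where
d and m come from. -/
theorem weighted_fst_iff (k : SystemCoeffs) (f P Q r s : ℝ → ℂ) (A B : ℂ) (ξ : ℝ) :
    f ξ = s ξ + (k.c : ℂ) * r ξ + A * ((k.h : ℂ) * P ξ - (1 - (k.h : ℂ)) * Q ξ) + B * Q ξ ↔
    weight k.α f ξ = (weightedDeriv k.α r s ξ + k.α * weightedDeriv k.α P r ξ)
      + (k.d : ℂ) * weightedDeriv k.α P r ξ - (k.m : ℂ) * weight k.α P ξ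
      + (A * ((k.h : ℂ) * weight k.α P ξ - (1 - (k.h : ℂ)) * weight k.α Q ξ)
        + B * weight k.α Q ξ) := by
  have hne : (Real.exp (k.α * ξ) : ℂ) ≠ 0 := by exact_mod_cast (Real.exp_pos _).ne'
  simp only [weightedDeriv, weight_apply, SystemCoeffs.d, SystemCoeffs.m]
  rw [← mul_right_inj' hne]
  push_cast
  refine Eq.congr rfl ?_
  ring

theorem weighted_snd_iff (k : SystemCoeffs) (f P Q t : ℝ → ℂ) (A B : ℂ) (ξ : ℝ) :
    f ξ = (k.c : ℂ) * t ξ - A * ((k.h : ℂ) * P ξ - (1 - (k.h : ℂ)) * Q ξ) - B * Q ξ ↔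
    weight k.α f ξ = (k.c : ℂ) * weightedDeriv k.α Q t ξ
      - ((k.c : ℂ) * k.α) * weight k.α Q ξ
      - (A * ((k.h : ℂ) * weight k.α P ξ - (1 - (k.h : ℂ)) * weight k.α Q ξ)
        + B * weight k.α Q ξ) := by
  have hne : (Real.exp (k.α * ξ) : ℂ) ≠ 0 := by exact_mod_cast (Real.exp_pos _).ne'
  simp only [weightedDeriv, weight_apply]
  rw [← mul_right_inj' hne]
  refine Eq.congr rfl ?_
  ring

/-- The weight turns each system into the other almost everywhere. What needs proof is regularity:
that the derivatives of a pair in the maximal domain lie in Lᵖ after weighting, and conversely that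
weak derivatives in Lᵖ give the classical regularity required in the domain. The domain embeds in E²
since first derivatives are controlled by the graph norm. -/
theorem isPartOf_linearization {k : SystemCoeffs} (hE : IsWeightedSpace p k.α ι j)
    {F : ℝ → ℝ} {u y : ℝ → ℝ}
    (ha : AEStronglyMeasurable
      (fun ξ => ((deriv F (temperature k.h u y ξ) * y ξ : ℝ) : ℂ)) volume)
    (hCa : ∀ ξ, ‖((deriv F (temperature k.h u y ξ) * y ξ : ℝ) : ℂ)‖ ≤ Ca)
    (hb : AEStronglyMeasurable (fun ξ => (F (temperature k.h u y ξ) : ℂ)) volume)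
    (hCb : ∀ ξ, ‖(F (temperature k.h u y ξ) : ℂ)‖ ≤ Cb)
    (h𝓓 : IsDerivation (weakDeriv p) (mulOp hb hCb)) :
    IsPartOf (linearization ι F k.h k.c u y)
      (systemGraph k (weakDeriv p) (mulOp ha hCa) (mulOp hb hCb)) (j.prodMap j) := by
  have hcC : (k.c : ℂ) ≠ 0 := by exact_mod_cast k.c_pos.ne'
  refine ⟨hE.injective.prodMap hE.injective, ?_, ?_⟩
  · rintro ⟨P, Q⟩ ⟨f, g⟩
    rw [linearization_graph ι hE.inj hE.cont, mem_systemGraph]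
    constructor
    · rintro ⟨h1, h2, h3, h4, h5⟩
      simp only at h1 h2 h3 h4 h5
      have h4' := h4.mono fun ξ hξ => (weighted_fst_iff k (ι f) (ι P) (ι Q) _ _ _ _ ξ).1 hξ
      have h5' := h5.mono fun ξ hξ => (weighted_snd_iff k (ι g) (ι P) (ι Q) _ _ _ ξ).1 hξ
      have hRP := isPrimitive_weight_deriv k.α h1 h2
      have hSR := isPrimitive_weightedDeriv k.α h1 h2
      have hTQ : IsPrimitive (weight k.α (ι Q)) (weightedDeriv k.α (ι Q) (deriv (ι Q))) :=
        h3.isPrimitive.weight k.α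
      have hreact := memLp_reaction k.h ha hb hCa hCb (hE.memLp P) (hE.memLp Q)
      -- The equation gives P'' + d P' in Lᵖ, and `memLp_deriv` extracts P' from this combination.
      -- Afterwards P'' and Q' are read off from the two equations.
      have hR : MemLp (weightedDeriv k.α (ι P) (deriv (ι P))) p volume := by
        refine hE.memLp_deriv P _ _ (k.d : ℂ) hRP hSR ?_
        refine (((hE.memLp f).add ((hE.memLp P).const_mul (k.m : ℂ))).sub hreact).ae_eq ?_
        filter_upwards [h4'] with ξ hξ
        simp only [Pi.add_apply, Pi.sub_apply, hξ]; ring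
      have hS : MemLp (fun x => weightedDeriv k.α (deriv (ι P)) (deriv (deriv (ι P))) x
          + k.α * weightedDeriv k.α (ι P) (deriv (ι P)) x) p volume := by
        refine ((((hE.memLp f).add ((hE.memLp P).const_mul (k.m : ℂ))).sub hreact).sub
          (hR.const_mul (k.d : ℂ))).ae_eq ?_
        filter_upwards [h4'] with ξ hξ
        simp only [Pi.add_apply, Pi.sub_apply, hξ]; ring
      have hT : MemLp (weightedDeriv k.α (ι Q) (deriv (ι Q))) p volume := by
        refine ((((hE.memLp g).add ((hE.memLp Q).const_mul ((k.c : ℂ) * k.α))).add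
          hreact).const_mul (k.c : ℂ)⁻¹).ae_eq ?_
        filter_upwards [h5'] with ξ hξ
        simp only [Pi.add_apply, hξ]
        field_simp
        ring
      refine ⟨hR.toLp _, hS.toLp _, hT.toLp _, ⟨_, hE.coe P, hRP.congr hR.coeFn_toLp.symm⟩,
        ⟨_, hR.coeFn_toLp, hSR.congr hS.coeFn_toLp.symm⟩,
        ⟨_, hE.coe Q, hTQ.congr hT.coeFn_toLp.symm⟩, Lp.ext ?_, Lp.ext ?_⟩
      · refine (hE.coe f).trans (EventuallyEq.trans ?_ (coeFn_system_fst (x := (j P, j Q)) _ _ _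
          (hE.coe P) (hE.coe Q) hR.coeFn_toLp hS.coeFn_toLp).symm)
        exact h4'
      · refine (hE.coe g).trans (EventuallyEq.trans ?_ (coeFn_system_snd (x := (j P, j Q)) _ _ _
          (hE.coe P) (hE.coe Q) hT.coeFn_toLp).symm)
        exact h5'
    · rintro ⟨R, S, T, h1, h2, h3, h4, h5⟩
      have hR := hE.isPrimitive (e := P) h1
      have hT := hE.isPrimitive (e := Q) h3
      obtain ⟨r, hr, hrS⟩ := mem_weakDeriv.1 h2
      obtain ⟨hd, hac⟩ := differentiable_of_weight (hR.congr hr) hrS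
      have hq := locAC_of_weight hT
      have hRP := isPrimitive_weight_deriv k.α hd hac
      have hSR := isPrimitive_weightedDeriv k.α hd hac
      have hTQ : IsPrimitive (weight k.α (ι Q)) (weightedDeriv k.α (ι Q) (deriv (ι Q))) :=
        hq.isPrimitive.weight k.α
      have er : r = weightedDeriv k.α (ι P) (deriv (ι P)) :=
        (hrS.continuous.ae_eq_iff_eq volume hSR.continuous).1
          (hr.symm.trans (hR.ae_eq hRP))
      have eS := (er ▸ hrS).ae_eq hSR
      refine ⟨hd, hac, hq, ?_, ?_⟩
      · have e := coeFn_system_fst (ha := ha) (hb := hb) (hCa := hCa) (hCb := hCb)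
          (x := (j P, j Q)) (k.d : ℂ) (k.m : ℂ) k.h (hE.coe P) (hE.coe Q) (er ▸ hr) eS
        have h6 := (hE.coe f).symm.trans
          ((show (j f : ℝ → ℂ) =ᵐ[volume] _ from by
            rw [show j f = _ from h4]; exact EventuallyEq.rfl).trans e)
        filter_upwards [h6] with ξ hξ
        exact (weighted_fst_iff k (ι f) (ι P) (ι Q) _ _ _ _ ξ).2 hξ
      · have e := coeFn_system_snd (ha := ha) (hb := hb) (hCa := hCa) (hCb := hCb)
          (x := (j P, j Q)) (k.c : ℂ) ((k.c : ℂ) * k.α) k.h (hE.coe P) (hE.coe Q) (hT.ae_eq hTQ)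
        have h6 := (hE.coe g).symm.trans
          ((show (j g : ℝ → ℂ) =ᵐ[volume] _ from by
            rw [show j g = _ from h5]; exact EventuallyEq.rfl).trans e)
        filter_upwards [h6] with ξ hξ
        exact (weighted_snd_iff k (ι g) (ι P) (ι Q) _ _ _ ξ).2 hξ
  · obtain ⟨C, hC0, hC⟩ := exists_system_deriv_le (k := k) (A := mulOp ha hCa) h𝓓
    refine ⟨1 + C, fun x f hxf => ?_⟩
    obtain ⟨R, T, h1, h2, h3, h4⟩ := hC x f hxf
    obtain ⟨e₁, he₁, hn₁⟩ := hE.lift _ _ h1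
    obtain ⟨e₂, he₂, hn₂⟩ := hE.lift _ _ h2
    refine ⟨(e₁, e₂), Prod.ext he₁ he₂, ?_⟩
    have := norm_fst_le x
    have := norm_snd_le x
    have := norm_nonneg f
    refine max_le ?_ ?_
    · calc ‖e₁‖ ≤ ‖x.1‖ + ‖R‖ := hn₁
        _ ≤ (1 + C) * (‖x‖ + ‖f‖) := by linarith
    · calc ‖e₂‖ ≤ ‖x.2‖ + ‖T‖ := hn₂
        _ ≤ (1 + C) * (‖x‖ + ‖f‖) := by linarith

end Transfer

/-! ### The weighted spaces over `H¹` and `BUC` -/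

section Spaces

open ENNReal

/-- The equation for k = 1, t = 0 says that 1 - ∂ has a bounded inverse, and such an operator is
closed. -/
theorem IsDerivation.isClosed {X : Type*} [NormedAddCommGroup X] [NormedSpace ℂ X]
    {𝓓 : Submodule ℂ (X × X)} {B : X →L[ℂ] X} (h : IsDerivation 𝓓 B) :
    IsClosed (𝓓 : Set (X × X)) := by
  refine IsSeqClosed.isClosed fun z w hz hzw => ?_
  obtain ⟨V, hV⟩ := h.exists_growing 1 0 (by simp) le_rfl (w.1 - w.2)
  have hle : ∀ n, ‖(z n).1 - V‖ ≤ ‖(z n).1 - (z n).2 - (w.1 - w.2)‖ := by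
    intro n
    have h1 := 𝓓.sub_mem (hz n) hV
    have h2 := h.norm_growing 1 0 (by simp) le_rfl ((z n).1 - V)
      ((z n).1 - (z n).2 - (w.1 - w.2)) (by
        convert h1 using 1
        refine Prod.ext rfl ?_
        simp only [Prod.snd_sub, one_smul, Complex.ofReal_zero, zero_smul]
        abel)
    simpa using h2
  have h1 : Tendsto (fun n => (z n).1) atTop (𝓝 w.1) := (continuous_fst.tendsto w).comp hzw
  have h2 : Tendsto (fun n => (z n).2) atTop (𝓝 w.2) := (continuous_snd.tendsto w).comp hzw
  have h3 : Tendsto (fun n => ‖(z n).1 - (z n).2 - (w.1 - w.2)‖) atTop (𝓝 0) := by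
    have := ((h1.sub h2).sub_const (w.1 - w.2)).norm
    simpa using this
  have h4 : ‖w.1 - V‖ ≤ 0 := le_of_tendsto_of_tendsto' (h1.sub_const V).norm h3 hle
  have h5 : V = w.1 := (sub_eq_zero.1 (norm_le_zero_iff.1 h4)).symm
  rw [h5] at hV
  have h6 : w = (w.1, (1 : ℂ) • w.1 + ((0 : ℝ) : ℂ) • B w.1 - (w.1 - w.2)) :=
    Prod.ext rfl (by simp)
  rw [h6]
  exact hV

theorem isClosed_weakDeriv {p : ℝ≥0∞} [Fact (1 ≤ p)] (hp : p = 2 ∨ p = ∞) :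
    IsClosed (weakDeriv p : Set (Lp ℂ p (volume : Measure ℝ) × Lp ℂ p (volume : Measure ℝ))) :=
  (isDerivation_weakDeriv hp (β := fun _ => 0) continuous_const (fun _ => le_rfl)
    aestronglyMeasurable_const (C := 0) (fun _ => by simp)).isClosed

/-! #### The space over `H¹` -/

theorem H1.norm_eq {α : ℝ} (e : H1 α) : ‖e‖ = ‖H1.jet α e‖ := rfl

/-- The element of `H1 α` with a given weighted function. -/
def H1.mk {α : ℝ} {v : ℝ → ℂ} (hv : v ∈ h1Submodule) : H1 α :=
  ⟨weight (-α) v, by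
    rw [Submodule.mem_comap, weight_weight_neg]; exact hv⟩

theorem H1.weight_mk {α : ℝ} {v : ℝ → ℂ} (hv : v ∈ h1Submodule) :
    weight α (H1.toFun α (H1.mk hv)) = v :=
  weight_weight_neg α v

theorem H1.jet_mk {α : ℝ} {v : ℝ → ℂ} (hv : v ∈ h1Submodule) {U V : Lp ℂ 2 (volume : Measure ℝ)}
    (hU : U =ᵐ[volume] v) (hV : V =ᵐ[volume] deriv v) :
    H1.jet α (H1.mk hv) = WithLp.toLp 2 (U, V) := by
  refine congrArg (WithLp.toLp 2) (Prod.ext (Lp.ext ?_) (Lp.ext ?_))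
  · refine (H1.weight_mem (H1.mk hv)).2.1.coeFn_toLp.trans ?_
    rw [H1.weight_mk]; exact hU.symm
  · refine (H1.weight_mem (H1.mk hv)).2.2.coeFn_toLp.trans ?_
    rw [H1.weight_mk]; exact hV.symm

theorem mem_h1Submodule_of_weakDeriv {U V : Lp ℂ 2 (volume : Measure ℝ)} {v : ℝ → ℂ}
    (hU : U =ᵐ[volume] v) (hv : IsPrimitive v V) : v ∈ h1Submodule :=
  ⟨hv.locAC, (memLp_congr_ae hU).1 (Lp.memLp U),
    (memLp_congr_ae hv.deriv_ae_eq).2 (Lp.memLp V)⟩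

/-- Reduces completeness of `H1 α` to closedness of the weak derivative. -/
theorem H1.range_jet (α : ℝ) :
    Set.range (H1.jet α) = WithLp.ofLp ⁻¹' (weakDeriv 2 : Set (_ × _)) := by
  ext z
  constructor
  · rintro ⟨e, rfl⟩
    exact ⟨_, (H1.weight_mem e).2.1.coeFn_toLp,
      (H1.weight_mem e).1.isPrimitive.congr (H1.weight_mem e).2.2.coeFn_toLp.symm⟩
  · rintro ⟨v, hU, hv⟩
    exact ⟨H1.mk (mem_h1Submodule_of_weakDeriv hU hv), H1.jet_mk _ hU hv.deriv_ae_eq.symm⟩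

instance (α : ℝ) : CompleteSpace (H1 α) := by
  have hi : Isometry (H1.jet α) := AddMonoidHomClass.isometry_of_norm _ fun _ => rfl
  rw [completeSpace_iff_isComplete_range hi.isUniformInducing, H1.range_jet]
  refine IsClosed.isComplete ?_
  exact (isClosed_weakDeriv (Or.inl rfl)).preimage (WithLp.prod_continuous_ofLp 2 _ _)

/-- `u ↦ e^{α ξ} u` with values in `L²`. -/
def H1.toL2 (α : ℝ) : H1 α →L[ℂ] Lp ℂ 2 (volume : Measure ℝ) :=
  LinearMap.mkContinuous
    { toFun := fun e => (WithLp.ofLp (H1.jet α e)).1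
      map_add' := fun e e' => by rw [map_add]; rfl
      map_smul' := fun a e => by rw [map_smul]; rfl } 1 fun e => by
    rw [one_mul, H1.norm_eq]
    exact WithLp.norm_fst_le _ _

theorem H1.isWeightedSpace (α : ℝ) : IsWeightedSpace 2 α (H1.toFun α) (H1.toL2 α) where
  coe e := (H1.weight_mem e).2.1.coeFn_toLp
  inj := H1.toFun_injective α
  cont := H1.continuous
  lift U V h := by
    obtain ⟨v, hU, hv⟩ := h
    have hj := H1.jet_mk (α := α) (mem_h1Submodule_of_weakDeriv hU hv) hU hv.deriv_ae_eq.symm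
    refine ⟨H1.mk (mem_h1Submodule_of_weakDeriv hU hv), ?_, ?_⟩
    · exact congrArg (fun z => (WithLp.ofLp z).1) hj
    · rw [H1.norm_eq, hj, WithLp.prod_norm_eq_of_L2]
      refine Real.sqrt_le_iff.2 ⟨by positivity, ?_⟩
      change ‖U‖ ^ 2 + ‖V‖ ^ 2 ≤ (‖U‖ + ‖V‖) ^ 2
      nlinarith [norm_nonneg U, norm_nonneg V]
  memLp_deriv e r s t hr _ _ := (memLp_congr_ae hr.deriv_ae_eq).1 (H1.weight_mem e).2.2

/-! #### The space over `BUC` -/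

theorem norm_le_of_ae_norm_le {v : ℝ → ℂ} (hv : Continuous v) {C : ℝ}
    (h : ∀ᵐ x, ‖v x‖ ≤ C) (x : ℝ) : ‖v x‖ ≤ C := by
  have hd : Dense {x | ‖v x‖ ≤ C} := Measure.dense_of_ae h
  have hc : IsClosed {x | ‖v x‖ ≤ C} := isClosed_le hv.norm continuous_const
  have : x ∈ closure {x | ‖v x‖ ≤ C} := hd x
  rwa [hc.closure_eq] at this

theorem ae_norm_le_norm (V : Lp ℂ ∞ (volume : Measure ℝ)) : ∀ᵐ x, ‖V x‖ ≤ ‖V‖ := by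
  have h1 := ae_le_eLpNormEssSup (f := V) (μ := (volume : Measure ℝ))
  have h2 : eLpNormEssSup V volume ≠ ∞ := by
    rw [← eLpNorm_exponent_top]; exact Lp.eLpNorm_ne_top V
  filter_upwards [h1] with x hx
  rw [Lp.norm_def, eLpNorm_exponent_top]
  have := ENNReal.toReal_mono h2 hx
  simpa using this

theorem IsPrimitive.norm_sub_le {v r : ℝ → ℂ} (hv : IsPrimitive v r) {C : ℝ}
    (h : ∀ᵐ x, ‖r x‖ ≤ C) (x y : ℝ) : ‖v y - v x‖ ≤ C * |y - x| := by
  rw [← hv.2 x y]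
  exact intervalIntegral.norm_integral_le_of_norm_le_const_ae (h.mono fun x hx _ => hx)

theorem BUC.norm_le {α : ℝ} {e : BUC α} {C : ℝ} (hC : 0 ≤ C)
    (h : ∀ x, ‖weight α (BUC.toFun α e) x‖ ≤ C) : ‖e‖ ≤ C :=
  (BoundedContinuousFunction.norm_le hC (f := BUC.weighted α e)).2 h

theorem BUC.norm_weight_le {α : ℝ} (e : BUC α) (x : ℝ) :
    ‖weight α (BUC.toFun α e) x‖ ≤ ‖e‖ :=
  (BUC.weighted α e).norm_coe_le_norm x

/-- The element of `BUC α` with a given weighted function. -/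
def BUC.mk {α : ℝ} {v : ℝ → ℂ} (hv : v ∈ bucSubmodule) : BUC α :=
  ⟨weight (-α) v, by
    rw [Submodule.mem_comap, weight_weight_neg]; exact hv⟩

theorem BUC.weight_mk {α : ℝ} {v : ℝ → ℂ} (hv : v ∈ bucSubmodule) :
    weight α (BUC.toFun α (BUC.mk hv)) = v :=
  weight_weight_neg α v

theorem BUC.range_weighted (α : ℝ) :
    Set.range (BUC.weighted α) = {f : BoundedContinuousFunction ℝ ℂ | UniformContinuous f} := by
  ext f
  constructor
  · rintro ⟨e, rfl⟩
    exact (BUC.weight_mem e).1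
  · intro hf
    have hm : (f : ℝ → ℂ) ∈ bucSubmodule := ⟨hf, ‖f‖, f.norm_coe_le_norm⟩
    refine ⟨BUC.mk hm, ?_⟩
    ext x
    exact congrFun (BUC.weight_mk hm) x

instance (α : ℝ) : CompleteSpace (BUC α) := by
  have hi : Isometry (BUC.weighted α) := AddMonoidHomClass.isometry_of_norm _ fun _ => rfl
  rw [completeSpace_iff_isComplete_range hi.isUniformInducing, BUC.range_weighted]
  refine IsClosed.isComplete (IsSeqClosed.isClosed fun f g hf hfg => ?_)
  exact (BoundedContinuousFunction.tendsto_iff_tendstoUniformly.1 hfg).uniformContinuous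
    (Frequently.of_forall hf)

theorem BUC.memLp {α : ℝ} (e : BUC α) : MemLp (weight α (BUC.toFun α e)) ∞ volume :=
  memLp_top_of_bound (BUC.weight_mem e).1.continuous.aestronglyMeasurable ‖e‖
    (Eventually.of_forall (BUC.norm_weight_le e))

/-- `u ↦ e^{α ξ} u` with values in `L^∞`. -/
def BUC.toLinfty (α : ℝ) : BUC α →L[ℂ] Lp ℂ ∞ (volume : Measure ℝ) :=
  LinearMap.mkContinuous
    { toFun := fun e => (BUC.memLp e).toLp _
      map_add' := fun e e' => by
        rw [← MemLp.toLp_add]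
        refine MemLp.toLp_congr _ _ ?_
        rw [map_add, map_add]
      map_smul' := fun a e => by
        rw [RingHom.id_apply, ← MemLp.toLp_const_smul]
        refine MemLp.toLp_congr _ _ ?_
        rw [map_smul, map_smul] } 1 fun e => by
    rw [one_mul]
    change ‖(BUC.memLp e).toLp _‖ ≤ _
    rw [Lp.norm_toLp, eLpNorm_exponent_top]
    refine ENNReal.toReal_le_of_le_ofReal (norm_nonneg e) ?_
    exact eLpNormEssSup_le_of_ae_bound (Eventually.of_forall (BUC.norm_weight_le e))

/-- A bounded solution of `v'' + t v' = g` with bounded `g` has a bounded derivative. -/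
theorem norm_deriv_le_of_bounded {v r s : ℝ → ℂ} {t : ℂ} (hv : IsPrimitive v r)
    (hr : IsPrimitive r s) {M K : ℝ} (hM : ∀ x, ‖v x‖ ≤ M)
    (hK : ∀ᵐ x, ‖s x + t * r x‖ ≤ K) (x : ℝ) : ‖r x‖ ≤ K + 2 * ‖t‖ * M + 2 * M := by
  have hK0 : 0 ≤ K := by
    obtain ⟨x, hx⟩ := hK.exists
    exact (norm_nonneg _).trans hx
  -- r + t v is Lipschitz with constant K, so over a unit interval r varies by at most K + 2 ‖t‖ M.
  have h1 := (hr.add (hv.const_mul t)).norm_sub_le hK x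
  have h2 : ∀ z ∈ Set.uIoc x (x + 1), ‖r z - r x‖ ≤ K + 2 * ‖t‖ * M := by
    intro z hz
    rw [Set.uIoc_of_le (by linarith)] at hz
    have h3 : ‖r z + t * v z - (r x + t * v x)‖ ≤ K := by
      refine (h1 z).trans ?_
      rw [abs_of_nonneg (by linarith [hz.1])]
      nlinarith [hz.2]
    have e : r z - r x = (r z + t * v z - (r x + t * v x)) - t * v z + t * v x := by ring
    rw [e]
    have h4 : ∀ z, ‖t * v z‖ ≤ ‖t‖ * M := fun z => by
      rw [norm_mul]; gcongr; exact hM z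
    have h5 := norm_add_le ((r z + t * v z - (r x + t * v x)) - t * v z) (t * v x)
    have h6 := norm_sub_le (r z + t * v z - (r x + t * v x)) (t * v z)
    linarith [h4 z, h4 x]
  -- The average of r over [x, x + 1] is v(x + 1) - v(x), at most 2 M in norm. Together with the
  -- bound on the oscillation this bounds r(x).
  have h7 := intervalIntegral.norm_integral_le_of_norm_le_const h2
  rw [intervalIntegral.integral_sub (hr.continuous.intervalIntegrable _ _) (by simp), hv.2,
    intervalIntegral.integral_const, add_sub_cancel_left, abs_one, mul_one, one_smul] at h7
  have e : r x = (v (x + 1) - v x) - (v (x + 1) - v x - r x) := by ring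
  rw [e]
  have h8 := norm_sub_le (v (x + 1) - v x) (v (x + 1) - v x - r x)
  have h9 := norm_sub_le (v (x + 1)) (v x)
  linarith [hM x, hM (x + 1)]

/-- A bounded function with weak derivative in L^∞ is Lipschitz, hence in BUC. Unlike in H¹,
membership in BUC says nothing about the derivative, so `memLp_deriv` rests on the second order
bound above. -/
theorem BUC.isWeightedSpace (α : ℝ) : IsWeightedSpace ∞ α (BUC.toFun α) (BUC.toLinfty α) where
  coe e := (BUC.memLp e).coeFn_toLp
  inj := BUC.toFun_injective α
  cont := BUC.continuous
  lift U V h := by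
    obtain ⟨v, hU, hv⟩ := h
    have hvU : ∀ x, ‖v x‖ ≤ ‖U‖ := norm_le_of_ae_norm_le hv.continuous (by
      filter_upwards [hU, ae_norm_le_norm U] with x h1 h2
      rw [← h1]; exact h2)
    have hm : v ∈ bucSubmodule := by
      refine ⟨?_, ‖U‖, hvU⟩
      have : LipschitzWith ‖V‖₊ v := LipschitzWith.of_dist_le_mul fun x y => by
        rw [dist_eq_norm, Real.dist_eq]
        exact hv.norm_sub_le (ae_norm_le_norm V) y x
      exact this.uniformContinuous
    refine ⟨BUC.mk hm, Lp.ext ?_, ?_⟩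
    · refine (BUC.memLp (BUC.mk hm)).coeFn_toLp.trans ?_
      rw [BUC.weight_mk]; exact hU.symm
    · refine BUC.norm_le (by positivity) fun x => ?_
      rw [BUC.weight_mk]
      linarith [hvU x, norm_nonneg V]
  memLp_deriv e r s t hr hs hg := by
    refine memLp_top_of_bound hs.continuous.aestronglyMeasurable _ (Eventually.of_forall
      (norm_deriv_le_of_bounded (t := t) hr hs (BUC.norm_weight_le e)
        (K := ‖hg.toLp _‖) ?_))
    filter_upwards [ae_norm_le_norm (hg.toLp _), hg.coeFn_toLp] with x h1 h2
    rw [← h2]; exact h1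

end Spaces

/-! ### The coefficients of the linearization -/

section Front

theorem exists_bound_of_tendsto {f : ℝ → ℝ} (hf : Continuous f) {l₁ l₂ : ℝ}
    (h₁ : Tendsto f atBot (𝓝 l₁)) (h₂ : Tendsto f atTop (𝓝 l₂)) : ∃ C, ∀ x, |f x| ≤ C := by
  obtain ⟨m₁, hm₁⟩ := eventually_atBot.1 (h₁.abs.eventually_le_const (lt_add_one |l₁|))
  obtain ⟨m₂, hm₂⟩ := eventually_atTop.1 (h₂.abs.eventually_le_const (lt_add_one |l₂|))
  obtain ⟨K, hK⟩ := (isCompact_Icc (a := m₁) (b := m₂)).exists_bound_of_continuousOn hf.continuousOn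
  refine ⟨max K (max (|l₁| + 1) (|l₂| + 1)), fun x => ?_⟩
  rcases le_total x m₁ with h | h
  · exact (hm₁ x h).trans ((le_max_left _ _).trans (le_max_right _ _))
  · rcases le_total m₂ x with h' | h'
    · exact (hm₂ x h').trans ((le_max_right _ _).trans (le_max_right _ _))
    · exact (hK x ⟨h, h'⟩).trans (le_max_left _ _)

/-! ### Regularity and bounds of the reaction rate -/

namespace IsSmoothedArrhenius

variable {Z σ h Tign δ : ℝ} {F : ℝ → ℝ}

theorem contDiffOn_Ici (hF : IsSmoothedArrhenius Z σ h Tign δ F) (hσ : 0 < σ) (hσ1 : σ < 1)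
    (hT : 0 < Tign) (hδ : 0 < δ) : ContDiffOn ℝ 1 F (Set.Ici (Tign + 2 * δ)) := by
  have h1 : ContDiffOn ℝ 1 (arrhenius Z σ h) (Set.Ici (Tign + 2 * δ)) := by
    unfold arrhenius
    refine ContDiffOn.exp (contDiffOn_const.mul (ContDiffOn.div ?_ ?_ ?_))
    · exact contDiffOn_id.sub contDiffOn_const
    · exact contDiffOn_const.add (contDiffOn_const.mul contDiffOn_id)
    · intro T hT'
      have h2 : 0 < T := lt_of_lt_of_le (by linarith) hT'
      have h3 : 0 < (1 - σ) * T := mul_pos (by linarith) h2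
      positivity
  exact h1.congr fun T hT' => hF.eq_arrhenius T hT'

theorem contDiffOn_Iic (hF : IsSmoothedArrhenius Z σ h Tign δ F) :
    ContDiffOn ℝ 1 F (Set.Iic (Tign + 2 * δ)) :=
  hF.smooth.of_le (by exact_mod_cast le_top)

theorem continuous (hF : IsSmoothedArrhenius Z σ h Tign δ F) (hσ : 0 < σ) (hσ1 : σ < 1)
    (hT : 0 < Tign) (hδ : 0 < δ) : Continuous F := by
  rw [← continuousOn_univ, ← Set.Iic_union_Ici (a := Tign + 2 * δ)]
  exact hF.contDiffOn_Iic.continuousOn.union_of_isClosed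
    (hF.contDiffOn_Ici hσ hσ1 hT hδ).continuousOn isClosed_Iic isClosed_Ici

theorem nonneg (hF : IsSmoothedArrhenius Z σ h Tign δ F) (hδ : 0 < δ) (T : ℝ) : 0 ≤ F T := by
  rcases le_total T Tign with h1 | h1
  · exact (hF.eq_zero T h1).ge
  · rcases le_total T (Tign + 2 * δ) with h2 | h2
    · rw [← hF.eq_zero Tign le_rfl]
      exact hF.monotone ⟨le_rfl, by linarith⟩ ⟨h1, h2⟩ h1
    · rw [hF.eq_arrhenius T h2]
      exact (Real.exp_pos _).le

theorem deriv_eq_zero (hF : IsSmoothedArrhenius Z σ h Tign δ F) {T : ℝ} (hT : T < Tign) :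
    deriv F T = 0 := by
  have h1 : F =ᶠ[𝓝 T] fun _ => 0 :=
    (eventually_lt_nhds hT).mono fun t ht => hF.eq_zero t ht.le
  rw [h1.deriv_eq, deriv_const]

/-- On each closed side of the junction F is C¹ up to the end point, so the one-sided derivative is
bounded on compact sets. The possible corner is a single point, whatever value `deriv` takes there.
-/
theorem exists_deriv_bound (hF : IsSmoothedArrhenius Z σ h Tign δ F) (hσ : 0 < σ) (hσ1 : σ < 1)
    (hT : 0 < Tign) (hδ : 0 < δ) (M : ℝ) : ∃ K, ∀ T, |T| ≤ M → |deriv F T| ≤ K := by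
  set T₀ := Tign + 2 * δ
  have hbound : ∀ s : Set ℝ, IsClosed s → UniqueDiffOn ℝ s → ContDiffOn ℝ 1 F s →
      ∃ K, ∀ T, |T| ≤ M → s ∈ 𝓝 T → |deriv F T| ≤ K := by
    intro s hs hu hc
    obtain ⟨K, hK⟩ := ((isCompact_Icc (a := -M) (b := M)).inter_right hs).exists_bound_of_continuousOn
      ((hc.continuousOn_derivWithin hu le_rfl).mono Set.inter_subset_right)
    refine ⟨K, fun T hTM hTs => ?_⟩
    rw [← derivWithin_of_mem_nhds hTs]
    exact hK T ⟨abs_le.1 hTM, mem_of_mem_nhds hTs⟩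
  obtain ⟨K₁, hK₁⟩ := hbound _ isClosed_Iic (uniqueDiffOn_Iic T₀) hF.contDiffOn_Iic
  obtain ⟨K₂, hK₂⟩ := hbound _ isClosed_Ici (uniqueDiffOn_Ici T₀) (hF.contDiffOn_Ici hσ hσ1 hT hδ)
  refine ⟨max |deriv F T₀| (max K₁ K₂), fun T hTM => ?_⟩
  rcases lt_trichotomy T T₀ with hlt | rfl | hgt
  · exact (hK₁ T hTM (Iic_mem_nhds hlt)).trans ((le_max_left _ _).trans (le_max_right _ _))
  · exact le_max_left _ _
  · exact (hK₂ T hTM (Ici_mem_nhds hgt)).trans ((le_max_right _ _).trans (le_max_right _ _))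

end IsSmoothedArrhenius

/-! ### The coefficients along the front and their limits -/

namespace IsFront

variable {F : ℝ → ℝ} {h c : ℝ} {u y : ℝ → ℝ}

theorem continuous_temperature (hf : IsFront F h c u y) : Continuous (temperature h u y) := by
  have h1 := hf.contDiff_u.continuous
  have h2 := hf.contDiff_y.continuous
  unfold temperature
  fun_prop

theorem temperature_atBot (hf : IsFront F h c u y) :
    Tendsto (temperature h u y) atBot (𝓝 1) := by
  have := (hf.u_atBot.const_mul h).add ((hf.y_atBot.const_sub 1).const_mul (1 - h))
  rwa [show h * 1 + (1 - h) * (1 - 0) = 1 by ring] at this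

theorem temperature_atTop (hf : IsFront F h c u y) :
    Tendsto (temperature h u y) atTop (𝓝 0) := by
  have := (hf.u_atTop.const_mul h).add ((hf.y_atTop.const_sub 1).const_mul (1 - h))
  rwa [show h * 0 + (1 - h) * (1 - 1) = 0 by ring] at this

theorem exists_temperature_bound (hf : IsFront F h c u y) :
    ∃ M, ∀ ξ, |temperature h u y ξ| ≤ M :=
  exists_bound_of_tendsto hf.continuous_temperature hf.temperature_atBot hf.temperature_atTop

theorem measurable_coeff (hf : IsFront F h c u y) :
    AEStronglyMeasurable (fun ξ => ((deriv F (temperature h u y ξ) * y ξ : ℝ) : ℂ)) volume := by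
  have h1 : Measurable fun ξ => deriv F (temperature h u y ξ) :=
    (measurable_deriv F).comp hf.continuous_temperature.measurable
  exact (Complex.measurable_ofReal.comp
    (h1.mul hf.contDiff_y.continuous.measurable)).aestronglyMeasurable

variable {Z σ Tign δ : ℝ}

theorem exists_coeff_le (hf : IsFront F h c u y) (hF : IsSmoothedArrhenius Z σ h Tign δ F)
    (hσ : 0 < σ) (hσ1 : σ < 1) (hT : 0 < Tign) (hδ : 0 < δ) :
    ∃ K, 0 ≤ K ∧ ∀ ξ, ‖((deriv F (temperature h u y ξ) * y ξ : ℝ) : ℂ)‖ ≤ K * |y ξ| := by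
  obtain ⟨M, hM⟩ := hf.exists_temperature_bound
  obtain ⟨K, hK⟩ := hF.exists_deriv_bound hσ hσ1 hT hδ M
  refine ⟨K, (abs_nonneg _).trans (hK _ (hM 0)), fun ξ => ?_⟩
  rw [Complex.norm_real, Real.norm_eq_abs, abs_mul]
  gcongr
  exact hK _ (hM ξ)

/-- Far to the right the temperature is below ignition and F' vanishes identically, so no decay of y
is needed; indeed y → 1 there. -/
theorem coeff_atTop (hf : IsFront F h c u y) (hF : IsSmoothedArrhenius Z σ h Tign δ F)
    (hT : 0 < Tign) :
    Tendsto (fun ξ => ((deriv F (temperature h u y ξ) * y ξ : ℝ) : ℂ)) atTop (𝓝 0) := by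
  refine tendsto_const_nhds.congr' ?_
  filter_upwards [hf.temperature_atTop.eventually_lt_const hT] with ξ hξ
  rw [hF.deriv_eq_zero hξ, zero_mul, Complex.ofReal_zero]

/-- Here F' need not be small near w = 1; the decay comes from y → 0 while F' stays bounded along
the front. -/
theorem coeff_atBot (hf : IsFront F h c u y) (hF : IsSmoothedArrhenius Z σ h Tign δ F)
    (hσ : 0 < σ) (hσ1 : σ < 1) (hT : 0 < Tign) (hδ : 0 < δ) :
    Tendsto (fun ξ => ((deriv F (temperature h u y ξ) * y ξ : ℝ) : ℂ)) atBot (𝓝 0) := by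
  obtain ⟨K, -, hK⟩ := hf.exists_coeff_le hF hσ hσ1 hT hδ
  refine squeeze_zero_norm hK ?_
  have := hf.y_atBot.abs.const_mul K
  simpa using this

theorem exists_coeff_bound (hf : IsFront F h c u y) (hF : IsSmoothedArrhenius Z σ h Tign δ F)
    (hσ : 0 < σ) (hσ1 : σ < 1) (hT : 0 < Tign) (hδ : 0 < δ) :
    ∃ C, ∀ ξ, ‖((deriv F (temperature h u y ξ) * y ξ : ℝ) : ℂ)‖ ≤ C := by
  obtain ⟨K, hK0, hK⟩ := hf.exists_coeff_le hF hσ hσ1 hT hδ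
  obtain ⟨Y, hY⟩ := exists_bound_of_tendsto hf.contDiff_y.continuous hf.y_atBot hf.y_atTop
  exact ⟨K * Y, fun ξ => (hK ξ).trans (mul_le_mul_of_nonneg_left (hY ξ) hK0)⟩

theorem exists_rate_bound (hf : IsFront F h c u y) (hF : Continuous F) :
    ∃ C, ∀ ξ, ‖(F (temperature h u y ξ) : ℂ)‖ ≤ C := by
  obtain ⟨M, hM⟩ := hf.exists_temperature_bound
  obtain ⟨C, hC⟩ := (isCompact_Icc (a := -M) (b := M)).exists_bound_of_continuousOn hF.continuousOn
  exact ⟨C, fun ξ => by rw [Complex.norm_real]; exact hC _ (abs_le.1 (hM ξ))⟩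

end IsFront

open ENNReal in
/-- In a weighted space modelled on `L²` or `L^∞` the essential spectrum of the linearization lies to
the left of the spectrum of the weighted diffusion operator. -/
theorem IsWeightedSpace.essentialSpectrum_re_le {Z σ Tign δ : ℝ} {F : ℝ → ℝ} {u y : ℝ → ℝ}
    {p : ℝ≥0∞} [Fact (1 ≤ p)] (hp : p = 2 ∨ p = ∞) (k : SystemCoeffs)
    {E : Type} [NormedAddCommGroup E] [NormedSpace ℂ E] [CompleteSpace E]
    {ι : E →ₗ[ℂ] (ℝ → ℂ)} {j : E →L[ℂ] Lp ℂ p (volume : Measure ℝ)}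
    (hE : IsWeightedSpace p k.α ι j) (hσ : 0 < σ) (hσ1 : σ < 1) (hT : 0 < Tign) (hδ : 0 < δ)
    (hF : IsSmoothedArrhenius Z σ k.h Tign δ F) (hf : IsFront F k.h k.c u y) {z : ℂ}
    (hz : z ∈ essentialSpectrum (linearization ι F k.h k.c u y)) : z.re ≤ -k.m := by
  have hFc := hF.continuous hσ hσ1 hT hδ
  have hβc : Continuous fun ξ => F (temperature k.h u y ξ) := hFc.comp hf.continuous_temperature
  have hbm : AEStronglyMeasurable (fun ξ => (F (temperature k.h u y ξ) : ℂ)) volume :=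
    (Complex.continuous_ofReal.comp hβc).aestronglyMeasurable
  obtain ⟨Cb, hCb⟩ := hf.exists_rate_bound hFc
  obtain ⟨Ca, hCa⟩ := hf.exists_coeff_bound hF hσ hσ1 hT hδ
  -- Nonnegativity of F makes B a damping term in the second equation, so it needs no decay at -∞
  -- and stays in the unperturbed operator.
  have h𝓓 := isDerivation_weakDeriv hp hβc (fun ξ => hF.nonneg hδ _) hbm hCb
  have hA := isApproximable_mulOp hp hf.measurable_coeff hCa (hf.coeff_atBot hF hσ hσ1 hT hδ)
    (hf.coeff_atTop hF hT)
  by_contra! hlt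
  exact (isPartOf_linearization hE hf.measurable_coeff hCa hbm hCb h𝓓).notMem_essentialSpectrum
    (systemGraph_single h𝓓) (Ω := {z : ℂ | -k.m < z.re})
    (convex_halfSpace_re_gt (-k.m)).isPreconnected
    (fun z₀ hz₀ => exists_system_parametrix h𝓓 hA hz₀) (exists_system_injective h𝓓) hlt hz

end Front

end CombustionFront

end

/-! ### The essential spectrum on both weighted spaces -/

theorem mainTheorem2 (Z σ h Tign δ : ℝ) (hZ : 0 < Z) (hσ : 0 < σ) (hσ1 : σ < 1)
    (hh : 0 < h) (hh1 : h < 1) (hT : 0 < Tign) (hT1 : Tign < 1) (hδ : 0 < δ)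
    (F : ℝ → ℝ) (hF : CombustionFront.IsSmoothedArrhenius Z σ h Tign δ F)
    (c : ℝ) (u y : ℝ → ℝ) (hfront : CombustionFront.IsFront F h c u y)
    (α : ℝ) (hα : 0 < α) (hαc : α < c / 2) :
    ∃ ν : ℝ, 0 < ν ∧
      (∀ z ∈ CombustionFront.essentialSpectrum
        (CombustionFront.linearizationH1 α F h c u y), z.re ≤ -ν) ∧
      (∀ z ∈ CombustionFront.essentialSpectrum
        (CombustionFront.linearizationBUC α F h c u y), z.re ≤ -ν) := by
  let k : CombustionFront.SystemCoeffs := ⟨c, α, h, hα, hαc⟩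
  -- The same ν = α (c - α) serves both spaces; H¹ uses p = 2 and BUC uses p = ∞.
  exact ⟨k.m, k.m_pos,
    fun z hz => (CombustionFront.H1.isWeightedSpace α).essentialSpectrum_re_le (Or.inl rfl) k
      hσ hσ1 hT hδ hF hfront hz,
    fun z hz => (CombustionFront.BUC.isWeightedSpace α).essentialSpectrum_re_le (Or.inr rfl) k
      hσ hσ1 hT hδ hF hfront hz⟩
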